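/- Let $0<k<n$ be integers and let $K$ be a field containing a primitive $n$-th root of unity, so that $G=\{\zeta\in K^\times:\zeta^n=1\}$ is cyclic of order $n$. Let $\zeta\in G$ act on $R=K[[x,y]]/(x^k-y^{n-k})$ by $x\mapsto\zeta x$, $y\mapsto\zeta^{-1}y$, let $A=R*G$ be the twisted group ring, and let $Z=K[[t]]$ with $t=xy$, a central subring of $A$. Let $\mathrm{CM}(A)$ be the category of Cohen–Macaulay $A$-modules, that is, finitely generated left $A$-modules that are free over $Z$, with the exact structure inherited from $A$-modules. The rank $\operatorname{rk}M$ of an $A$-module $M$ is the length of $M\otimes_Z\operatorname{Frac}(Z)$ as a module over $A\otimes_Z\operatorname{Frac}(Z)$. For $j\in\mathbb Z/n$ let $e_j=\frac1n\sum_{\zeta\in G}\zeta^{-j}\zeta\in A$ (so $xe_j=e_{j+1}x$, $ye_{j+1}=e_jy$ and $e_n=e_0$), let $(e_n)$ be the two-sided ideal generated by $e_n$, and let $P_n=Ae_n$. Let $\Pi$ be the preprojective algebra of type $A_{n-1}$ over $K$: the path algebra of the quiver with vertices $1,\dots,n-1$ and arrows $x\colon i\to i+1$, $y\colon i+1\to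 i$, modulo the relation $xy=yx$ at each vertex (a path that leaves the quiver being $0$); left modules are representations. Let $Q_k=\operatorname{Hom}_K(e_k\Pi,K)$ be the indecomposable injective $\Pi$-module whose socle is the simple module at vertex $k$, and let $\operatorname{Sub}Q_k$ be the category of finite-dimensional $\Pi$-modules isomorphic to a submodule of a finite direct sum of copies of $Q_k$. Sending vertices and arrows to vertices and arrows gives an algebra homomorphism $\Pi\to A/(e_n)$, through which $\pi M=M/(e_n)M$ is a $\Pi$-module for every $A$-module $M$. **Theorem.** The module $P_n$ lies in $\mathrm{CM}(A)$ and is projective and injective there. The functor $M\mapsto\pi M$ restricts to an exact functor $\pi\colon\mathrm{CM}(A)\to\operatorname{Sub}Q_k$ (it takes short exact sequences of modules in $\mathrm{CM}(A)$ to short exact sequences). A map $f$ in $\mathrm{CM}(A)$ satisfies $\pi f=0$ if and only if it lies in the ideal generated by $P_n$, i.e. factors through a finite direct sum of copies of $P_n$, and $\pi$ induces an equivalence from the quotient category of $\mathrm{CM}(A)$ by this ideal to $\operatorname{Sub}Q_k$. Moreover, for every $N$ in $\operatorname{Sub}Q_k$ there is, up to isomorphism, a unique minimal $M$ in $\mathrm{CM}(A)$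 with $\pi M\cong N$, where minimal means that $M$ has no direct summand isomorphic to $P_n$. Every minimal $M$ in $\mathrm{CM}(A)$ satisfies $$\operatorname{rk}M=\dim_K\operatorname{soc}\pi M .$$ -/

import Mathlib

open CategoryTheory TensorProduct

universe u

noncomputable section

namespace GrassCM

/-! ### The twisted group ring of the complete plane curve singularity `x ^ k = y ^ (n - k)` -/

/-- The group `G` of `n`-th roots of unity in the field `K`. (A type synonym, so that the scalar
action of roots of unity on `K`-vector spaces is not used by accident.) -/
def Grp (K : Type u) [Field K] (n : ℕ) : Type u := rootsOfUnity n K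

instance (K : Type u) [Field K] (n : ℕ) : CommGroup (Grp K n) :=
  inferInstanceAs (CommGroup (rootsOfUnity n K))

instance (K : Type u) [Field K] (n : ℕ) [NeZero n] : Fintype (Grp K n) :=
  haveI : Finite (Grp K n) := inferInstanceAs (Finite (rootsOfUnity n K))
  Fintype.ofFinite _

/-- The inclusion of `G` in the multiplicative group of the field. -/
def Grp.val {K : Type u} [Field K] {n : ℕ} : Grp K n →* Kˣ := (rootsOfUnity n K).subtype

/-- The curve ring `R = K[[x, y]] / (x ^ k - y ^ (n - k))`, with `x`, `y` the variables of
index `0`, `1`. -/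
def CurveRing (K : Type u) [Field K] (n : ℕ) (k : Fin n) : Type u :=
  MvPowerSeries (Fin 2) K ⧸
    Ideal.span {(MvPowerSeries.X 0 ^ (k : ℕ) - MvPowerSeries.X 1 ^ (n - (k : ℕ)) :
      MvPowerSeries (Fin 2) K)}

section Curve

variable (K : Type u) [Field K] (n : ℕ) (k : Fin n)

instance : CommRing (CurveRing K n k) :=
  inferInstanceAs (CommRing (MvPowerSeries (Fin 2) K ⧸ Ideal.span _))

/-- The quotient map `K[[x, y]] → R`. -/
def CurveRing.mk : MvPowerSeries (Fin 2) K →+* CurveRing K n k :=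
  Ideal.Quotient.mk _

/-- The weights `(ζ, ζ⁻¹)` by which the group element `ζ` scales `(x, y)`. -/
def weight (g : Grp K n) : Fin 2 → K := ![(g.val : K), ((g.val⁻¹ : Kˣ) : K)]

variable {K n} in
lemma val_pow (g : Grp K n) : (Grp.val g) ^ n = 1 := g.2

/-- The automorphism of `R` with `x ↦ ζ x`, `y ↦ ζ⁻¹ y`. -/
def actHom (g : Grp K n) : CurveRing K n k →+* CurveRing K n k :=
  Ideal.quotientMap _ (MvPowerSeries.rescale (weight K n g)) (by
    rw [Ideal.span_le, Set.singleton_subset_iff]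
    have hX : ∀ i : Fin 2, MvPowerSeries.rescale (weight K n g)
        (MvPowerSeries.X i : MvPowerSeries (Fin 2) K) =
        MvPowerSeries.C (weight K n g i) * MvPowerSeries.X i := by
      intro i
      rw [← MvPowerSeries.smul_eq_C_mul]
      ext m
      rw [MvPowerSeries.coeff_rescale, MvPowerSeries.coeff_smul, MvPowerSeries.coeff_X]
      split_ifs with h
      · subst h; simp
      · simp
    have hw : (((Grp.val g)⁻¹ : Kˣ) : K) ^ (n - (k : ℕ)) = (Grp.val g : K) ^ (k : ℕ) := by
      have h1 : ((Grp.val g)⁻¹) ^ (n - (k : ℕ)) = (Grp.val g) ^ (k : ℕ) := by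
        rw [inv_pow, inv_eq_iff_mul_eq_one, ← pow_add, Nat.sub_add_cancel k.isLt.le, val_pow]
      exact_mod_cast congrArg (Units.val) h1
    simp only [SetLike.mem_coe, Ideal.mem_comap, map_sub, map_pow, hX]
    have : (MvPowerSeries.C (weight K n g 0) * MvPowerSeries.X 0) ^ (k : ℕ) -
        (MvPowerSeries.C (weight K n g 1) * MvPowerSeries.X 1) ^ (n - (k : ℕ)) =
        MvPowerSeries.C ((Grp.val g : K) ^ (k : ℕ)) *
          (MvPowerSeries.X 0 ^ (k : ℕ) - MvPowerSeries.X 1 ^ (n - (k : ℕ)) :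
            MvPowerSeries (Fin 2) K) := by
      rw [mul_pow, mul_pow, ← map_pow, ← map_pow, mul_sub]
      simp only [weight, Matrix.cons_val_zero, Matrix.cons_val_one, hw]
    rw [this]
    exact Ideal.mul_mem_left _ _ (Ideal.subset_span rfl))

lemma actHom_mk (g : Grp K n) (f : MvPowerSeries (Fin 2) K) :
    actHom K n k g (CurveRing.mk K n k f) =
      CurveRing.mk K n k (MvPowerSeries.rescale (weight K n g) f) :=
  Ideal.quotientMap_mk

lemma CurveRing.mk_surjective : Function.Surjective (CurveRing.mk K n k) :=
  Ideal.Quotient.mk_surjective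

/-- The action of `G` on `R` by ring automorphisms. -/
instance : MulSemiringAction (Grp K n) (CurveRing K n k) where
  smul g := actHom K n k g
  one_smul r := by
    obtain ⟨f, rfl⟩ := CurveRing.mk_surjective K n k r
    change actHom K n k 1 _ = _
    have : weight K n 1 = 1 := by ext i; fin_cases i <;> simp [weight]
    rw [actHom_mk, this, MvPowerSeries.rescale_one, RingHom.id_apply]
  mul_smul g h r := by
    obtain ⟨f, rfl⟩ := CurveRing.mk_surjective K n k r
    change actHom K n k (g * h) _ = actHom K n k g (actHom K n k h _)
    have : weight K n (g * h) = weight K n h * weight K n g := by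
      ext i; fin_cases i <;> simp [weight, mul_comm]
    rw [actHom_mk, actHom_mk, actHom_mk, this, MvPowerSeries.rescale_mul, RingHom.comp_apply]
  smul_zero g := map_zero (actHom K n k g)
  smul_add g := map_add (actHom K n k g)
  smul_one g := map_one (actHom K n k g)
  smul_mul g := map_mul (actHom K n k g)

lemma smul_mk (g : Grp K n) (f : MvPowerSeries (Fin 2) K) :
    g • (CurveRing.mk K n k f) =
      CurveRing.mk K n k (MvPowerSeries.rescale (weight K n g) f) :=
  actHom_mk K n k g f

lemma hasSubst_t : PowerSeries.HasSubst
    (MvPowerSeries.X 0 * MvPowerSeries.X 1 : MvPowerSeries (Fin 2) K) :=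
  PowerSeries.HasSubst.of_constantCoeff_zero (by simp)

/-- The ring homomorphism `Z = K[[t]] → R` with `t ↦ x y`. -/
def tHom : PowerSeries K →+* CurveRing K n k :=
  (CurveRing.mk K n k).comp (PowerSeries.substAlgHom (hasSubst_t K)).toRingHom

lemma rescale_X (g : Grp K n) (i : Fin 2) : MvPowerSeries.rescale (weight K n g)
    (MvPowerSeries.X i : MvPowerSeries (Fin 2) K) =
      weight K n g i • MvPowerSeries.X i := by
  ext m
  rw [MvPowerSeries.coeff_rescale, MvPowerSeries.coeff_smul, MvPowerSeries.coeff_X]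
  split_ifs with h
  · subst h; simp
  · simp

lemma smul_tHom (g : Grp K n) (c : PowerSeries K) : g • tHom K n k c = tHom K n k c := by
  change g • CurveRing.mk K n k (PowerSeries.substAlgHom (hasSubst_t K) c) =
    CurveRing.mk K n k (PowerSeries.substAlgHom (hasSubst_t K) c)
  rw [smul_mk, PowerSeries.coe_substAlgHom, MvPowerSeries.rescale_eq_subst]
  congr 1
  rw [PowerSeries.subst_def,
    MvPowerSeries.subst_comp_subst_apply (hasSubst_t K).const (MvPowerSeries.HasSubst.smul_X _)]
  congr 1
  funext _
  rw [← MvPowerSeries.rescale_eq_subst, map_mul, rescale_X, rescale_X]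
  simp [weight, smul_smul]

/-- The twisted group ring `A = R * G`: free left `R`-module on `G`, with
`(r g) (s h) = (r (g • s)) (g h)`. -/
def TwistedRing : Type u := SkewMonoidAlgebra (CurveRing K n k) (Grp K n)

instance : Ring (TwistedRing K n k) :=
  inferInstanceAs (Ring (SkewMonoidAlgebra (CurveRing K n k) (Grp K n)))

/-- The element `r g` of `A`. -/
def TwistedRing.single (g : Grp K n) (r : CurveRing K n k) : TwistedRing K n k :=
  SkewMonoidAlgebra.single g r

lemma single_mul_single (g h : Grp K n) (r s : CurveRing K n k) :
    TwistedRing.single K n k g r * TwistedRing.single K n k h s =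
      TwistedRing.single K n k (g * h) (r * g • s) :=
  SkewMonoidAlgebra.single_mul_single

/-- The inclusion `R → A`. -/
def ofR : CurveRing K n k →+* TwistedRing K n k where
  toFun r := TwistedRing.single K n k 1 r
  map_one' := rfl
  map_zero' := SkewMonoidAlgebra.single_zero_right _
  map_add' r s := SkewMonoidAlgebra.single_add _ _ _
  map_mul' r s := by rw [single_mul_single]; simp

/-- The inclusion `G → A`. -/
def ofG : Grp K n →* TwistedRing K n k where
  toFun g := TwistedRing.single K n k g 1
  map_one' := rfl
  map_mul' g h := by rw [single_mul_single]; simp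

lemma ofG_mul_ofR (g : Grp K n) (r : CurveRing K n k) :
    ofG K n k g * ofR K n k r = ofR K n k (g • r) * ofG K n k g := by
  change TwistedRing.single K n k g 1 * TwistedRing.single K n k 1 r =
    TwistedRing.single K n k 1 (g • r) * TwistedRing.single K n k g 1
  rw [single_mul_single, single_mul_single]; simp

lemma TwistedRing.induction {p : TwistedRing K n k → Prop} (a : TwistedRing K n k) (h0 : p 0)
    (h1 : ∀ g r, p (TwistedRing.single K n k g r)) (h2 : ∀ a b, p a → p b → p (a + b)) : p a :=
  SkewMonoidAlgebra.induction_on a h0 h1 h2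

lemma ofR_tHom_comm (c : PowerSeries K) (a : TwistedRing K n k) :
    ofR K n k (tHom K n k c) * a = a * ofR K n k (tHom K n k c) := by
  induction a using TwistedRing.induction with
  | h0 => rw [mul_zero, zero_mul]
  | h1 g r =>
    change TwistedRing.single K n k 1 _ * _ = _ * TwistedRing.single K n k 1 _
    rw [single_mul_single, single_mul_single, smul_tHom, one_smul, one_mul, mul_one, mul_comm]
  | h2 a b ha hb => rw [mul_add, add_mul, ha, hb]

/-- `A` is an algebra over `Z = K[[t]]`, with `t` acting as `x y`. -/
instance instAlgebraZ : Algebra (PowerSeries K) (TwistedRing K n k) :=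
  ((ofR K n k).comp (tHom K n k)).toAlgebra' fun c a => ofR_tHom_comm K n k c a

/-- `A` is a `K`-algebra, with `K ⊆ K[[t]]`. -/
instance instAlgebraK : Algebra K (TwistedRing K n k) :=
  ((ofR K n k).comp ((tHom K n k).comp PowerSeries.C)).toAlgebra'
    fun c a => ofR_tHom_comm K n k (PowerSeries.C c) a

/-- The element `x` of `A`. -/
def xA : TwistedRing K n k := ofR K n k (CurveRing.mk K n k (MvPowerSeries.X 0))

/-- The element `y` of `A`. -/
def yA : TwistedRing K n k := ofR K n k (CurveRing.mk K n k (MvPowerSeries.X 1))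

lemma algebraMap_eq (c : K) : algebraMap K (TwistedRing K n k) c =
    ofR K n k (CurveRing.mk K n k (algebraMap K (MvPowerSeries (Fin 2) K) c)) := by
  change ofR K n k (CurveRing.mk K n k
    (PowerSeries.substAlgHom (hasSubst_t K) (algebraMap K (PowerSeries K) c))) = _
  rw [AlgHom.commutes]

lemma smul_ofR_mk (c : K) (f : MvPowerSeries (Fin 2) K) (a : TwistedRing K n k) :
    ofR K n k (CurveRing.mk K n k (c • f)) * a = c • (ofR K n k (CurveRing.mk K n k f) * a) := by
  rw [Algebra.smul_def, Algebra.smul_def, algebraMap_eq, map_mul, map_mul, mul_assoc]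

lemma ofG_mul_xA (g : Grp K n) :
    ofG K n k g * xA K n k = (Grp.val g : K) • (xA K n k * ofG K n k g) := by
  rw [xA, ofG_mul_ofR, smul_mk, rescale_X, smul_ofR_mk]
  rfl

lemma ofG_mul_yA (g : Grp K n) :
    ofG K n k g * yA K n k = ((Grp.val g)⁻¹ : K) • (yA K n k * ofG K n k g) := by
  rw [yA, ofG_mul_ofR, smul_mk, rescale_X, smul_ofR_mk]
  simp [weight]

lemma xA_mul_yA : xA K n k * yA K n k = yA K n k * xA K n k := by
  rw [xA, yA, ← map_mul, ← map_mul, mul_comm, map_mul, map_mul]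

lemma val_pow' (g : Grp K n) : (Grp.val g : K) ^ n = 1 := by
  rw [← Units.val_pow_eq_pow_val, val_pow, Units.val_one]

variable [NeZero n]

/-- The vertex idempotent `e_j = (1/n) ∑_ζ ζ^{-j} ζ` of `A`, for `j` modulo `n`: it projects an
`A`-module to the subspace where `G` acts by the character `ζ ↦ ζ ^ j`. In particular
`x e_j = e_{j+1} x` and `y e_{j+1} = e_j y`, and `e_n = e_0`. -/
def idem (j : ℕ) : TwistedRing K n k :=
  (n : K)⁻¹ • ∑ g : Grp K n, ((Grp.val g)⁻¹ : K) ^ j • ofG K n k g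

lemma idem_mul_xA (j : ℕ) : idem K n k (j + 1) * xA K n k = xA K n k * idem K n k j := by
  simp only [idem, smul_mul_assoc, mul_smul_comm, Finset.sum_mul, Finset.mul_sum, ofG_mul_xA,
    smul_smul]
  congr 1
  refine Finset.sum_congr rfl fun g _ => ?_
  congr 1
  rw [pow_succ, mul_assoc, inv_mul_cancel₀ (Units.ne_zero _), mul_one]

lemma idem_mul_yA (j : ℕ) : idem K n k j * yA K n k = yA K n k * idem K n k (j + 1) := by
  simp only [idem, smul_mul_assoc, mul_smul_comm, Finset.sum_mul, Finset.mul_sum, ofG_mul_yA,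
    smul_smul, pow_succ]

lemma idem_self : idem K n k n = idem K n k 0 := by
  simp only [idem]
  congr 1
  refine Finset.sum_congr rfl fun g _ => ?_
  rw [inv_pow, val_pow', inv_one, pow_zero]

lemma idem_mul_idem (i j : ℕ) : idem K n k i * idem K n k j =
    ((n : K)⁻¹ * ∑ g : Grp K n, ((Grp.val g)⁻¹ : K) ^ i * (Grp.val g : K) ^ j) •
      idem K n k j := by
  have key : (∑ g : Grp K n, ((Grp.val g)⁻¹ : K) ^ i • ofG K n k g) *
      (∑ g : Grp K n, ((Grp.val g)⁻¹ : K) ^ j • ofG K n k g) =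
      (∑ g : Grp K n, ((Grp.val g)⁻¹ : K) ^ i * (Grp.val g : K) ^ j) •
        ∑ g : Grp K n, ((Grp.val g)⁻¹ : K) ^ j • ofG K n k g := by
    rw [Finset.sum_mul, Finset.sum_smul]
    refine Finset.sum_congr rfl fun g _ => ?_
    rw [Finset.mul_sum, Finset.smul_sum, ← Equiv.sum_comp (Equiv.mulLeft g⁻¹)]
    refine Finset.sum_congr rfl fun h _ => ?_
    rw [smul_mul_smul_comm, ← map_mul, smul_smul, Equiv.coe_mulLeft, mul_inv_cancel_left]
    congr 1
    simp only [map_mul, map_inv, Units.val_mul, Units.val_inv_eq_inv_val, mul_inv, inv_inv,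
      mul_pow]
    ring
  simp only [idem]
  rw [smul_mul_smul_comm, key, smul_smul, smul_smul]
  congr 1
  ring

variable [HasEnoughRootsOfUnity K n]

lemma natCast_ne_zero : (n : K) ≠ 0 := by
  obtain ⟨z, hz⟩ := HasEnoughRootsOfUnity.exists_primitiveRoot K n
  exact hz.neZero'.out

lemma card_grp : Fintype.card (Grp K n) = n := by
  obtain ⟨z, hz⟩ := HasEnoughRootsOfUnity.exists_primitiveRoot K n
  rw [← Nat.card_eq_fintype_card]
  exact hz.card_rootsOfUnity

lemma idem_mul_idem_self (i : ℕ) : idem K n k i * idem K n k i = idem K n k i := by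
  rw [idem_mul_idem]
  have : ∀ g : Grp K n, ((Grp.val g)⁻¹ : K) ^ i * (Grp.val g : K) ^ i = 1 := fun g => by
    rw [← mul_pow, inv_mul_cancel₀ (Units.ne_zero _), one_pow]
  rw [Finset.sum_congr rfl fun g _ => this g]
  simp [card_grp, natCast_ne_zero K n]

lemma mesh_A (i : ℕ) :
    idem K n k (i + 1) * xA K n k * idem K n k i *
        (idem K n k i * yA K n k * idem K n k (i + 1)) =
      idem K n k (i + 1) * yA K n k * idem K n k (i + 1 + 1) *
        (idem K n k (i + 1 + 1) * xA K n k * idem K n k (i + 1)) := by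
  have h := idem_mul_idem_self K n k
  have e1 : idem K n k (i + 1) * xA K n k * idem K n k i *
      (idem K n k i * yA K n k * idem K n k (i + 1)) =
      idem K n k (i + 1) * (xA K n k * yA K n k) * idem K n k (i + 1) := by
    rw [idem_mul_xA, idem_mul_yA, mul_assoc (xA K n k), h, mul_assoc (yA K n k), h,
      ← idem_mul_xA, ← mul_assoc]
    simp only [mul_assoc]
  have e2 : idem K n k (i + 1) * yA K n k * idem K n k (i + 1 + 1) *
      (idem K n k (i + 1 + 1) * xA K n k * idem K n k (i + 1)) =
      idem K n k (i + 1) * (yA K n k * xA K n k) * idem K n k (i + 1) := by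
    rw [idem_mul_xA, idem_mul_yA, mul_assoc (xA K n k), h, mul_assoc (yA K n k), h,
      ← idem_mul_yA, ← mul_assoc]
    simp only [mul_assoc]
  rw [e1, e2, xA_mul_yA]

lemma idem_mul_idem_ne {i j : ℕ} (hi : i < n) (hj : j < n) (hij : i ≠ j) :
    idem K n k i * idem K n k j = 0 := by
  rw [idem_mul_idem]
  let φ : Grp K n →* K :=
    { toFun := fun g => ((Grp.val g)⁻¹ : K) ^ i * (Grp.val g : K) ^ j
      map_one' := by simp
      map_mul' := fun g h => by simp only [map_mul, Units.val_mul, mul_inv, mul_pow]; ring }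
  have hφ : φ ≠ 1 := by
    intro h
    obtain ⟨z, hz⟩ := HasEnoughRootsOfUnity.exists_primitiveRoot K n
    have h1 := DFunLike.congr_fun h (hz.toRootsOfUnity : Grp K n)
    have hz0 : z ≠ 0 := hz.ne_zero (NeZero.ne n)
    have h2 : (z⁻¹) ^ i * z ^ j = 1 := h1
    have h3 : z ^ j = z ^ i := by
      rw [inv_pow] at h2
      field_simp at h2
      exact h2
    exact hij (hz.pow_inj hi hj h3.symm)
  have := sum_hom_units_eq_zero φ hφ
  change ((n : K)⁻¹ * ∑ g : Grp K n, φ g) • _ = _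
  rw [this]; simp

lemma sum_idem : ∑ j ∈ Finset.range n, idem K n k j = 1 := by
  simp only [idem]
  rw [← Finset.smul_sum, Finset.sum_comm]
  simp only [← Finset.sum_smul]
  rw [Finset.sum_eq_single (1 : Grp K n)]
  · simp [smul_smul, natCast_ne_zero K n]
  · intro g _ hg
    have h1 : ((Grp.val g)⁻¹ : K) ≠ 1 := by
      intro h
      apply hg
      have : Grp.val g = 1 := by
        ext
        simpa using h
      exact Subtype.ext this
    have h2 := mul_neg_geom_sum ((Grp.val g)⁻¹ : K) n
    rw [inv_pow, val_pow', inv_one, sub_self] at h2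
    rw [(mul_eq_zero.mp h2).resolve_left (sub_ne_zero.mpr h1.symm), zero_smul]
  · simp

end Curve

/-! ### The preprojective algebra of type `A_{n-1}` and the category `Sub Q_k` -/

/-- Generators of the path algebra of the double quiver of the linear graph
`1 - 2 - ... - (n-1)`: the vertex idempotents `e i`, the arrows `x i : i → i + 1` and
`y i : i + 1 → i`. -/
inductive PGen : Type
  | e (i : ℕ)
  | x (i : ℕ)
  | y (i : ℕ)

/-- The generators in the free algebra. -/
abbrev gen (K : Type u) [Field K] (a : PGen) : FreeAlgebra K PGen := FreeAlgebra.ι K a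

open PGen in
/-- The relations of the preprojective algebra of type `A_{n-1}`. The vertices are `1, ..., n-1`:
all other `e i` are zero, and hence so are the arrows that begin or end outside this range. Paths
are composed like functions, so that left modules are representations of the quiver. -/
inductive PreprojRel (K : Type u) [Field K] (n : ℕ) :
    FreeAlgebra K PGen → FreeAlgebra K PGen → Prop
  | outside (i : ℕ) (h : i = 0 ∨ n ≤ i) : PreprojRel K n (gen K (e i)) 0
  | idem (i : ℕ) : PreprojRel K n (gen K (e i) * gen K (e i)) (gen K (e i))
  | orth (i j : ℕ) (h : i ≠ j) : PreprojRel K n (gen K (e i) * gen K (e j)) 0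
  | one : PreprojRel K n (∑ i ∈ Finset.Ioo 0 n, gen K (e i)) 1
  | source_target_x (i : ℕ) :
      PreprojRel K n (gen K (e (i + 1)) * gen K (x i) * gen K (e i)) (gen K (x i))
  | source_target_y (i : ℕ) :
      PreprojRel K n (gen K (e i) * gen K (y i) * gen K (e (i + 1))) (gen K (y i))
  | mesh (i : ℕ) :
      PreprojRel K n (gen K (x i) * gen K (y i)) (gen K (y (i + 1)) * gen K (x (i + 1)))

/-- The preprojective algebra `Π` of type `A_{n-1}`. -/
def Preproj (K : Type u) [Field K] (n : ℕ) : Type u := RingQuot (PreprojRel K n)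

section Preproj

variable (K : Type u) [Field K] (n : ℕ)

instance : Ring (Preproj K n) := inferInstanceAs (Ring (RingQuot (PreprojRel K n)))

instance : Algebra K (Preproj K n) := inferInstanceAs (Algebra K (RingQuot (PreprojRel K n)))

/-- The image of a generator in `Π`. -/
def Preproj.of (a : PGen) : Preproj K n := RingQuot.mkAlgHom K (PreprojRel K n) (gen K a)

/-- The right ideal `e_i Π`, as a `K`-vector space. -/
def ePi (i : ℕ) : Submodule K (Preproj K n) :=
  LinearMap.range (LinearMap.mulLeft K (Preproj.of K n (PGen.e i)))

/-- Right multiplication by an element of `Π` on `e_i Π`. -/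
def rightMul (i : ℕ) (a : Preproj K n) : ePi K n i →ₗ[K] ePi K n i :=
  (LinearMap.mulRight K a).restrict (by
    rintro _ ⟨u, rfl⟩
    exact ⟨u * a, by simp [mul_assoc]⟩)

/-- The indecomposable injective left `Π`-module `Q_i` with socle the simple module `S_i` at the
vertex `i`: the `K`-linear dual of the right projective module `e_i Π`. -/
def Q (i : ℕ) : Type u := Module.Dual K (ePi K n i)

instance (i : ℕ) : AddCommGroup (Q K n i) := inferInstanceAs (AddCommGroup (Module.Dual K _))

/-- `(a • φ) u = φ (u a)`. -/
instance (i : ℕ) : Module (Preproj K n) (Q K n i) where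
  smul a φ := LinearMap.comp (M₃ := K) φ (rightMul K n i a)
  one_smul φ := LinearMap.ext fun u => congrArg (DFunLike.coe (F := Module.Dual K _) φ)
    (Subtype.ext (mul_one (u : Preproj K n)))
  mul_smul a b φ := LinearMap.ext fun u => congrArg (DFunLike.coe (F := Module.Dual K _) φ)
    (Subtype.ext (mul_assoc (u : Preproj K n) a b).symm)
  smul_zero _ := LinearMap.zero_comp _
  smul_add _ _ _ := LinearMap.add_comp _ _ _
  add_smul a b φ := LinearMap.ext fun u =>
    (congrArg (DFunLike.coe (F := Module.Dual K _) φ)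
      (Subtype.ext (mul_add (u : Preproj K n) a b))).trans (map_add (F := Module.Dual K _) φ _ _)
  zero_smul φ := LinearMap.ext fun u =>
    (congrArg (DFunLike.coe (F := Module.Dual K _) φ)
      (Subtype.ext (mul_zero (u : Preproj K n)))).trans (map_zero (F := Module.Dual K _) φ)

/-- A `Π`-module is finite-dimensional over `K`. -/
def IsFinDim (N : ModuleCat.{u} (Preproj K n)) : Prop :=
  letI : Module K N := Module.restrictScalars K (Preproj K n) N
  Module.Finite K N

/-- `Sub Q_i`: the finite-dimensional `Π`-modules isomorphic to a submodule of a finite direct sum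
of copies of `Q_i`. -/
def isSubQ (i : ℕ) : ObjectProperty (ModuleCat.{u} (Preproj K n)) := fun N =>
  IsFinDim K n N ∧
    ∃ (m : ℕ) (f : N →ₗ[Preproj K n] (Fin m → Q K n i)), Function.Injective f

end Preproj

/-- The socle of a module: the sum of its simple submodules. -/
def socle (S : Type u) [Ring S] (N : Type u) [AddCommGroup N] [Module S N] : Submodule S N :=
  sSup {U : Submodule S N | IsSimpleModule S U}

/-- The dimension over `K` of the socle of a `Π`-module. -/
def dimSocle (K : Type u) [Field K] (n : ℕ) (N : ModuleCat.{u} (Preproj K n)) : ℕ :=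
  letI : Module K (socle (Preproj K n) N) := Module.restrictScalars K (Preproj K n) _
  Module.finrank K (socle (Preproj K n) N)

/-! ### Cohen-Macaulay modules and their rank -/

section CM

variable (K : Type u) [Field K] (n : ℕ) (k : Fin n)

/-- `CM(A)`: the finitely generated left `A`-modules that are free over `Z = K[[t]]`. -/
def isCM : ObjectProperty (ModuleCat.{u} (TwistedRing K n k)) := fun M =>
  Module.Finite (TwistedRing K n k) M ∧
    letI : Module (PowerSeries K) M := Module.restrictScalars (PowerSeries K) (TwistedRing K n k) M
    Module.Free (PowerSeries K) M

end CM

/-- The action of `A ⊗_Z L` on `M ⊗_Z L`, given by `(a ⊗ l) (m ⊗ l') = a m ⊗ l l'`. -/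
def tensorAction (Z A L M : Type u) [CommRing Z] [Ring A] [Algebra Z A] [CommRing L] [Algebra Z L]
    [AddCommGroup M] [Module Z M] [Module A M] [IsScalarTower Z A M] :
    (A ⊗[Z] L) →ₐ[Z] Module.End Z (M ⊗[Z] L) :=
  (Module.endTensorEndAlgHom (R := Z) (S := Z) (A := Z) (M := M) (N := L)).comp
    (Algebra.TensorProduct.map (Algebra.lsmul Z Z M) (Algebra.lmul Z L))

/-- The length of `M ⊗_Z L` as a module over `A ⊗_Z L`. -/
def lengthTensor (Z A L M : Type u) [CommRing Z] [Ring A] [Algebra Z A] [CommRing L] [Algebra Z L]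
    [AddCommGroup M] [Module A M] : ℕ∞ :=
  letI : Module Z M := Module.restrictScalars Z A M
  haveI : IsScalarTower Z A M := IsScalarTower.restrictScalars Z A M
  letI : Module (A ⊗[Z] L) (M ⊗[Z] L) :=
    Module.compHom _ (tensorAction Z A L M).toRingHom
  Module.length (A ⊗[Z] L) (M ⊗[Z] L)

/-- The rank of an `A`-module `M`: the length of `M ⊗_Z Frac Z` over `A ⊗_Z Frac Z`. -/
def rk (K : Type u) [Field K] (n : ℕ) (k : Fin n) (M : ModuleCat.{u} (TwistedRing K n k)) : ℕ∞ :=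
  lengthTensor (PowerSeries K) (TwistedRing K n k) (FractionRing (PowerSeries K)) M

/-- The map `M / I M → N / I N` induced by `f : M → N`. -/
def truncMap (S : Type u) [Ring S] (I : Ideal S) {M N : Type u} [AddCommGroup M] [AddCommGroup N]
    [Module S M] [Module S N] (f : M →ₗ[S] N) :
    (M ⧸ (I • ⊤ : Submodule S M)) →ₗ[S] (N ⧸ (I • ⊤ : Submodule S N)) :=
  Submodule.mapQ _ _ f (by
    rw [← Submodule.map_le_iff_le_comap, Submodule.map_smul'']
    exact Submodule.smul_mono le_rfl le_top)

/-- The map `M / I M → N / I N` induced by `f : M → N`, as a map of `S / I`-modules. -/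
def truncMapQ (S : Type u) [Ring S] (I : Ideal S) [I.IsTwoSided] {M N : Type u} [AddCommGroup M]
    [AddCommGroup N] [Module S M] [Module S N] (f : M →ₗ[S] N) :
    (M ⧸ (I • ⊤ : Submodule S M)) →ₗ[S ⧸ I] (N ⧸ (I • ⊤ : Submodule S N)) where
  toFun := truncMap S I f
  map_add' x y := LinearMap.map_add (truncMap S I f) x y
  map_smul' r m := by
    obtain ⟨a, rfl⟩ := Ideal.Quotient.mk_surjective r
    obtain ⟨m, rfl⟩ := Submodule.Quotient.mk_surjective _ m
    exact congrArg (Submodule.Quotient.mk) (map_smul f a m)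

lemma truncMapQ_mk (S : Type u) [Ring S] (I : Ideal S) [I.IsTwoSided] {M N : Type u}
    [AddCommGroup M] [AddCommGroup N] [Module S M] [Module S N] (f : M →ₗ[S] N) (m : M) :
    truncMapQ S I f (Submodule.Quotient.mk m) = Submodule.Quotient.mk (f m) := rfl

/-- For a two-sided ideal `I` of a ring `S`, the functor `M ↦ M / I M` from left `S`-modules to
left `S / I`-modules. -/
def truncFunctor (S : Type u) [Ring S] (I : Ideal S) [I.IsTwoSided] :
    ModuleCat.{u} S ⥤ ModuleCat.{u} (S ⧸ I) where
  obj M := ModuleCat.of (S ⧸ I) (M ⧸ (I • ⊤ : Submodule S M))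
  map f := ModuleCat.ofHom (truncMapQ S I f.hom)
  map_id M := ModuleCat.hom_ext <| LinearMap.ext fun m => by
    obtain ⟨m, rfl⟩ := Submodule.Quotient.mk_surjective _ m
    exact truncMapQ_mk S I _ m
  map_comp {L M N} f g := ModuleCat.hom_ext <| LinearMap.ext fun m => by
    obtain ⟨m, rfl⟩ := Submodule.Quotient.mk_surjective _ m
    change truncMapQ S I (f ≫ g).hom _ = truncMapQ S I g.hom (truncMapQ S I f.hom _)
    rw [truncMapQ_mk, truncMapQ_mk, truncMapQ_mk]
    rfl

instance (S : Type u) [Ring S] (I : Ideal S) [I.IsTwoSided] : (truncFunctor S I).Additive where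
  map_add {M N f g} := ModuleCat.hom_ext <| LinearMap.ext fun m => by
    obtain ⟨m, rfl⟩ := Submodule.Quotient.mk_surjective _ m
    change truncMapQ S I (f + g).hom _ = truncMapQ S I f.hom _ + truncMapQ S I g.hom _
    rw [truncMapQ_mk, truncMapQ_mk, truncMapQ_mk]
    rfl

/-! ### The projective `P_n`, the ideal `(e_n)` and the functor `π` -/

section Pi

variable (K : Type u) [Field K] (n : ℕ) [NeZero n] (k : Fin n)

/-- The projective module `P_n = A e_n`. -/
abbrev Pn : Submodule (TwistedRing K n k) (TwistedRing K n k) :=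
  Submodule.span (TwistedRing K n k) {idem K n k n}

/-- `M` is minimal: it has no direct summand isomorphic to `P_n`. -/
def IsMinimal (M : ModuleCat.{u} (TwistedRing K n k)) : Prop :=
  ¬ ∃ U W : Submodule (TwistedRing K n k) M,
    IsCompl U W ∧ Nonempty (U ≃ₗ[TwistedRing K n k] Pn K n k)

/-- The ideal of `CM(A)` generated by `P_n`: the maps that factor through a finite direct sum of
copies of `P_n`. -/
def InIdealPn {M N : (isCM K n k).FullSubcategory} (f : M ⟶ N) : Prop :=
  ∃ (m : ℕ) (a : M.obj →ₗ[TwistedRing K n k] (Fin m → Pn K n k))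
    (b : (Fin m → Pn K n k) →ₗ[TwistedRing K n k] N.obj),
    ((isCM K n k).ι.map f).hom = b ∘ₗ a

/-- The congruence on `CM(A)` defined by this ideal. -/
def idealRel : HomRel (isCM K n k).FullSubcategory := fun _ _ f g => InIdealPn K n k (f - g)

/-- The two-sided ideal `(e_n)` of `A`. -/
abbrev idealEn : Ideal (TwistedRing K n k) := (TwoSidedIdeal.span {idem K n k n}).asIdeal

/-- The quotient ring `A / (e_n)`. -/
abbrev B : Type u := TwistedRing K n k ⧸ idealEn K n k

/-- The image in `A / (e_n)` of the idempotent `e_i`, for `0 < i < n`, and zero otherwise. -/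
def bIdem (i : ℕ) : B K n k :=
  if 0 < i ∧ i < n then Ideal.Quotient.mk _ (idem K n k i) else 0

/-- The images of the generators of `Π` in `A / (e_n)`: the vertex idempotents and the arrows
`x : i → i + 1`, `y : i + 1 → i`. -/
def genImage : PGen → B K n k
  | .e i => bIdem K n k i
  | .x i => bIdem K n k (i + 1) * Ideal.Quotient.mk _ (xA K n k) * bIdem K n k i
  | .y i => bIdem K n k i * Ideal.Quotient.mk _ (yA K n k) * bIdem K n k (i + 1)

lemma mk_idem_n : (Ideal.Quotient.mk (idealEn K n k)) (idem K n k n) = 0 := by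
  rw [Ideal.Quotient.eq_zero_iff_mem, TwoSidedIdeal.mem_asIdeal]
  exact TwoSidedIdeal.subset_span rfl

lemma bIdem_of_le {i : ℕ} (hi : i ≤ n) :
    bIdem K n k i = Ideal.Quotient.mk _ (idem K n k i) := by
  unfold bIdem
  split_ifs with h
  · rfl
  · rcases Nat.eq_zero_or_pos i with h0 | h0
    · rw [h0, ← idem_self, mk_idem_n]
    · have : i = n := by omega
      rw [this, mk_idem_n]

variable [HasEnoughRootsOfUnity K n]

lemma bIdem_mul_self (i : ℕ) : bIdem K n k i * bIdem K n k i = bIdem K n k i := by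
  unfold bIdem
  split_ifs with h
  · rw [← map_mul, idem_mul_idem_self]
  · simp

/-- The homomorphism `Π → A / (e_n)` sending vertices and arrows to vertices and arrows. -/
def preprojHom : Preproj K n →ₐ[K] B K n k :=
  RingQuot.liftAlgHom K ⟨FreeAlgebra.lift K (genImage K n k), by
    intro a b h
    induction h with
    | outside i h =>
      simp only [FreeAlgebra.lift_ι_apply, genImage, map_zero, bIdem]
      rw [if_neg (by omega)]
    | idem i => simp only [map_mul, FreeAlgebra.lift_ι_apply, genImage, bIdem_mul_self]
    | orth i j h =>
      simp only [map_mul, FreeAlgebra.lift_ι_apply, genImage, bIdem, map_zero]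
      split_ifs with h1 h2
      · rw [← map_mul, idem_mul_idem_ne K n k h1.2 h2.2 h, map_zero]
      all_goals simp
    | one =>
      simp only [map_sum, FreeAlgebra.lift_ι_apply, genImage, map_one]
      have h0 : bIdem K n k 0 = 0 := by simp [bIdem]
      have h1 : ∑ i ∈ Finset.Ioo 0 n, bIdem K n k i = ∑ i ∈ Finset.range n, bIdem K n k i := by
        refine Finset.sum_subset (fun i hi => ?_) (fun i hi hi' => ?_)
        · simp only [Finset.mem_Ioo] at hi; simpa using hi.2
        · simp only [Finset.mem_Ioo, Finset.mem_range] at hi hi'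
          have : i = 0 := by omega
          rw [this, h0]
      rw [h1, Finset.sum_congr rfl fun i hi =>
        bIdem_of_le K n k (Finset.mem_range.mp hi).le, ← map_sum, sum_idem, map_one]
    | source_target_x i =>
      simp only [map_mul, FreeAlgebra.lift_ι_apply, genImage]
      rw [← mul_assoc, ← mul_assoc, bIdem_mul_self, mul_assoc _ (bIdem K n k i), bIdem_mul_self]
    | source_target_y i =>
      simp only [map_mul, FreeAlgebra.lift_ι_apply, genImage]
      rw [← mul_assoc, ← mul_assoc, bIdem_mul_self, mul_assoc _ (bIdem K n k (i + 1)),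
        bIdem_mul_self]
    | mesh i =>
      simp only [map_mul, FreeAlgebra.lift_ι_apply, genImage]
      by_cases hi : i + 1 < n
      · rw [bIdem_of_le K n k (show i ≤ n by omega), bIdem_of_le K n k hi.le,
          bIdem_of_le K n k (show i + 1 + 1 ≤ n by omega)]
        have := congrArg (Ideal.Quotient.mk (idealEn K n k)) (mesh_A K n k i)
        rwa [map_mul, map_mul, map_mul, map_mul, map_mul, map_mul, map_mul, map_mul, map_mul,
          map_mul] at this
      · have : bIdem K n k (i + 1) = 0 := by
          unfold bIdem; rw [if_neg (by omega)]
        simp [this]⟩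

/-- The functor `π : mod A → mod Π`, `M ↦ M / (e_n) M`, regarded as a `Π`-module along
`Π → A / (e_n)`. -/
def piFunctor : ModuleCat.{u} (TwistedRing K n k) ⥤ ModuleCat.{u} (Preproj K n) :=
  truncFunctor (TwistedRing K n k) (idealEn K n k) ⋙ ModuleCat.restrictScalars (preprojHom K n k).toRingHom

instance : (piFunctor K n k).Additive := by
  unfold piFunctor; infer_instance

/-- The restriction `CM(A) → Sub Q_k` of `π`, given that `π` takes `CM(A)` to `Sub Q_k`. -/
def piCM (hπ : ∀ M : (isCM K n k).FullSubcategory,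
      isSubQ K n k (((isCM K n k).ι ⋙ piFunctor K n k).obj M)) :
    (isCM K n k).FullSubcategory ⥤ (isSubQ K n k).FullSubcategory :=
  (isSubQ K n k).lift ((isCM K n k).ι ⋙ piFunctor K n k) hπ

end Pi

end GrassCM

end

set_option linter.unusedSectionVars false

open CategoryTheory TensorProduct

noncomputable section

namespace GrassCM

/-! ### Modules over power series rings -/

/-! A module `M` in `CM(A)` is a cyclic configuration of free `K[[t]]`-modules `e_j M`, with arrows
`x` and `y` whose composites are both `t`. Since `t` is injective, so are all the arrows. Everything
rests on shortest paths. Let `fromZero i` be the shortest path from the vertex `0 = n` to `i`, along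
`x` for `i ≤ k` and along `y` for `i ≥ k`; the two choices agree at `k` because `x ^ k = y ^ (n -
k)`. Let `toK i` be the shortest path from `i` to `k`. Then `toK i * fromZero i = fromZero k`, with
no factor `t` (`toK_mul_fromZero`).

The paths `fromZero i` with `i < n` form a `K[[t]]`-basis of `P_n` (`pnBasis`). By the pairing with
`toK`, `P_n` is also coinduced from the vertex `k`: homomorphisms `M → P_n` come from linear forms
at `k` (`coind`, `coind_coord`). Linear forms extend along injections that split over `K[[t]]`, so
`P_n` is injective in `CM(A)`.

The component of `(e_n) M` at `j` consists of the elements `fromZero j • m` with `m` in `e_n M`, and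
a basis of `e_n M` identifies `(e_n) M` with a power of `P_n` (`IsVertexBasis.pnSum_injective`).
Hence the maps killed by `π` are those that factor through powers of `P_n` (`factors_iff_range_le`).
If `toK j • w` lies in `(e_n) M`, then it equals `toK j • fromZero j • m`, and cancelling `toK j`
puts `e_j w` in `(e_n) M`. By the criterion `isSubQ_iff` this says that `π M` lies in `Sub Q_k`. A
similar cancellation gives exactness.

`π` is full because the obstruction to lifting a map `π M → π N` is an extension of `M` by `(e_n)
N`, a power of `P_n`, and such extensions split (`exists_lift_of_pi`). It is dense because linear
forms embed `N` in a power of `P_n / t ^ n P_n`; the preimage `S` of `N` in the power of `P_n` has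
`(e_n) S` equal to `t ^ n` times that power (`exists_isCM_pi_iso`).

If `M` is minimal, every map `M → P_n` takes `(e_n) M` into `t P_n`, since a unit coefficient would
split off `P_n` (`exists_eq_X_smul_of_isMinimal`). So an endomorphism with image in `(e_n) M` has
square divisible by `t`, and Nakayama makes minimal lifts unique (`bijective_of_isMinimal`).
Finally, the rank of `M` is the rank `r` of `e_n M`, because `P_n ^ r → M` becomes an isomorphism
over the fraction field, where `P_n` becomes simple (`rk_eq`). For minimal `M` the map `m ↦ t⁻¹
fromZero k • m` is defined on `e_n M` and identifies `e_n M / t e_n M` with the socle of `π M`, of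
dimension `r` (`dimSocle_pi`). -/

/-- A family `b` spans a `K[[X]]`-module that is `X`-adically separated as soon as it spans
modulo `X` over `K`. -/
lemma span_eq_top_of_separated {K : Type*} [Field K] {M ι : Type*} [AddCommGroup M]
    [Module (PowerSeries K) M] [Fintype ι] (b : ι → M)
    (hstep : ∀ m : M, ∃ (c : ι → K) (m' : M),
      m = ∑ i, (PowerSeries.C (c i)) • b i + (PowerSeries.X : PowerSeries K) • m')
    (hsep : ∀ m : M, (∀ N : ℕ, ∃ m' : M, m = (PowerSeries.X : PowerSeries K) ^ N • m') → m = 0) :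
    Submodule.span (PowerSeries K) (Set.range b) = ⊤ := by
  choose c F hcF using hstep
  -- The `j`-th coefficient is the digit of the `j`-th remainder, as in an expansion in base `X`.
  let C : ι → M → PowerSeries K := fun i m => PowerSeries.mk fun j => c (F^[j] m) i
  have hC : ∀ i m, C i m = PowerSeries.C (c m i) + PowerSeries.X * C i (F m) := by
    intro i m
    ext j
    rcases j with _ | j
    · simp [C]
    · simp [C, PowerSeries.coeff_succ_X_mul]
  -- The error of the expansion: it satisfies `D m = X • D (F m)`, so it is divisible by every power
  -- of `X`.
  let D : M → M := fun m => m - ∑ i, C i m • b i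
  have hD : ∀ m, D m = (PowerSeries.X : PowerSeries K) • D (F m) := by
    intro m
    have h1 : ∑ i, C i m • b i = ∑ i, (PowerSeries.C (c m i)) • b i +
        (PowerSeries.X : PowerSeries K) • ∑ i, C i (F m) • b i := by
      rw [Finset.smul_sum, ← Finset.sum_add_distrib]
      refine Finset.sum_congr rfl fun i _ => ?_
      rw [hC, add_smul, mul_smul]
    simp only [D]
    rw [h1, smul_sub]
    nth_rewrite 1 [hcF m]
    abel
  have hDN : ∀ N m, D m = (PowerSeries.X : PowerSeries K) ^ N • D (F^[N] m) := by
    intro N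
    induction N with
    | zero => intro m; simp
    | succ N ih =>
      intro m
      rw [Function.iterate_succ_apply, hD, ih (F m), smul_smul, pow_succ']
  refine eq_top_iff.mpr fun m _ => ?_
  have h0 : D m = 0 := hsep _ fun N => ⟨_, hDN N m⟩
  rw [sub_eq_zero.mp h0]
  exact Submodule.sum_mem _ fun i _ => Submodule.smul_mem _ _ (Submodule.subset_span ⟨i, rfl⟩)

/-! ### The curve ring as a finite, separated, faithful `K[[t]]`-module. -/

section Curve

variable (K : Type u) [Field K] (n : ℕ) (k : Fin n)

/-- `R` as a `K[[t]]`-algebra, with `t` acting as `x y`. -/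
instance : Algebra (PowerSeries K) (CurveRing K n k) := (tHom K n k).toAlgebra

/-- The element `x` of `R`. -/
def xR : CurveRing K n k := CurveRing.mk K n k (MvPowerSeries.X 0)

/-- The element `y` of `R`. -/
def yR : CurveRing K n k := CurveRing.mk K n k (MvPowerSeries.X 1)

lemma algebraMap_X_curve : algebraMap (PowerSeries K) (CurveRing K n k) PowerSeries.X =
    xR K n k * yR K n k := by
  change CurveRing.mk K n k (PowerSeries.substAlgHom (hasSubst_t K) PowerSeries.X) = _
  rw [PowerSeries.substAlgHom_X, map_mul]
  rfl

lemma algebraMap_C_curve (c : K) : algebraMap (PowerSeries K) (CurveRing K n k) (PowerSeries.C c) =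
    CurveRing.mk K n k (MvPowerSeries.C c) := by
  change CurveRing.mk K n k (PowerSeries.substAlgHom (hasSubst_t K)
    (algebraMap K (PowerSeries K) c)) = _
  rw [AlgHom.commutes]
  rfl

lemma xR_pow : xR K n k ^ (k : ℕ) = yR K n k ^ (n - (k : ℕ)) := by
  rw [xR, yR, ← map_pow, ← map_pow]
  exact Ideal.Quotient.eq.mpr (Ideal.subset_span rfl)

/-- As `x ^ k = y ^ (n - k)`, one has `x ^ n = x ^ (n - k) * y ^ (n - k)`. High powers of `x` (and
likewise of `y`) are thus multiples of `t`, which makes `R` finite over `K[[t]]`. -/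
lemma xR_pow_n : xR K n k ^ n = (xR K n k * yR K n k) ^ (n - (k : ℕ)) := by
  have h : n - (k : ℕ) + k = n := Nat.sub_add_cancel k.isLt.le
  calc xR K n k ^ n = xR K n k ^ (n - (k : ℕ) + k) := by rw [h]
    _ = _ := by rw [pow_add, xR_pow, mul_pow]

lemma yR_pow_n : yR K n k ^ n = (xR K n k * yR K n k) ^ (k : ℕ) := by
  have h : n - (k : ℕ) + k = n := Nat.sub_add_cancel k.isLt.le
  calc yR K n k ^ n = yR K n k ^ (n - (k : ℕ) + k) := by rw [h]
    _ = _ := by rw [pow_add, ← xR_pow, mul_pow]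

variable {K n k} in
-- Once the monomials with both exponents below `n` are removed, what remains has the form `x ^ n q₁
-- + y ^ n q₂`, which lies in `t R`. This is the input for `span_eq_top_of_separated`.
lemma exists_curve_step (hk : (k : ℕ) ≠ 0) (r : CurveRing K n k) :
    ∃ (c : Fin n × Fin n → K) (r' : CurveRing K n k),
      r = ∑ i, (PowerSeries.C (c i)) • (xR K n k ^ (i.1 : ℕ) * yR K n k ^ (i.2 : ℕ)) +
        (PowerSeries.X : PowerSeries K) • r' := by
  obtain ⟨f, rfl⟩ := CurveRing.mk_surjective K n k r
  classical
  let mon : Fin n × Fin n → (Fin 2 →₀ ℕ) := fun i =>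
    Finsupp.single 0 (i.1 : ℕ) + Finsupp.single 1 (i.2 : ℕ)
  let c : Fin n × Fin n → K := fun i => MvPowerSeries.coeff (mon i) f
  let s : MvPowerSeries (Fin 2) K := ∑ i, MvPowerSeries.monomial (mon i) (c i)
  have hmon : ∀ d : Fin 2 →₀ ℕ, ∀ (h0 : d 0 < n) (h1 : d 1 < n), mon (⟨d 0, h0⟩, ⟨d 1, h1⟩) = d := by
    intro d h0 h1
    ext i
    fin_cases i <;> simp [mon]
  have hinj : Function.Injective mon := by
    rintro ⟨a, b⟩ ⟨a', b'⟩ h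
    have h0 := DFunLike.congr_fun h 0
    have h1 := DFunLike.congr_fun h 1
    simp [mon] at h0 h1
    simp [Fin.ext_iff, h0, h1]
  have hs : ∀ d : Fin 2 →₀ ℕ, d 0 < n → d 1 < n → MvPowerSeries.coeff d (f - s) = 0 := by
    intro d h0 h1
    rw [map_sub, map_sum, Finset.sum_eq_single (⟨d 0, h0⟩, ⟨d 1, h1⟩)]
    · rw [hmon, MvPowerSeries.coeff_monomial_same]
      simp only [c, hmon, sub_self]
    · intro i _ hi
      rw [MvPowerSeries.coeff_monomial_ne]
      rw [← hmon d h0 h1]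
      exact fun h => hi (hinj h).symm
    · simp
  -- The terms with `x`-exponent at least `n`; the other terms of `f - s` have `y`-exponent at least
  -- `n`.
  let h₁ : MvPowerSeries (Fin 2) K := fun d => if n ≤ d 0 then MvPowerSeries.coeff d (f - s) else 0
  have hc₁ : ∀ d, MvPowerSeries.coeff d h₁ =
      if n ≤ d 0 then MvPowerSeries.coeff d (f - s) else 0 := fun d => rfl
  have d1 : (MvPowerSeries.X 0 : MvPowerSeries (Fin 2) K) ^ n ∣ h₁ := by
    rw [MvPowerSeries.X_pow_dvd_iff]
    intro d hd
    rw [hc₁, if_neg (by omega)]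
  have d2 : (MvPowerSeries.X 1 : MvPowerSeries (Fin 2) K) ^ n ∣ f - s - h₁ := by
    rw [MvPowerSeries.X_pow_dvd_iff]
    intro d hd
    rw [map_sub, hc₁]
    split_ifs with h
    · rw [sub_self]
    · rw [hs d (by omega) hd, sub_zero]
  obtain ⟨q₁, hq₁⟩ := d1
  obtain ⟨q₂, hq₂⟩ := d2
  have hf : f = s + MvPowerSeries.X 0 ^ n * q₁ + MvPowerSeries.X 1 ^ n * q₂ := by
    rw [← hq₂, ← hq₁]; ring
  -- Both `n - k` and `k` are positive, so one factor `t` can be pulled out of `x ^ n` and of `y ^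
  -- n`.
  obtain ⟨a, ha⟩ : ∃ a, n - (k : ℕ) = a + 1 := ⟨n - k - 1, by have := k.isLt; omega⟩
  obtain ⟨b, hb⟩ : ∃ b, (k : ℕ) = b + 1 := ⟨k - 1, by omega⟩
  refine ⟨c, (xR K n k * yR K n k) ^ a * CurveRing.mk K n k q₁ +
    (xR K n k * yR K n k) ^ b * CurveRing.mk K n k q₂, ?_⟩
  have hsR : CurveRing.mk K n k s =
      ∑ i, (PowerSeries.C (c i)) • (xR K n k ^ (i.1 : ℕ) * yR K n k ^ (i.2 : ℕ)) := by
    rw [map_sum]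
    refine Finset.sum_congr rfl fun i _ => ?_
    rw [Algebra.smul_def, algebraMap_C_curve, xR, yR, ← map_pow, ← map_pow, ← map_mul, ← map_mul]
    congr 1
    rw [MvPowerSeries.X_pow_eq, MvPowerSeries.X_pow_eq, MvPowerSeries.monomial_mul_monomial,
      ← MvPowerSeries.monomial_zero_eq_C_apply, MvPowerSeries.monomial_mul_monomial]
    simp [mon]
  conv_lhs => rw [hf]
  rw [map_add, map_add, map_mul, map_mul, map_pow, map_pow, hsR, Algebra.smul_def,
    algebraMap_X_curve]
  change _ + xR K n k ^ n * _ + yR K n k ^ n * _ = _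
  rw [xR_pow_n, yR_pow_n, ha, hb, pow_succ', pow_succ', mul_add]
  ring

/-- The homomorphism `R → K[[s]]` with `x ↦ s ^ (n - k)` and `y ↦ s ^ k`. -/
lemma exists_curve_param (hk : (k : ℕ) ≠ 0) : ∃ φ : CurveRing K n k →+* PowerSeries K,
    φ (xR K n k) = PowerSeries.X ^ (n - (k : ℕ)) ∧ φ (yR K n k) = PowerSeries.X ^ (k : ℕ) := by
  have hnk : n - (k : ℕ) ≠ 0 := by have := k.isLt; omega
  let a : Fin 2 → MvPowerSeries Unit K :=
    ![(PowerSeries.X : PowerSeries K) ^ (n - (k : ℕ)), (PowerSeries.X : PowerSeries K) ^ (k : ℕ)]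
  have ha : MvPowerSeries.HasSubst a := by
    refine MvPowerSeries.hasSubst_of_constantCoeff_zero fun i => ?_
    fin_cases i
    · change PowerSeries.constantCoeff ((PowerSeries.X : PowerSeries K) ^ (n - (k : ℕ))) = 0
      simp [hnk]
    · change PowerSeries.constantCoeff ((PowerSeries.X : PowerSeries K) ^ (k : ℕ)) = 0
      simp [hk]
  let ψ : MvPowerSeries (Fin 2) K →ₐ[K] MvPowerSeries Unit K := MvPowerSeries.substAlgHom ha
  have h0 : ψ (MvPowerSeries.X 0) = (PowerSeries.X : PowerSeries K) ^ (n - (k : ℕ)) :=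
    MvPowerSeries.substAlgHom_X ha 0
  have h1 : ψ (MvPowerSeries.X 1) = (PowerSeries.X : PowerSeries K) ^ (k : ℕ) :=
    MvPowerSeries.substAlgHom_X ha 1
  refine ⟨Ideal.Quotient.lift _ (ψ : MvPowerSeries (Fin 2) K →+* PowerSeries K) ?_, h0, h1⟩
  intro f hf
  obtain ⟨q, rfl⟩ := Ideal.mem_span_singleton.mp hf
  change ψ _ = 0
  rw [map_mul, map_sub, map_pow, map_pow, h0, h1]
  have : ((PowerSeries.X : PowerSeries K) ^ (n - (k : ℕ))) ^ (k : ℕ) -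
    ((PowerSeries.X : PowerSeries K) ^ (k : ℕ)) ^ (n - (k : ℕ)) = 0 := by
    rw [← pow_mul, ← pow_mul, mul_comm, sub_self]
  exact (congrArg (· * ψ q) this).trans (zero_mul _)

variable {K n k}

/-- A nonzero power series is `t ^ m` times a unit, and `t = x y` is not nilpotent: the
parametrization sends it to `s ^ n`. -/
lemma algebraMap_curve_injective (hk : (k : ℕ) ≠ 0) :
    Function.Injective (algebraMap (PowerSeries K) (CurveRing K n k)) := by
  rw [injective_iff_map_eq_zero]
  intro c hc
  by_contra h0
  obtain ⟨φ, hx, hy⟩ := exists_curve_param K n k hk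
  obtain ⟨m, v, rfl⟩ : ∃ (m : ℕ) (v : (PowerSeries K)ˣ), c = PowerSeries.X ^ m * (v : PowerSeries K) := by
    obtain ⟨m, v, hv⟩ := IsDiscreteValuationRing.eq_unit_mul_pow_irreducible h0
      (PowerSeries.X_prime (R := K)).irreducible
    exact ⟨m, v, by rw [hv, mul_comm]⟩
  rw [map_mul, map_pow, algebraMap_X_curve] at hc
  have h1 : (xR K n k * yR K n k) ^ m = 0 := by
    have hv : IsUnit (algebraMap (PowerSeries K) (CurveRing K n k) (v : PowerSeries K)) :=
      v.isUnit.map _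
    exact hv.mul_left_eq_zero.mp hc
  have h2 := congrArg φ h1
  rw [map_pow, map_mul, hx, hy, map_zero, ← pow_add, ← pow_mul] at h2
  exact PowerSeries.X_ne_zero (eq_zero_of_pow_eq_zero h2)

lemma curve_nontrivial (hk : (k : ℕ) ≠ 0) : Nontrivial (CurveRing K n k) :=
  (algebraMap_curve_injective hk).nontrivial

/-- Krull's intersection theorem in the Noetherian local ring `R`; `t` is not a unit because its
image `s ^ n` is not one. -/
lemma curve_separated (hk : (k : ℕ) ≠ 0) (r : CurveRing K n k)
    (h : ∀ N : ℕ, ∃ r' : CurveRing K n k, r = (PowerSeries.X : PowerSeries K) ^ N • r') :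
    r = 0 := by
  have := curve_nontrivial (K := K) hk
  have : IsNoetherianRing (CurveRing K n k) :=
    isNoetherianRing_of_surjective _ _ _ (CurveRing.mk_surjective K n k)
  have : IsLocalRing (CurveRing K n k) :=
    IsLocalRing.of_surjective' _ (CurveRing.mk_surjective K n k)
  have hne : Ideal.span {xR K n k * yR K n k} ≠ ⊤ := by
    rw [Ne, Ideal.span_singleton_eq_top]
    intro hu
    obtain ⟨φ, hx, hy⟩ := exists_curve_param K n k hk
    have h2 := hu.map φ
    rw [map_mul, hx, hy, ← pow_add, Nat.sub_add_cancel k.isLt.le] at h2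
    have : n ≠ 0 := by have := k.isLt; omega
    exact PowerSeries.X_prime.not_isUnit ((isUnit_pow_iff this).mp h2)
  have hI := Ideal.iInf_pow_eq_bot_of_isLocalRing _ hne
  rw [← Ideal.mem_bot, ← hI, Submodule.mem_iInf]
  intro N
  obtain ⟨r', rfl⟩ := h N
  rw [Algebra.smul_def, map_pow, algebraMap_X_curve, Ideal.span_singleton_pow]
  exact Ideal.mul_mem_right _ _ (Ideal.subset_span rfl)

lemma span_curve (hk : (k : ℕ) ≠ 0) :
    Submodule.span (PowerSeries K) (Set.range fun i : Fin n × Fin n =>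
      xR K n k ^ (i.1 : ℕ) * yR K n k ^ (i.2 : ℕ)) = ⊤ :=
  span_eq_top_of_separated _ (exists_curve_step hk) (curve_separated hk)

/-! ### The twisted group ring over `K[[t]]`: finiteness and generators. -/

section Twisted

lemma algebraMap_twisted (c : PowerSeries K) : algebraMap (PowerSeries K) (TwistedRing K n k) c =
    ofR K n k (algebraMap (PowerSeries K) (CurveRing K n k) c) := rfl

lemma algebraMap_X_twisted : algebraMap (PowerSeries K) (TwistedRing K n k) PowerSeries.X =
    xA K n k * yA K n k := by
  rw [algebraMap_twisted, algebraMap_X_curve, map_mul]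
  rfl

lemma xA_pow : xA K n k ^ (k : ℕ) = yA K n k ^ (n - (k : ℕ)) := by
  have := congrArg (ofR K n k) (xR_pow K n k)
  rwa [map_pow, map_pow] at this

instance : IsScalarTower K (PowerSeries K) (TwistedRing K n k) :=
  IsScalarTower.of_algebraMap_eq fun _ => rfl

lemma single_eq (g : Grp K n) (r : CurveRing K n k) :
    TwistedRing.single K n k g r = ofR K n k r * ofG K n k g := by
  change _ = TwistedRing.single K n k 1 r * TwistedRing.single K n k g 1
  rw [single_mul_single]; simp

/-- The inclusion of `R` in `A` as a `K[[t]]`-linear map. -/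
def ofRLinear : CurveRing K n k →ₗ[PowerSeries K] TwistedRing K n k where
  toFun := ofR K n k
  map_add' := map_add _
  map_smul' c r := by
    rw [Algebra.smul_def, map_mul, Algebra.smul_def]
    rfl

lemma mem_span_curve (hk : (k : ℕ) ≠ 0) (r : CurveRing K n k) :
    ofR K n k r ∈ Submodule.span (PowerSeries K) (Set.range fun i : Fin n × Fin n =>
      xA K n k ^ (i.1 : ℕ) * yA K n k ^ (i.2 : ℕ)) := by
  have h : r ∈ (⊤ : Submodule (PowerSeries K) _) := trivial
  rw [← span_curve hk] at h
  have h1 := Submodule.mem_map_of_mem (f := ofRLinear) h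
  rw [Submodule.map_span, ← Set.range_comp] at h1
  refine Submodule.span_mono ?_ h1
  rintro _ ⟨i, rfl⟩
  refine ⟨i, ?_⟩
  change _ = ofR K n k _
  rw [map_mul, map_pow, map_pow]
  rfl

variable [NeZero n]

lemma finite_twisted (hk : (k : ℕ) ≠ 0) : Module.Finite (PowerSeries K) (TwistedRing K n k) := by
  refine ⟨⟨(Set.toFinite (Set.range fun i : (Fin n × Fin n) × Grp K n =>
      xA K n k ^ (i.1.1 : ℕ) * yA K n k ^ (i.1.2 : ℕ) * ofG K n k i.2)).toFinset, ?_⟩⟩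
  rw [Set.Finite.coe_toFinset, eq_top_iff]
  intro a _
  induction a using TwistedRing.induction with
  | h0 => exact zero_mem _
  | h2 a b ha hb => exact add_mem (ha trivial) (hb trivial)
  | h1 g r =>
    rw [single_eq]
    have h := Submodule.mem_map_of_mem (f := LinearMap.mulRight (PowerSeries K) (ofG K n k g))
      (mem_span_curve hk r)
    rw [Submodule.map_span, ← Set.range_comp] at h
    refine Submodule.span_mono ?_ h
    rintro _ ⟨i, rfl⟩
    exact ⟨(i, g), rfl⟩

/-- The coefficient of `c e_n` at the identity of `G` is `c / n`, and `K[[t]]` embeds in `R`. -/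
lemma smul_idem_n_eq_zero [HasEnoughRootsOfUnity K n] (hk : (k : ℕ) ≠ 0) {c : PowerSeries K}
    (h : c • idem K n k n = 0) : c = 0 := by
  have key : ∀ j : ℕ, c • idem K n k j = (n : K)⁻¹ • ∑ g : Grp K n,
      TwistedRing.single K n k g (algebraMap (PowerSeries K) (CurveRing K n k)
        (PowerSeries.C (((Grp.val g)⁻¹ : K) ^ j) * c)) := by
    intro j
    rw [idem, smul_comm, Finset.smul_sum]
    congr 1
    refine Finset.sum_congr rfl fun g _ => ?_
    rw [single_eq, ← algebraMap_twisted, ← Algebra.smul_def, mul_smul, smul_comm]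
    congr 1
  rw [key] at h
  have h1 := (smul_eq_zero_iff_right (inv_ne_zero (natCast_ne_zero K n))).mp h
  let p : TwistedRing K n k →+ CurveRing K n k :=
    { toFun := fun a => SkewMonoidAlgebra.coeff a 1
      map_zero' := rfl
      map_add' := fun a b => DFunLike.congr_fun (SkewMonoidAlgebra.coeff_add a b) 1 }
  have hp : ∀ g r, p (TwistedRing.single K n k g r) = Finsupp.single g r 1 := fun g r =>
    DFunLike.congr_fun (SkewMonoidAlgebra.coeff_single g r) 1
  have h2 := congrArg p h1
  rw [map_sum, map_zero, Finset.sum_eq_single 1 (fun g _ hg => by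
    rw [hp, Finsupp.single_eq_of_ne' hg]) (by simp), hp, Finsupp.single_eq_same, map_mul] at h2
  rw [map_one, Units.val_one, inv_one, one_pow, map_one, map_one, one_mul] at h2
  exact (map_eq_zero_iff _ (algebraMap_curve_injective hk)).mp h2

/-- Fourier inversion on `G`: `g` acts on `e_j` by the scalar `g ^ j`, and the `e_j` sum to `1`. -/
lemma idem_mul_ofG_sum [HasEnoughRootsOfUnity K n] (g : Grp K n) :
    ofG K n k g = ∑ j ∈ Finset.range n, (Grp.val g : K) ^ j • idem K n k j := by
  have h : ∀ j, ofG K n k g * idem K n k j = (Grp.val g : K) ^ j • idem K n k j := by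
    intro j
    have h1 : ofG K n k g * ∑ h : Grp K n, ((Grp.val h)⁻¹ : K) ^ j • ofG K n k h =
        (Grp.val g : K) ^ j • ∑ h : Grp K n, ((Grp.val h)⁻¹ : K) ^ j • ofG K n k h := by
      rw [Finset.mul_sum, Finset.smul_sum, ← Equiv.sum_comp (Equiv.mulLeft g⁻¹)]
      refine Finset.sum_congr rfl fun h _ => ?_
      rw [mul_smul_comm, ← map_mul, Equiv.coe_mulLeft, mul_inv_cancel_left, smul_smul]
      congr 1
      simp only [map_mul, map_inv, Units.val_mul, Units.val_inv_eq_inv_val, mul_inv, inv_inv,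
        mul_pow]
    rw [idem, mul_smul_comm, h1, smul_comm]
  calc ofG K n k g = ofG K n k g * ∑ j ∈ Finset.range n, idem K n k j := by
        rw [sum_idem, mul_one]
    _ = _ := by rw [Finset.mul_sum]; exact Finset.sum_congr rfl fun j _ => h j

/-- `A` is generated over `K[[t]]` by `x`, `y` and the idempotents `e_j`. -/
lemma twisted_induction [HasEnoughRootsOfUnity K n] (hk : (k : ℕ) ≠ 0)
    {p : TwistedRing K n k → Prop} (a : TwistedRing K n k)
    (algebraMap : ∀ c : PowerSeries K, p (algebraMap _ _ c)) (gen_x : p (xA K n k)) (gen_y : p (yA K n k))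
    (vertex : ∀ j, p (idem K n k j)) (add : ∀ a b, p a → p b → p (a + b))
    (mul : ∀ a b, p a → p b → p (a * b)) : p a := by
  let S : Subalgebra (PowerSeries K) (TwistedRing K n k) :=
    { carrier := {a | p a}
      mul_mem' := fun {a b} ha hb => mul a b ha hb
      add_mem' := fun {a b} ha hb => add a b ha hb
      algebraMap_mem' := algebraMap }
  change a ∈ S
  have hK : ∀ (c : K) (a : TwistedRing K n k), a ∈ S → c • a ∈ S := fun c a ha => by
    rw [← algebraMap_smul (PowerSeries K) c a]
    exact S.smul_mem ha _
  induction a using TwistedRing.induction with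
  | h0 => exact zero_mem _
  | h2 a b ha hb => exact add_mem ha hb
  | h1 g r =>
    rw [single_eq]
    refine mul_mem ?_ ?_
    · have h : Submodule.span (PowerSeries K) (Set.range fun i : Fin n × Fin n =>
          xA K n k ^ (i.1 : ℕ) * yA K n k ^ (i.2 : ℕ)) ≤ Subalgebra.toSubmodule S := by
        rw [Submodule.span_le]
        rintro _ ⟨i, rfl⟩
        exact S.mul_mem (pow_mem (show xA K n k ∈ S from gen_x) _) (pow_mem (show yA K n k ∈ S from gen_y) _)
      exact h (mem_span_curve hk r)
    · rw [idem_mul_ofG_sum]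
      exact sum_mem fun j _ => hK _ _ (vertex j)

end Twisted

end Curve

/-! ### Paths in linear and cyclic double quivers -/

/-- Elements `x`, `y` and idempotents `e j` of a ring, behaving like the sums of the arrows
`x : j → j + 1`, of the arrows `y : j + 1 → j`, and the vertices of a linear or cyclic quiver. -/
structure IsZigzag {S : Type*} [Ring S] (x y : S) (e : ℕ → S) : Prop where
  comm : x * y = y * x
  e_mul_x : ∀ j, e (j + 1) * x = x * e j
  e_mul_y : ∀ j, e j * y = y * e (j + 1)
  idem : ∀ j, e j * e j = e j

/-- The shortest path from the vertex `i` to the vertex `k`. -/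
def toVertex {S : Type*} [Ring S] (x y : S) (e : ℕ → S) (k i : ℕ) : S :=
  if i ≤ k then x ^ (k - i) * e i else y ^ (i - k) * e i

namespace IsZigzag

variable {S : Type*} [Ring S] {x y : S} {e : ℕ → S}

lemma e_mul_x_pow (h : IsZigzag x y e) (i j : ℕ) : e (i + j) * x ^ j = x ^ j * e i := by
  induction j with
  | zero => simp
  | succ j ih => rw [pow_succ', ← mul_assoc, ← add_assoc, h.e_mul_x, mul_assoc, ih, mul_assoc]

lemma e_mul_y_pow (h : IsZigzag x y e) (i j : ℕ) : e i * y ^ j = y ^ j * e (i + j) := by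
  induction j with
  | zero => simp
  | succ j ih => rw [pow_succ, ← mul_assoc, ih, mul_assoc, h.e_mul_y, ← add_assoc, mul_assoc]

lemma toVertex_self (k : ℕ) : toVertex x y e k k = e k := by simp [toVertex]

lemma toVertex_of_le {k i : ℕ} (hi : i ≤ k) : toVertex x y e k i = x ^ (k - i) * e i := if_pos hi

lemma toVertex_of_ge {k i : ℕ} (hi : k ≤ i) : toVertex x y e k i = y ^ (i - k) * e i := by
  unfold toVertex
  split_ifs with h
  · rw [le_antisymm h hi]; simp
  · rfl

lemma toVertex_mul_e (h : IsZigzag x y e) (k i : ℕ) : toVertex x y e k i * e i = toVertex x y e k i := by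
  unfold toVertex
  split_ifs <;> rw [mul_assoc, h.idem]

lemma e_mul_toVertex (h : IsZigzag x y e) (k i : ℕ) : e k * toVertex x y e k i = toVertex x y e k i := by
  rcases le_total i k with hi | hi
  · rw [toVertex_of_le hi, ← mul_assoc]
    have := h.e_mul_x_pow i (k - i)
    rw [Nat.add_sub_cancel' hi] at this
    rw [this, mul_assoc, h.idem]
  · rw [toVertex_of_ge hi, ← mul_assoc]
    have := h.e_mul_y_pow k (i - k)
    rw [Nat.add_sub_cancel' hi] at this
    rw [this, mul_assoc, h.idem]

/-- An arrow towards the vertex `k` followed by the shortest path is again a shortest path; an arrow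
away from `k` makes a detour, which costs a factor `x * y`. This and the next three lemmas are the
four cases. -/
lemma toVertex_mul_x_of_lt (h : IsZigzag x y e) {k i : ℕ} (hi : i < k) :
    toVertex x y e k (i + 1) * x = toVertex x y e k i := by
  rw [toVertex_of_le hi.le, toVertex_of_le hi, mul_assoc, h.e_mul_x, ← mul_assoc, ← pow_succ]
  congr 2
  omega

lemma toVertex_mul_x_of_ge (h : IsZigzag x y e) {k i : ℕ} (hi : k ≤ i) :
    toVertex x y e k (i + 1) * x = x * y * toVertex x y e k i := by
  rw [toVertex_of_ge hi, toVertex_of_ge (hi.trans i.le_succ), mul_assoc, h.e_mul_x, ← mul_assoc,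
    ← mul_assoc]
  congr 1
  have hc : Commute x y := h.comm
  rw [Nat.succ_sub hi, ← (hc.pow_right _).eq, pow_succ', mul_assoc]

lemma toVertex_mul_y_of_lt (h : IsZigzag x y e) {k i : ℕ} (hi : i < k) :
    toVertex x y e k i * y = x * y * toVertex x y e k (i + 1) := by
  rw [toVertex_of_le hi.le, toVertex_of_le hi, mul_assoc, h.e_mul_y, ← mul_assoc, ← mul_assoc]
  congr 1
  have hc : Commute x y := h.comm
  rw [hc.eq, mul_assoc y, ← pow_succ', ← ((hc.pow_left _).eq)]
  congr 2
  omega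

lemma toVertex_mul_y_of_ge (h : IsZigzag x y e) {k i : ℕ} (hi : k ≤ i) :
    toVertex x y e k i * y = toVertex x y e k (i + 1) := by
  rw [toVertex_of_ge hi, toVertex_of_ge (hi.trans i.le_succ), mul_assoc, h.e_mul_y, ← mul_assoc,
    ← pow_succ]
  congr 2
  omega

end IsZigzag

/-! ### The module `P_n` -/

section Pn

variable {K : Type u} [Field K] {n : ℕ} {k : Fin n} [NeZero n] [HasEnoughRootsOfUnity K n]

variable (K n k) in
lemma zigzag_twisted : IsZigzag (xA K n k) (yA K n k) (idem K n k) :=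
  ⟨xA_mul_yA K n k, idem_mul_xA K n k, idem_mul_yA K n k, idem_mul_idem_self K n k⟩

lemma idem_mod (j : ℕ) : idem K n k (j % n) = idem K n k j := by
  simp only [idem]
  congr 1
  refine Finset.sum_congr rfl fun g _ => ?_
  congr 1
  conv_rhs => rw [← Nat.div_add_mod j n]
  rw [pow_add, pow_mul, inv_pow _ n, val_pow', inv_one, one_pow, one_mul]

/-- Compatibility with `x`, `y`, the vertices and `K[[t]]` implies `A`-linearity. -/
def linearOfGenerators (hk : (k : ℕ) ≠ 0) {M N : Type*} [AddCommGroup M] [AddCommGroup N]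
    [Module (TwistedRing K n k) M] [Module (TwistedRing K n k) N]
    [Module (PowerSeries K) M] [IsScalarTower (PowerSeries K) (TwistedRing K n k) M]
    [Module (PowerSeries K) N] [IsScalarTower (PowerSeries K) (TwistedRing K n k) N]
    (f : M →ₗ[PowerSeries K] N) (hx : ∀ m, f (xA K n k • m) = xA K n k • f m)
    (hy : ∀ m, f (yA K n k • m) = yA K n k • f m)
    (he : ∀ j < n, ∀ m, f (idem K n k j • m) = idem K n k j • f m) :
    M →ₗ[TwistedRing K n k] N where
  toFun := f
  map_add' := map_add f
  map_smul' a m := by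
    induction a using twisted_induction (K := K) hk generalizing m with
    | algebraMap c => simp only [algebraMap_smul, map_smul, RingHom.id_apply]
    | gen_x => exact hx m
    | gen_y => exact hy m
    | vertex j => rw [← idem_mod]; exact he _ (Nat.mod_lt _ (NeZero.pos n)) m
    | add a b ha hb => rw [add_smul, map_add, ha, hb, RingHom.id_apply, ← add_smul]; rfl
    | mul a b ha hb => rw [mul_smul, ha, hb, RingHom.id_apply, RingHom.id_apply, ← mul_smul]; rfl

variable (K n k) in
/-- The shortest path from the vertex `0` to the vertex `i` (for `0 ≤ i ≤ n`). -/
def fromZero (i : ℕ) : TwistedRing K n k :=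
  if i ≤ k then xA K n k ^ i * idem K n k n else yA K n k ^ (n - i) * idem K n k n

lemma fromZero_of_le {i : ℕ} (hi : i ≤ k) : fromZero K n k i = xA K n k ^ i * idem K n k n :=
  if_pos hi

/-- The two branches of the definition agree at `i = k` by the equation of the curve. -/
lemma fromZero_of_ge {i : ℕ} (hi : k ≤ i) :
    fromZero K n k i = yA K n k ^ (n - i) * idem K n k n := by
  unfold fromZero
  split_ifs with h
  · rw [le_antisymm h hi, xA_pow]
  · rfl

lemma fromZero_zero : fromZero K n k 0 = idem K n k n := by simp [fromZero]

lemma fromZero_n : fromZero K n k n = idem K n k n := by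
  rw [fromZero_of_ge k.isLt.le]; simp

lemma xA_mul_fromZero_of_lt {i : ℕ} (hi : i < k) :
    xA K n k * fromZero K n k i = fromZero K n k (i + 1) := by
  rw [fromZero_of_le hi.le, fromZero_of_le hi, ← mul_assoc, pow_succ']

lemma xA_mul_fromZero_of_ge {i : ℕ} (hi : k ≤ i) (hn : i < n) :
    xA K n k * fromZero K n k i = (PowerSeries.X : PowerSeries K) • fromZero K n k (i + 1) := by
  rw [fromZero_of_ge hi, fromZero_of_ge (hi.trans i.le_succ), Algebra.smul_def,
    algebraMap_X_twisted, ← mul_assoc, ← mul_assoc, mul_assoc (xA K n k) (yA K n k), ← pow_succ']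
  congr 3
  omega

lemma yA_mul_fromZero_of_lt {i : ℕ} (hi : i < k) :
    yA K n k * fromZero K n k (i + 1) = (PowerSeries.X : PowerSeries K) • fromZero K n k i := by
  rw [fromZero_of_le hi, fromZero_of_le hi.le, Algebra.smul_def, algebraMap_X_twisted,
    ← mul_assoc, ← mul_assoc, xA_mul_yA, mul_assoc (yA K n k) (xA K n k), ← pow_succ']

lemma yA_mul_fromZero_of_ge {i : ℕ} (hi : k ≤ i) (hn : i < n) :
    yA K n k * fromZero K n k (i + 1) = fromZero K n k i := by
  rw [fromZero_of_ge hi, fromZero_of_ge (hi.trans i.le_succ), ← mul_assoc, ← pow_succ']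
  congr 2
  omega

lemma fromZero_mul_idem (i : ℕ) : fromZero K n k i * idem K n k n = fromZero K n k i := by
  unfold fromZero
  split_ifs <;> rw [mul_assoc, idem_mul_idem_self]

lemma idem_mul_fromZero {i : ℕ} (hi : i ≤ n) :
    idem K n k i * fromZero K n k i = fromZero K n k i := by
  have hz := zigzag_twisted K n k
  rcases le_total i k with h | h
  · rw [fromZero_of_le h, idem_self, ← mul_assoc]
    have := hz.e_mul_x_pow 0 i
    rw [zero_add] at this
    rw [this, mul_assoc, hz.idem]
  · rw [fromZero_of_ge h, ← mul_assoc]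
    have := hz.e_mul_y_pow i (n - i)
    rw [Nat.add_sub_cancel' hi] at this
    rw [this, mul_assoc, hz.idem]

lemma idem_mul_fromZero_ne {i j : ℕ} (hi : i < n) (hj : j < n) (hij : j ≠ i) :
    idem K n k j * fromZero K n k i = 0 := by
  rw [← idem_mul_fromZero hi.le, ← mul_assoc, idem_mul_idem_ne K n k hj hi hij, zero_mul]

variable (K n k) in
/-- The shortest path from the vertex `i` to the vertex `k` in `A`. -/
abbrev toK (i : ℕ) : TwistedRing K n k := toVertex (xA K n k) (yA K n k) (idem K n k) k i

/-- A shortest path from `0` to `k`, on either side of the cycle, can be cut at any vertex `i` on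
it. No factor `t` appears, which is why `P_n`, generated at the vertex `n`, is also cogenerated at
the vertex `k`. -/
lemma toK_mul_fromZero {i : ℕ} (hi : i ≤ n) : toK K n k i * fromZero K n k i = fromZero K n k k := by
  rcases le_total i k with h | h
  · rw [toK, IsZigzag.toVertex_of_le h, mul_assoc, idem_mul_fromZero hi, fromZero_of_le h,
      fromZero_of_le le_rfl, ← mul_assoc, ← pow_add, Nat.sub_add_cancel h]
  · rw [toK, IsZigzag.toVertex_of_ge h, mul_assoc, idem_mul_fromZero hi, fromZero_of_ge h,
      fromZero_of_ge le_rfl, ← mul_assoc, ← pow_add]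
    congr 2
    omega

lemma toK_mul_fromZero_ne {i j : ℕ} (hi : i < n) (hj : j < n) (hij : j ≠ i) :
    toK K n k j * fromZero K n k i = 0 := by
  rw [toK, ← (zigzag_twisted K n k).toVertex_mul_e, mul_assoc, idem_mul_fromZero_ne hi hj hij, mul_zero]

/-- The vertices `0` and `n` coincide in `A`, and `x ^ k = y ^ (n - k)` identifies the two ways from
there to `k`. -/
lemma toK_zero : toK K n k 0 = toK K n k n := by
  rw [toK, toK, IsZigzag.toVertex_of_le (Nat.zero_le _), IsZigzag.toVertex_of_ge k.isLt.le, ← idem_self,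
    Nat.sub_zero, xA_pow]

lemma toK_mul_idem_ne {i j : ℕ} (hi : i < n) (hj : j < n) (hij : i ≠ j) :
    toK K n k i * idem K n k j = 0 := by
  rw [toK, ← (zigzag_twisted K n k).toVertex_mul_e, mul_assoc, idem_mul_idem_ne K n k hi hj hij, mul_zero]

/-- Cyclic reindexing: it absorbs the shift of vertices caused by an arrow when the terms at `0` and
`N` agree. -/
lemma sum_range_shift {G : Type*} [AddCommGroup G] (F : ℕ → G) (N : ℕ) (h : F N = F 0) :
    ∑ i ∈ Finset.range N, F (i + 1) = ∑ i ∈ Finset.range N, F i := by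
  have := Finset.sum_range_succ F N
  rw [Finset.sum_range_succ', h] at this
  exact add_right_cancel this

variable (K n k) in
/-- The generator of the `i`-th component of `P_n`. -/
def pnGen (i : ℕ) : Pn K n k := ⟨fromZero K n k i, by
  rw [← fromZero_mul_idem]
  exact Submodule.smul_mem _ _ (Submodule.subset_span rfl)⟩

lemma xA_smul_pnGen_of_lt {i : ℕ} (hi : i < k) : xA K n k • pnGen K n k i = pnGen K n k (i + 1) :=
  Subtype.ext (xA_mul_fromZero_of_lt hi)

lemma xA_smul_pnGen_of_ge {i : ℕ} (hi : k ≤ i) (hn : i < n) :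
    xA K n k • pnGen K n k i = (PowerSeries.X : PowerSeries K) • pnGen K n k (i + 1) :=
  Subtype.ext (xA_mul_fromZero_of_ge hi hn)

lemma yA_smul_pnGen_of_lt {i : ℕ} (hi : i < k) :
    yA K n k • pnGen K n k (i + 1) = (PowerSeries.X : PowerSeries K) • pnGen K n k i :=
  Subtype.ext (yA_mul_fromZero_of_lt hi)

lemma yA_smul_pnGen_of_ge {i : ℕ} (hi : k ≤ i) (hn : i < n) :
    yA K n k • pnGen K n k (i + 1) = pnGen K n k i :=
  Subtype.ext (yA_mul_fromZero_of_ge hi hn)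

lemma pnGen_n : pnGen K n k n = pnGen K n k 0 :=
  Subtype.ext (fromZero_n.trans fromZero_zero.symm)

lemma idem_smul_pnGen {i : ℕ} (hi : i ≤ n) : idem K n k i • pnGen K n k i = pnGen K n k i :=
  Subtype.ext (idem_mul_fromZero hi)

lemma idem_smul_pnGen_ne {i j : ℕ} (hi : i < n) (hj : j < n) (hij : j ≠ i) :
    idem K n k j • pnGen K n k i = 0 :=
  Subtype.ext (idem_mul_fromZero_ne hi hj hij)

lemma toK_smul_pnGen {i : ℕ} (hi : i ≤ n) : toK K n k i • pnGen K n k i = pnGen K n k k :=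
  Subtype.ext (toK_mul_fromZero hi)

lemma toK_smul_pnGen_ne {i j : ℕ} (hi : i < n) (hj : j < n) (hij : j ≠ i) :
    toK K n k j • pnGen K n k i = 0 :=
  Subtype.ext (toK_mul_fromZero_ne hi hj hij)

lemma eq_smul_pnGen (p : Pn K n k) : ∃ a : TwistedRing K n k, p = a • pnGen K n k 0 := by
  obtain ⟨a, ha⟩ := Submodule.mem_span_singleton.mp p.2
  refine ⟨a, Subtype.ext ?_⟩
  rw [← ha]
  exact congrArg (a * ·) fromZero_zero.symm

lemma pn_hom_ext {M : Type*} [AddCommGroup M] [Module (TwistedRing K n k) M]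
    {f g : Pn K n k →ₗ[TwistedRing K n k] M} (h : f (pnGen K n k 0) = g (pnGen K n k 0)) :
    f = g := by
  ext p
  obtain ⟨a, rfl⟩ := eq_smul_pnGen p
  rw [map_smul, map_smul, h]

/-- The `K[[t]]`-span of the shortest paths is stable under `x`, `y` and the vertices, so it is an
`A`-submodule; it contains the generator of `P_n`. -/
lemma pnGen_span (hk : (k : ℕ) ≠ 0) :
    ⊤ ≤ Submodule.span (PowerSeries K) (Set.range fun i : Fin n => pnGen K n k i) := by
  set T := Submodule.span (PowerSeries K) (Set.range fun i : Fin n => pnGen K n k i) with hT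
  have hmem : ∀ i, i ≤ n → pnGen K n k i ∈ T := by
    intro i hi
    rcases hi.lt_or_eq with h | rfl
    · exact Submodule.subset_span ⟨⟨i, h⟩, rfl⟩
    · rw [pnGen_n]; exact Submodule.subset_span ⟨⟨0, NeZero.pos _⟩, rfl⟩
  have hlin : ∀ b : TwistedRing K n k, (∀ i < n, b • pnGen K n k i ∈ T) → ∀ p ∈ T, b • p ∈ T := by
    intro b hb p hp
    induction hp using Submodule.span_induction with
    | mem p hp => obtain ⟨i, rfl⟩ := hp; exact hb i i.isLt
    | zero => rw [smul_zero]; exact zero_mem _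
    | add p q _ _ hp hq => rw [smul_add]; exact add_mem hp hq
    | smul c p _ hp => rw [smul_comm]; exact T.smul_mem c hp
  have key : ∀ a : TwistedRing K n k, ∀ p ∈ T, a • p ∈ T := by
    intro a
    induction a using twisted_induction (K := K) hk with
    | algebraMap c => intro p hp; rw [algebraMap_smul]; exact T.smul_mem c hp
    | add a b ha hb => intro p hp; rw [add_smul]; exact add_mem (ha p hp) (hb p hp)
    | mul a b ha hb => intro p hp; rw [mul_smul]; exact ha _ (hb p hp)
    | gen_x =>
      refine hlin _ fun i hi => ?_
      rcases lt_or_ge i (k : ℕ) with h | h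
      · rw [xA_smul_pnGen_of_lt h]; exact hmem _ hi
      · rw [xA_smul_pnGen_of_ge h hi]; exact T.smul_mem _ (hmem _ hi)
    | gen_y =>
      refine hlin _ fun i hi => ?_
      -- The action of `y` is known on the element at `j + 1`; the vertex `0` is therefore read as
      -- `n`.
      obtain ⟨j, hj, hij⟩ : ∃ j < n, pnGen K n k i = pnGen K n k (j + 1) := by
        rcases i with _ | i
        · exact ⟨n - 1, by omega, by rw [Nat.sub_add_cancel (NeZero.pos n), pnGen_n]⟩
        · exact ⟨i, by omega, rfl⟩
      rw [hij]
      rcases lt_or_ge j (k : ℕ) with h | h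
      · rw [yA_smul_pnGen_of_lt h]; exact T.smul_mem _ (hmem _ hj.le)
      · rw [yA_smul_pnGen_of_ge h hj]; exact hmem _ hj.le
    | vertex j =>
      refine hlin _ fun i hi => ?_
      rw [← idem_mod]
      by_cases h : j % n = i
      · rw [h, idem_smul_pnGen hi.le]; exact hmem _ hi.le
      · rw [idem_smul_pnGen_ne hi (Nat.mod_lt _ (NeZero.pos n)) h]; exact zero_mem _
  intro p _
  obtain ⟨a, rfl⟩ := eq_smul_pnGen p
  exact key a _ (hmem 0 (Nat.zero_le _))

variable (k) in
-- Returning along the same path gives a power of `t`. Torsion-freeness of `P_n` and the simplicity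
-- of its generic fibre both rest on this.
lemma exists_mul_fromZero (i : ℕ) : ∃ (b : TwistedRing K n k) (m : ℕ), b * fromZero K n k i =
    (PowerSeries.X : PowerSeries K) ^ m • idem K n k n := by
  have hc : Commute (xA K n k) (yA K n k) := xA_mul_yA K n k
  rcases le_total i k with h | h
  · refine ⟨yA K n k ^ i, i, ?_⟩
    rw [fromZero_of_le h, ← mul_assoc, Algebra.smul_def, map_pow, algebraMap_X_twisted,
      hc.mul_pow, (hc.pow_pow _ _).eq]
  · refine ⟨xA K n k ^ (n - i), n - i, ?_⟩
    rw [fromZero_of_ge h, ← mul_assoc, Algebra.smul_def, map_pow, algebraMap_X_twisted,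
      hc.mul_pow]

lemma smul_pnGen_eq_zero (hk : (k : ℕ) ≠ 0) {c : PowerSeries K} {i : ℕ} (_ : i ≤ n)
    (h : c • pnGen K n k i = 0) : c = 0 := by
  have h1 : c • fromZero K n k i = 0 := congrArg Subtype.val h
  obtain ⟨b, m, hb⟩ := exists_mul_fromZero (K := K) k i
  have h2 : (c * PowerSeries.X ^ m) • idem K n k n = 0 := by
    rw [mul_smul, ← hb, ← mul_smul_comm, h1, mul_zero]
  exact (mul_eq_zero.mp (smul_idem_n_eq_zero hk h2)).resolve_right
    (pow_ne_zero _ PowerSeries.X_ne_zero)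

/-- The basis of `P_n` over `K[[t]]` given by the shortest paths. -/
def pnBasis (hk : (k : ℕ) ≠ 0) : Module.Basis (Fin n) (PowerSeries K) (Pn K n k) :=
  Module.Basis.mk (v := fun i : Fin n => pnGen K n k i) (by
    rw [Fintype.linearIndependent_iff]
    intro c hc j
    have h := congrArg (idem K n k j • ·) hc
    simp only [Finset.smul_sum, smul_zero] at h
    rw [Finset.sum_eq_single j] at h
    · rw [smul_comm, idem_smul_pnGen j.isLt.le] at h
      exact smul_pnGen_eq_zero hk j.isLt.le h
    · intro i _ hij
      rw [smul_comm, idem_smul_pnGen_ne i.isLt j.isLt (fun h => hij (Fin.ext h.symm)), smul_zero]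
    · simp) (pnGen_span hk)

lemma pnBasis_apply (hk : (k : ℕ) ≠ 0) (i : Fin n) : pnBasis (K := K) hk i = pnGen K n k i :=
  Module.Basis.mk_apply _ _ _

/-! ### Homomorphisms to `P_n` as linear forms at the vertex `k`. -/

section Coinduced

variable {M : Type*} [AddCommGroup M] [Module (TwistedRing K n k) M]
    [Module (PowerSeries K) M] [IsScalarTower (PowerSeries K) (TwistedRing K n k) M]

lemma smul_smul_comm' (a : TwistedRing K n k) (c : PowerSeries K) (m : M) :
    a • c • m = c • a • m := by
  rw [← algebraMap_smul (TwistedRing K n k) c m, ← algebraMap_smul (TwistedRing K n k) c (a • m),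
    smul_smul, smul_smul, Algebra.commutes]

lemma xA_yA_smul (m : M) : (xA K n k * yA K n k) • m = (PowerSeries.X : PowerSeries K) • m := by
  rw [← algebraMap_X_twisted, algebraMap_smul]

/-- `P_n` is coinduced from the vertex `k`: the homomorphism `M → P_n` given by a linear form on
the component of `M` at `k`. -/
def coind (hk : (k : ℕ) ≠ 0) (φ : M →ₗ[PowerSeries K] PowerSeries K) :
    M →ₗ[TwistedRing K n k] Pn K n k :=
  linearOfGenerators hk
    { toFun := fun m => ∑ i ∈ Finset.range n, φ (toK K n k i • m) • pnGen K n k i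
      map_add' := fun m m' => by
        simp only [smul_add, map_add, add_smul, Finset.sum_add_distrib]
      map_smul' := fun c m => by
        simp only [smul_smul_comm', map_smul, smul_assoc, Finset.smul_sum, RingHom.id_apply] }
    (fun m => by
      simp only [LinearMap.coe_mk, AddHom.coe_mk]
      rw [← sum_range_shift, Finset.smul_sum]
      · refine Finset.sum_congr rfl fun i hi => ?_
        rw [smul_smul, smul_smul_comm']
        -- The factors `t` match: for `i < k` neither the path to `k` nor the generator of `P_n`
        -- acquires one, for `i ≥ k` both do. For `y` below the two cases are exchanged.
        rcases lt_or_ge i (k : ℕ) with h | h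
        · rw [(zigzag_twisted K n k).toVertex_mul_x_of_lt h, xA_smul_pnGen_of_lt h]
        · rw [(zigzag_twisted K n k).toVertex_mul_x_of_ge h, mul_smul, xA_yA_smul,
            xA_smul_pnGen_of_ge h (Finset.mem_range.mp hi), map_smul, smul_eq_mul, mul_comm,
            mul_smul]
      · rw [toK_zero, pnGen_n])
    (fun m => by
      simp only [LinearMap.coe_mk, AddHom.coe_mk]
      rw [← sum_range_shift (fun i => φ (toK K n k i • m) • pnGen K n k i), Finset.smul_sum]
      · refine Finset.sum_congr rfl fun i hi => ?_
        rw [smul_smul, smul_smul_comm']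
        rcases lt_or_ge i (k : ℕ) with h | h
        · rw [(zigzag_twisted K n k).toVertex_mul_y_of_lt h, yA_smul_pnGen_of_lt h, mul_smul,
            xA_yA_smul, map_smul, smul_eq_mul, mul_comm, mul_smul]
        · rw [(zigzag_twisted K n k).toVertex_mul_y_of_ge h,
            yA_smul_pnGen_of_ge h (Finset.mem_range.mp hi)]
      · rw [toK_zero, pnGen_n])
    (fun j hj m => by
      simp only [LinearMap.coe_mk, AddHom.coe_mk]
      rw [Finset.smul_sum]
      refine Finset.sum_congr rfl fun i hi => ?_
      rw [smul_smul, smul_smul_comm']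
      by_cases h : j = i
      · subst h
        rw [(zigzag_twisted K n k).toVertex_mul_e, idem_smul_pnGen hj.le]
      · rw [toK_mul_idem_ne (Finset.mem_range.mp hi) hj (Ne.symm h),
          idem_smul_pnGen_ne (Finset.mem_range.mp hi) hj h, zero_smul, map_zero, zero_smul,
          smul_zero])

lemma coind_apply (hk : (k : ℕ) ≠ 0) (φ : M →ₗ[PowerSeries K] PowerSeries K) (m : M) :
    coind hk φ m = ∑ i ∈ Finset.range n, φ (toK K n k i • m) • pnGen K n k i := rfl

end Coinduced

/-- It suffices to look at the generator: `toK 0` takes it to the basis element at `k`, whose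
coordinate is `1`. Hence every homomorphism to `P_n` is recovered from its coordinate at `k`. -/
lemma coind_coord (hk : (k : ℕ) ≠ 0) (p : Pn K n k) : coind hk ((pnBasis hk).coord k) p = p := by
  suffices h : coind hk ((pnBasis hk).coord k) = LinearMap.id by rw [h]; rfl
  refine pn_hom_ext ?_
  rw [coind_apply, Finset.sum_eq_single 0]
  · rw [toK_smul_pnGen (Nat.zero_le _), ← pnBasis_apply hk, Module.Basis.coord_apply,
      Module.Basis.repr_self, Finsupp.single_eq_same, one_smul]
    rfl
  · intro i hi h0
    rw [toK_smul_pnGen_ne (NeZero.pos n) (Finset.mem_range.mp hi) h0, map_zero, zero_smul]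
  · intro h
    exact absurd (Finset.mem_range.mpr (NeZero.pos n)) h

/-- Homomorphisms to `P_n` extend along injections that split over `K[[t]]`. -/
lemma exists_extension_pn (hk : (k : ℕ) ≠ 0) {L M : Type*} [AddCommGroup L] [AddCommGroup M]
    [Module (TwistedRing K n k) L] [Module (TwistedRing K n k) M]
    [Module (PowerSeries K) L] [IsScalarTower (PowerSeries K) (TwistedRing K n k) L]
    [Module (PowerSeries K) M] [IsScalarTower (PowerSeries K) (TwistedRing K n k) M]
    (i : L →ₗ[TwistedRing K n k] M) (s : M →ₗ[PowerSeries K] L) (hs : ∀ l, s (i l) = l)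
    (g : L →ₗ[TwistedRing K n k] Pn K n k) :
    ∃ h : M →ₗ[TwistedRing K n k] Pn K n k, h ∘ₗ i = g := by
  -- The linear form that defines `g` is extended through the retraction `s`, which need only be
  -- `K[[t]]`-linear; coinduction restores `A`-linearity.
  refine ⟨coind hk (((pnBasis hk).coord k ∘ₗ g.restrictScalars (PowerSeries K)) ∘ₗ s), ?_⟩
  ext l : 1
  rw [LinearMap.comp_apply, ← coind_coord hk (g l), coind_apply, coind_apply]
  refine Finset.sum_congr rfl fun j _ => ?_
  simp only [LinearMap.comp_apply, ← map_smul i, hs, LinearMap.coe_restrictScalars, map_smul g]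

/-- Right multiplication by the idempotent `e_n` is a retraction of `A` onto `A e_n`. -/
lemma projective_pn : Module.Projective (TwistedRing K n k) (Pn K n k) := by
  refine Module.Projective.of_split (Pn K n k).subtype
    ((LinearMap.toSpanSingleton _ _ (idem K n k n)).codRestrict (Pn K n k) fun a =>
      Submodule.smul_mem _ _ (Submodule.subset_span rfl)) ?_
  ext p
  obtain ⟨a, ha⟩ := Submodule.mem_span_singleton.mp p.2
  change (p : TwistedRing K n k) * idem K n k n = p
  rw [← ha, smul_eq_mul, mul_assoc, idem_mul_idem_self]

end Pn

/-! ### Cohen-Macaulay modules and the submodule generated by the vertex `n` -/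

section CMModules

variable {K : Type u} [Field K] {n : ℕ} {k : Fin n}

/-- The definitions of `CM(A)` and of the rank use this particular `K[[t]]`-structure; any
compatible one may replace it. -/
lemma restrictScalars_eq (M : Type*) [AddCommGroup M] [Module (TwistedRing K n k) M]
    [inst : Module (PowerSeries K) M] [IsScalarTower (PowerSeries K) (TwistedRing K n k) M] :
    Module.restrictScalars (PowerSeries K) (TwistedRing K n k) M = inst :=
  Module.ext' _ _ fun c m => algebraMap_smul (TwistedRing K n k) c m

variable [NeZero n]

/-- `A` is finite over `K[[t]]`, so finite generation over the two rings is the same condition. -/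
lemma isCM_of_iff (hk : (k : ℕ) ≠ 0) (M : Type u) [AddCommGroup M]
    [Module (TwistedRing K n k) M] [Module (PowerSeries K) M]
    [IsScalarTower (PowerSeries K) (TwistedRing K n k) M] :
    isCM K n k (ModuleCat.of (TwistedRing K n k) M) ↔
      Module.Finite (PowerSeries K) M ∧ Module.Free (PowerSeries K) M := by
  have := finite_twisted (K := K) hk
  unfold isCM
  change Module.Finite (TwistedRing K n k) M ∧ @Module.Free (PowerSeries K) M _ _
    (Module.restrictScalars (PowerSeries K) (TwistedRing K n k) M) ↔ _
  rw [restrictScalars_eq M]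
  refine and_congr_left fun _ => ⟨fun h => Module.Finite.trans (TwistedRing K n k) M,
    fun h => Module.Finite.of_restrictScalars_finite (PowerSeries K) (TwistedRing K n k) M⟩

lemma isCM.finite_free (hk : (k : ℕ) ≠ 0) {M : ModuleCat.{u} (TwistedRing K n k)}
    (h : isCM K n k M) [Module (PowerSeries K) M]
    [IsScalarTower (PowerSeries K) (TwistedRing K n k) M] :
    Module.Finite (PowerSeries K) M ∧ Module.Free (PowerSeries K) M :=
  (isCM_of_iff hk M).mp h

/-- A module that is finite over `K[[t]]` and embeds in a torsion-free one is Cohen-Macaulay. -/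
lemma isCM_of_injective (hk : (k : ℕ) ≠ 0) {M N : Type u} [AddCommGroup M] [AddCommGroup N]
    [Module (TwistedRing K n k) M] [Module (PowerSeries K) M]
    [IsScalarTower (PowerSeries K) (TwistedRing K n k) M]
    [Module (TwistedRing K n k) N] [Module (PowerSeries K) N]
    [IsScalarTower (PowerSeries K) (TwistedRing K n k) N] [Module.Finite (PowerSeries K) N]
    [Module.Free (PowerSeries K) N] (f : M →ₗ[TwistedRing K n k] N) (hf : Function.Injective f) :
    isCM K n k (ModuleCat.of (TwistedRing K n k) M) := by
  rw [isCM_of_iff hk]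
  let g : M →ₗ[PowerSeries K] N := f.restrictScalars (PowerSeries K)
  have hg : Function.Injective g := hf
  have := Module.Finite.of_injective g hg
  have := hg.moduleIsTorsionFree g (fun c m => map_smul g c m)
  exact ⟨inferInstance, Module.free_of_finite_type_torsion_free'⟩

variable [HasEnoughRootsOfUnity K n]

lemma isCM_pn (hk : (k : ℕ) ≠ 0) : isCM K n k (ModuleCat.of (TwistedRing K n k) (Pn K n k)) := by
  rw [isCM_of_iff hk]
  exact ⟨Module.Finite.of_basis (pnBasis hk), Module.Free.of_basis (pnBasis hk)⟩

variable {M : Type*} [AddCommGroup M] [Module (TwistedRing K n k) M]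

variable (K n k M) in
/-- The submodule `(e_n) M`. -/
abbrev genZero : Submodule (TwistedRing K n k) M := idealEn K n k • ⊤

lemma sum_idem_smul (m : M) : ∑ j ∈ Finset.range n, idem K n k j • m = m := by
  rw [← Finset.sum_smul, sum_idem, one_smul]

/-- The homomorphism `P_n → M` with `e_n ↦ e_n m`. -/
def pnMap (m : M) : Pn K n k →ₗ[TwistedRing K n k] M :=
  (LinearMap.toSpanSingleton (TwistedRing K n k) M m) ∘ₗ (Pn K n k).subtype

lemma pnMap_apply (m : M) (p : Pn K n k) : pnMap m p = (p : TwistedRing K n k) • m := rfl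

lemma pnMap_pnGen (m : M) (i : ℕ) : pnMap m (pnGen K n k i) = fromZero K n k i • m := rfl

lemma pnMap_zero (m : M) : pnMap m (pnGen K n k 0) = idem K n k n • m := by
  rw [pnMap_pnGen, fromZero_zero]

lemma fromZero_smul_mem (i : ℕ) (m : M) : fromZero K n k i • m ∈ genZero K n k M := by
  rw [← fromZero_mul_idem, mul_smul]
  exact Submodule.smul_mem _ _ (Submodule.smul_mem_smul
    (TwoSidedIdeal.mem_asIdeal.mpr (TwoSidedIdeal.subset_span rfl)) trivial)

lemma pn_smul_mem (p : Pn K n k) (m : M) : (p : TwistedRing K n k) • m ∈ genZero K n k M := by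
  obtain ⟨a, rfl⟩ := eq_smul_pnGen p
  change (a * fromZero K n k 0) • m ∈ _
  rw [mul_smul]
  exact Submodule.smul_mem _ _ (fromZero_smul_mem 0 m)

/-- The elements of `A` that take `M` into the submodule generated by `e_n M` form a two-sided
ideal, and it contains `e_n`. -/
lemma genZero_eq_span : genZero K n k M =
    Submodule.span (TwistedRing K n k) (Set.range fun m : M => idem K n k n • m) := by
  set N := Submodule.span (TwistedRing K n k) (Set.range fun m : M => idem K n k n • m)
  apply le_antisymm
  · rw [Submodule.smul_le]
    intro a ha m _
    let J : TwoSidedIdeal (TwistedRing K n k) := TwoSidedIdeal.mk' {a | ∀ m : M, a • m ∈ N}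
      (fun m => by rw [zero_smul]; exact zero_mem _)
      (fun {a b} ha hb m => by rw [add_smul]; exact add_mem (ha m) (hb m))
      (fun {a} ha m => by rw [neg_smul]; exact neg_mem (ha m))
      (fun {a b} hb m => by rw [mul_smul]; exact N.smul_mem a (hb m))
      (fun {a b} ha m => by rw [mul_smul]; exact ha _)
    have hJ : ∀ a, a ∈ J ↔ ∀ m : M, a • m ∈ N := TwoSidedIdeal.mem_mk' _ _ _ _ _ _
    refine (hJ a).mp ?_ m
    refine TwoSidedIdeal.mem_span_iff.mp (TwoSidedIdeal.mem_asIdeal.mp ha) J ?_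
    rintro _ rfl
    exact (hJ _).mpr fun m => Submodule.subset_span ⟨m, rfl⟩
  · rw [Submodule.span_le]
    rintro _ ⟨m, rfl⟩
    change idem K n k n • m ∈ _
    rw [← fromZero_zero]
    exact fromZero_smul_mem 0 m

variable [Module (PowerSeries K) M] [IsScalarTower (PowerSeries K) (TwistedRing K n k) M]

lemma pn_smul_eq_sum (hk : (k : ℕ) ≠ 0) (p : Pn K n k) (m : M) :
    ∃ m' : ℕ → M, (p : TwistedRing K n k) • m = ∑ i ∈ Finset.range n, fromZero K n k i • m' i := by
  refine ⟨fun i => if h : i < n then (pnBasis hk).repr p ⟨i, h⟩ • m else 0, ?_⟩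
  rw [← pnMap_apply]
  conv_lhs => rw [← (pnBasis hk).sum_repr p]
  rw [map_sum, Finset.sum_range]
  refine Finset.sum_congr rfl fun i _ => ?_
  simp only [i.isLt, dif_pos, Fin.eta]
  rw [pnBasis_apply, smul_smul_comm', ← pnMap_pnGen]
  exact map_smul ((pnMap m).restrictScalars (PowerSeries K)) _ _

/-- `P_n` is spanned over `K[[t]]` by the shortest paths, so products of elements of `P_n` with `M`
reduce to these. -/
lemma mem_genZero_iff_sum (hk : (k : ℕ) ≠ 0) (w : M) : w ∈ genZero K n k M ↔
    ∃ m : ℕ → M, w = ∑ i ∈ Finset.range n, fromZero K n k i • m i := by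
  constructor
  · intro hw
    rw [genZero_eq_span] at hw
    induction hw using Submodule.span_induction with
    | mem w hw =>
      obtain ⟨m, rfl⟩ := hw
      have := pn_smul_eq_sum hk (pnGen K n k 0) m
      rwa [show ((pnGen K n k 0 : Pn K n k) : TwistedRing K n k) = idem K n k n from
        fromZero_zero] at this
    | zero => exact ⟨0, by simp⟩
    | add w w' _ _ h h' =>
      obtain ⟨m, rfl⟩ := h
      obtain ⟨m', rfl⟩ := h'
      exact ⟨m + m', by simp only [Pi.add_apply, smul_add, Finset.sum_add_distrib]⟩
    | smul a w _ h =>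
      obtain ⟨m, rfl⟩ := h
      choose m' hm' using fun i => pn_smul_eq_sum hk (a • pnGen K n k i) (m i)
      refine ⟨fun j => ∑ i ∈ Finset.range n, m' i j, ?_⟩
      simp only [Finset.smul_sum]
      rw [Finset.sum_comm]
      refine Finset.sum_congr rfl fun i _ => ?_
      rw [← hm', smul_smul]
      rfl
  · rintro ⟨m, rfl⟩
    exact sum_mem fun i _ => fromZero_smul_mem i _

lemma idem_smul_fromZero_smul_sum {j : ℕ} (hj : j < n) (m : ℕ → M) :
    idem K n k j • ∑ i ∈ Finset.range n, fromZero K n k i • m i = fromZero K n k j • m j := by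
  rw [Finset.smul_sum, Finset.sum_eq_single j, smul_smul, idem_mul_fromZero hj.le]
  · intro i hi hij
    rw [smul_smul, idem_mul_fromZero_ne (Finset.mem_range.mp hi) hj hij.symm, zero_smul]
  · intro h
    exact absurd (Finset.mem_range.mpr hj) h

/-- Membership in `(e_n) M` at the vertex `j`. -/
lemma exists_fromZero_smul (hk : (k : ℕ) ≠ 0) {j : ℕ} (hj : j ≤ n) {w : M}
    (hw : w ∈ genZero K n k M) :
    ∃ m : M, idem K n k n • m = m ∧ idem K n k j • w = fromZero K n k j • m := by
  obtain ⟨m, rfl⟩ := (mem_genZero_iff_sum hk w).mp hw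
  have : ∃ m', idem K n k j • ∑ i ∈ Finset.range n, fromZero K n k i • m i =
      fromZero K n k j • m' := by
    rcases hj.lt_or_eq with h | rfl
    · exact ⟨_, idem_smul_fromZero_smul_sum h m⟩
    · refine ⟨m 0, ?_⟩
      rw [idem_self, fromZero_n, ← fromZero_zero, idem_smul_fromZero_smul_sum (NeZero.pos j)]
  obtain ⟨m', hm'⟩ := this
  refine ⟨idem K n k n • m', ?_, ?_⟩
  · rw [smul_smul, idem_mul_idem_self]
  · rw [hm', smul_smul, fromZero_mul_idem]

variable [Module.IsTorsionFree (PowerSeries K) M]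

/-- As `t = x y` is injective on a torsion-free module, so are `x` and `y`, and every shortest path
is injective on the component at its source. This is the cancellation behind most later arguments.
-/
lemma xA_smul_eq_zero {m : M} (h : xA K n k • m = 0) : m = 0 := by
  have : (PowerSeries.X : PowerSeries K) • m = 0 := by
    rw [← xA_yA_smul (k := k), xA_mul_yA, mul_smul, h, smul_zero]
  exact (smul_eq_zero.mp this).resolve_left PowerSeries.X_ne_zero

lemma yA_smul_eq_zero {m : M} (h : yA K n k • m = 0) : m = 0 := by
  have : (PowerSeries.X : PowerSeries K) • m = 0 := by
    rw [← xA_yA_smul (k := k), mul_smul, h, smul_zero]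
  exact (smul_eq_zero.mp this).resolve_left PowerSeries.X_ne_zero

lemma xA_pow_smul_eq_zero {m : M} {a : ℕ} (h : xA K n k ^ a • m = 0) : m = 0 := by
  induction a with
  | zero => simpa using h
  | succ a ih => rw [pow_succ', mul_smul] at h; exact ih (xA_smul_eq_zero h)

lemma yA_pow_smul_eq_zero {m : M} {a : ℕ} (h : yA K n k ^ a • m = 0) : m = 0 := by
  induction a with
  | zero => simpa using h
  | succ a ih => rw [pow_succ', mul_smul] at h; exact ih (yA_smul_eq_zero h)

lemma toK_smul_eq_zero {m : M} {j : ℕ} (h : toK K n k j • m = 0) : idem K n k j • m = 0 := by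
  rcases le_total j k with hj | hj
  · rw [toK, IsZigzag.toVertex_of_le hj, mul_smul] at h
    exact xA_pow_smul_eq_zero h
  · rw [toK, IsZigzag.toVertex_of_ge hj, mul_smul] at h
    exact yA_pow_smul_eq_zero h

lemma fromZero_smul_eq_zero {m : M} {j : ℕ} (h : fromZero K n k j • m = 0) :
    idem K n k n • m = 0 := by
  rcases le_total j k with hj | hj
  · rw [fromZero_of_le hj, mul_smul] at h
    exact xA_pow_smul_eq_zero h
  · rw [fromZero_of_ge hj, mul_smul] at h
    exact yA_pow_smul_eq_zero h

/-- At the vertex `k` an element of `(e_n) M` is `fromZero k • m`, which factors as `toK j •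
fromZero j • m`; now cancel `toK j`. This is why `π M` has no nonzero element killed by all the
paths to `k`. -/
lemma idem_smul_mem_of_toK_smul_mem (hk : (k : ℕ) ≠ 0) {w : M} {j : ℕ} (hj : j ≤ n)
    (h : toK K n k j • w ∈ genZero K n k M) : idem K n k j • w ∈ genZero K n k M := by
  obtain ⟨m, -, hm⟩ := exists_fromZero_smul hk k.isLt.le h
  rw [smul_smul, toK, (zigzag_twisted K n k).e_mul_toVertex, ← toK, ← toK_mul_fromZero hj, mul_smul,
    ← sub_eq_zero, ← smul_sub] at hm
  have h1 := toK_smul_eq_zero hm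
  rw [smul_sub, sub_eq_zero, smul_smul (idem K n k j) (fromZero K n k j), idem_mul_fromZero hj] at h1
  rw [h1]
  exact fromZero_smul_mem j m

end CMModules

/-! ### The submodule `(e_n) M` as a power of `P_n`. -/

section VertexBasis

variable {K : Type u} [Field K] {n : ℕ} {k : Fin n} [NeZero n] [HasEnoughRootsOfUnity K n]
  {M : Type*} [AddCommGroup M] [Module (TwistedRing K n k) M]
  [Module (PowerSeries K) M] [IsScalarTower (PowerSeries K) (TwistedRing K n k) M]

variable (K n k) in
/-- A basis over `K[[t]]` of the component of `M` at the vertex `n`. -/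
structure IsVertexBasis {r : ℕ} (b : Fin r → M) : Prop where
  idem_smul : ∀ i, idem K n k n • b i = b i
  linearIndependent : LinearIndependent (PowerSeries K) b
  exists_sum : ∀ m : M, idem K n k n • m = m → ∃ c : Fin r → PowerSeries K, m = ∑ i, c i • b i

variable (K n k M) in
-- `e_n M` is a submodule of a finite free module over a principal ideal domain, hence free.
lemma exists_isVertexBasis [Module.Finite (PowerSeries K) M] [Module.Free (PowerSeries K) M] :
    ∃ (r : ℕ) (b : Fin r → M), IsVertexBasis K n k b := by
  let f : M →ₗ[PowerSeries K] M := Algebra.lsmul (PowerSeries K) (PowerSeries K) M (idem K n k n)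
  have hf : ∀ m, f m = idem K n k n • m := fun m => rfl
  let b := Module.finBasis (PowerSeries K) (LinearMap.range f)
  refine ⟨_, fun i => (b i : M), ?_, ?_, ?_⟩
  · intro i
    obtain ⟨m, hm⟩ := (b i).2
    rw [← hm, hf, smul_smul, idem_mul_idem_self]
  · exact b.linearIndependent.map' (LinearMap.range f).subtype (Submodule.ker_subtype _)
  · intro m hm
    have hm' : m ∈ LinearMap.range f := ⟨m, hm⟩
    refine ⟨fun i => b.repr ⟨m, hm'⟩ i, ?_⟩
    have := congrArg (LinearMap.range f).subtype (b.sum_repr ⟨m, hm'⟩)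
    rw [map_sum] at this
    exact this.symm

variable (K n k) in
/-- The homomorphism `P_n ^ r → M` given by `r` elements of `M`. -/
def pnSum {r : ℕ} (b : Fin r → M) : (Fin r → Pn K n k) →ₗ[TwistedRing K n k] M :=
  ∑ i, pnMap (b i) ∘ₗ LinearMap.proj i

lemma pnSum_apply {r : ℕ} (b : Fin r → M) (p : Fin r → Pn K n k) :
    pnSum K n k b p = ∑ i, (p i : TwistedRing K n k) • b i := by
  simp [pnSum, pnMap_apply]

lemma pnSum_mem {r : ℕ} (b : Fin r → M) (p : Fin r → Pn K n k) :
    pnSum K n k b p ∈ genZero K n k M := by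
  rw [pnSum_apply]
  exact sum_mem fun i _ => pn_smul_mem _ _

lemma idem_smul_pn (hk : (k : ℕ) ≠ 0) (p : Pn K n k) (j : Fin n) :
    idem K n k j • p = (pnBasis hk).repr p j • pnGen K n k j := by
  conv_lhs => rw [← (pnBasis hk).sum_repr p]
  rw [Finset.smul_sum, Finset.sum_eq_single j]
  · rw [smul_comm, pnBasis_apply, idem_smul_pnGen j.isLt.le]
  · intro i _ hij
    rw [smul_comm, pnBasis_apply, idem_smul_pnGen_ne i.isLt j.isLt (fun h => hij (Fin.ext h.symm)),
      smul_zero]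
  · simp

variable {r : ℕ} {b : Fin r → M}

lemma IsVertexBasis.exists_pnSum_eq (hb : IsVertexBasis K n k b) {w : M}
    (hw : w ∈ genZero K n k M) : ∃ p, pnSum K n k b p = w := by
  rw [genZero_eq_span] at hw
  suffices h : Submodule.span (TwistedRing K n k) (Set.range fun m : M => idem K n k n • m) ≤
      LinearMap.range (pnSum K n k b) from h hw
  rw [Submodule.span_le]
  rintro _ ⟨m, rfl⟩
  obtain ⟨c, hc⟩ := hb.exists_sum (idem K n k n • m) (by rw [smul_smul, idem_mul_idem_self])
  refine ⟨fun i => c i • pnGen K n k 0, ?_⟩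
  change _ = idem K n k n • m
  rw [pnSum_apply, hc]
  refine Finset.sum_congr rfl fun i _ => ?_
  change (c i • fromZero K n k 0) • b i = _
  rw [fromZero_zero, smul_assoc, hb.idem_smul]

/-- At the vertex `j` a relation reads `fromZero j • ∑ c_i b_i = 0`; the path cancels and the `b_i`
are independent. With `exists_pnSum_eq` this identifies `(e_n) M` with `P_n ^ r`. -/
lemma IsVertexBasis.pnSum_injective (hb : IsVertexBasis K n k b) (hk : (k : ℕ) ≠ 0)
    [Module.IsTorsionFree (PowerSeries K) M] : Function.Injective (pnSum K n k b) := by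
  rw [injective_iff_map_eq_zero]
  intro p hp
  have key : ∀ (i : Fin r) (j : Fin n), (pnBasis hk).repr (p i) j = 0 := by
    intro i j
    have h1 : fromZero K n k j • ∑ i, (pnBasis hk).repr (p i) j • b i = 0 := by
      rw [← smul_zero (idem K n k j), ← hp, ← map_smul, pnSum_apply, Finset.smul_sum]
      refine Finset.sum_congr rfl fun i _ => ?_
      rw [Pi.smul_apply, idem_smul_pn hk, smul_smul_comm', ← pnMap_apply, ← pnMap_pnGen]
      exact (map_smul ((pnMap (b i)).restrictScalars (PowerSeries K)) _ _).symm
    have h2 := fromZero_smul_eq_zero h1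
    simp only [Finset.smul_sum, smul_smul_comm', hb.idem_smul] at h2
    exact Fintype.linearIndependent_iff.mp hb.linearIndependent _ h2 i
  funext i
  apply (pnBasis hk).repr.injective
  ext j
  rw [key i j]; simp

end VertexBasis

/-! ### The preprojective algebra -/

section Preprojective

variable (K : Type u) [Field K] (n : ℕ)

/-- The vertex idempotents of `Π`. -/
def pE (j : ℕ) : Preproj K n := Preproj.of K n (PGen.e j)

/-- The sum of the arrows `x` of `Π`. -/
def pX : Preproj K n := ∑ i ∈ Finset.range n, Preproj.of K n (PGen.x i)

/-- The sum of the arrows `y` of `Π`. -/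
def pY : Preproj K n := ∑ i ∈ Finset.range n, Preproj.of K n (PGen.y i)

variable {K n}

lemma pE_outside {j : ℕ} (h : j = 0 ∨ n ≤ j) : pE K n j = 0 :=
  (RingQuot.mkAlgHom_rel K (PreprojRel.outside j h)).trans (map_zero _)

lemma pE_idem (j : ℕ) : pE K n j * pE K n j = pE K n j :=
  (map_mul _ _ _).symm.trans (RingQuot.mkAlgHom_rel K (PreprojRel.idem j))

lemma pE_orth {i j : ℕ} (h : i ≠ j) : pE K n i * pE K n j = 0 :=
  (map_mul _ _ _).symm.trans
    ((RingQuot.mkAlgHom_rel K (PreprojRel.orth i j h)).trans (map_zero _))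

lemma sum_pE : ∑ j ∈ Finset.Ioo 0 n, pE K n j = 1 :=
  (map_sum _ _ _).symm.trans ((RingQuot.mkAlgHom_rel K PreprojRel.one).trans (map_one _))

lemma of_x (i : ℕ) : pE K n (i + 1) * Preproj.of K n (PGen.x i) * pE K n i =
    Preproj.of K n (PGen.x i) := by
  have := RingQuot.mkAlgHom_rel K (PreprojRel.source_target_x (K := K) (n := n) i)
  rwa [map_mul, map_mul] at this

lemma of_y (i : ℕ) : pE K n i * Preproj.of K n (PGen.y i) * pE K n (i + 1) =
    Preproj.of K n (PGen.y i) := by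
  have := RingQuot.mkAlgHom_rel K (PreprojRel.source_target_y (K := K) (n := n) i)
  rwa [map_mul, map_mul] at this

lemma of_mesh (i : ℕ) : Preproj.of K n (PGen.x i) * Preproj.of K n (PGen.y i) =
    Preproj.of K n (PGen.y (i + 1)) * Preproj.of K n (PGen.x (i + 1)) := by
  have := RingQuot.mkAlgHom_rel K (PreprojRel.mesh (K := K) (n := n) i)
  rwa [map_mul, map_mul] at this

lemma pX_mul_pE (j : ℕ) : pX K n * pE K n j = Preproj.of K n (PGen.x j) := by
  rw [pX, Finset.sum_mul, Finset.sum_eq_single j]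
  · rw [← of_x, mul_assoc, pE_idem]
  · intro i _ hij
    rw [← of_x, mul_assoc, pE_orth hij, mul_zero]
  · intro h
    rw [pE_outside (Or.inr (by simpa using h)), mul_zero]

lemma pE_mul_pX (j : ℕ) : pE K n (j + 1) * pX K n = Preproj.of K n (PGen.x j) := by
  rw [pX, Finset.mul_sum, Finset.sum_eq_single j]
  · rw [← of_x, ← mul_assoc, ← mul_assoc, pE_idem]
  · intro i _ hij
    rw [← of_x, ← mul_assoc, ← mul_assoc, pE_orth (by omega), zero_mul, zero_mul]
  · intro h
    rw [pE_outside (Or.inr (by simp at h; omega)), zero_mul]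

lemma pY_mul_pE (j : ℕ) : pY K n * pE K n (j + 1) = Preproj.of K n (PGen.y j) := by
  rw [pY, Finset.sum_mul, Finset.sum_eq_single j]
  · rw [← of_y, mul_assoc, pE_idem]
  · intro i _ hij
    rw [← of_y, mul_assoc, pE_orth (by omega), mul_zero]
  · intro h
    rw [pE_outside (Or.inr (by simp at h; omega)), mul_zero]

lemma pE_mul_pY (j : ℕ) : pE K n j * pY K n = Preproj.of K n (PGen.y j) := by
  rw [pY, Finset.mul_sum, Finset.sum_eq_single j]
  · rw [← of_y, ← mul_assoc, ← mul_assoc, pE_idem]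
  · intro i _ hij
    rw [← of_y, ← mul_assoc, ← mul_assoc, pE_orth hij.symm, zero_mul, zero_mul]
  · intro h
    rw [pE_outside (Or.inr (by simpa using h)), zero_mul]

/-- This is the sum of the mesh relations over the vertices `i + 1` of the quiver. -/
lemma pX_mul_pY : pX K n * pY K n = pY K n * pX K n := by
  rw [← mul_one (pX K n * pY K n), ← mul_one (pY K n * pX K n), ← sum_pE, Finset.mul_sum,
    Finset.mul_sum]
  refine Finset.sum_congr rfl fun j hj => ?_
  obtain ⟨i, rfl⟩ : ∃ i, j = i + 1 := ⟨j - 1, by simp at hj; omega⟩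
  have h1 : pE K n i * Preproj.of K n (PGen.y i) = Preproj.of K n (PGen.y i) := by
    rw [← of_y, ← mul_assoc, ← mul_assoc, pE_idem]
  have h2 : pE K n (i + 1 + 1) * Preproj.of K n (PGen.x (i + 1)) =
      Preproj.of K n (PGen.x (i + 1)) := by
    rw [← of_x, ← mul_assoc, ← mul_assoc, pE_idem]
  rw [mul_assoc, pY_mul_pE, ← h1, ← mul_assoc, pX_mul_pE, of_mesh, mul_assoc (pY K n), pX_mul_pE]
  conv_rhs => rw [← h2, ← mul_assoc, pY_mul_pE]

variable (K n) in
lemma zigzag_preproj : IsZigzag (pX K n) (pY K n) (pE K n) :=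
  ⟨pX_mul_pY, fun j => (pE_mul_pX j).trans (pX_mul_pE j).symm,
    fun j => (pE_mul_pY j).trans (pY_mul_pE j).symm, pE_idem⟩

/-- `Π` is generated by its vertices and by the sums of the arrows `x` and `y`. -/
lemma preproj_induction {p : Preproj K n → Prop} (a : Preproj K n)
    (algebraMap : ∀ c : K, p (algebraMap _ _ c)) (gen_x : p (pX K n)) (gen_y : p (pY K n))
    (vertex : ∀ j, p (pE K n j)) (add : ∀ a b, p a → p b → p (a + b))
    (mul : ∀ a b, p a → p b → p (a * b)) : p a := by
  obtain ⟨a, rfl⟩ := RingQuot.mkAlgHom_surjective K (PreprojRel K n) a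
  induction a using FreeAlgebra.induction with
  | grade0 c => rw [AlgHom.commutes]; exact algebraMap c
  | grade1 g =>
    rcases g with j | j | j
    · exact vertex j
    · have h := mul _ _ gen_x (vertex j)
      rwa [pX_mul_pE] at h
    · have h := mul _ _ (vertex j) gen_y
      rwa [pE_mul_pY] at h
  | mul a b ha hb => rw [map_mul]; exact mul _ _ ha hb
  | add a b ha hb => rw [map_add]; exact add _ _ ha hb

variable (K n) in
/-- The shortest path from the vertex `i` to the vertex `k` in `Π`. -/
abbrev pToK (k i : ℕ) : Preproj K n := toVertex (pX K n) (pY K n) (pE K n) k i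

lemma pToK_outside {k i : ℕ} (h : i = 0 ∨ n ≤ i) : pToK K n k i = 0 := by
  rw [pToK, ← (zigzag_preproj K n).toVertex_mul_e, pE_outside h, mul_zero]

lemma pToK_mul_pE_ne {k i j : ℕ} (h : i ≠ j) : pToK K n k i * pE K n j = 0 := by
  rw [pToK, ← (zigzag_preproj K n).toVertex_mul_e, mul_assoc, pE_orth h, mul_zero]

/-- A path of `n` arrows `x` would end at a vertex `j + n`, outside the quiver. -/
lemma pX_pow_n : pX K n ^ n = 0 := by
  rw [← mul_one (pX K n ^ n), ← sum_pE, Finset.mul_sum]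
  refine Finset.sum_eq_zero fun j _ => ?_
  rw [← (zigzag_preproj K n).e_mul_x_pow, pE_outside (Or.inr (by omega)), zero_mul]

lemma pY_pow_n : pY K n ^ n = 0 := by
  rw [← one_mul (pY K n ^ n), ← sum_pE, Finset.sum_mul]
  refine Finset.sum_eq_zero fun j _ => ?_
  rw [(zigzag_preproj K n).e_mul_y_pow, pE_outside (Or.inr (by omega)), mul_zero]

section Modules

variable {N : Type*} [AddCommGroup N] [Module (Preproj K n) N]

lemma sum_pE_smul (u : N) : ∑ j ∈ Finset.Ioo 0 n, pE K n j • u = u := by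
  rw [← Finset.sum_smul, sum_pE, one_smul]

/-- The elements killed by all the paths to `k` form a submodule. -/
lemma pToK_smul_smul_eq_zero {k : ℕ} (a : Preproj K n) {u : N} (h : ∀ i, pToK K n k i • u = 0) :
    ∀ i, pToK K n k i • a • u = 0 := by
  have hz := zigzag_preproj K n
  induction a using preproj_induction generalizing u with
  | algebraMap c =>
    intro i
    rw [smul_smul, ← Algebra.commutes, mul_smul, h, smul_zero]
  | add a b ha hb => intro i; rw [add_smul, smul_add, ha h, hb h, add_zero]
  | mul a b ha hb => intro i; rw [mul_smul]; exact ha (hb h) i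
  | vertex j =>
    intro i
    rw [smul_smul]
    by_cases hij : i = j
    · rw [hij, hz.toVertex_mul_e, h]
    · rw [pToK_mul_pE_ne hij, zero_smul]
  | gen_x =>
    intro i
    rcases i with _ | i
    · rw [pToK_outside (Or.inl rfl), zero_smul]
    rcases lt_or_ge i k with hi | hi
    · rw [smul_smul, hz.toVertex_mul_x_of_lt hi, h]
    · rw [smul_smul, hz.toVertex_mul_x_of_ge hi, mul_smul, h, smul_zero]
  | gen_y =>
    intro i
    rcases lt_or_ge i k with hi | hi
    · rw [smul_smul, hz.toVertex_mul_y_of_lt hi, mul_smul, h, smul_zero]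
    · rw [smul_smul, hz.toVertex_mul_y_of_ge hi, h]

end Modules

lemma Q_smul_apply {i : ℕ} (a : Preproj K n) (φ : Q K n i) (u : ePi K n i) :
    DFunLike.coe (F := Module.Dual K (ePi K n i)) (a • φ) u =
      DFunLike.coe (F := Module.Dual K (ePi K n i)) φ (rightMul K n i a u) := rfl

variable (K n) in
/-- The generator of `e_k Π`. -/
def ePiGen (k : ℕ) : ePi K n k := ⟨pE K n k, ⟨1, mul_one _⟩⟩

/-- The modules in `Sub Q_k` are the finite-dimensional ones in which no nonzero element is killed
by all the paths to `k`. -/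
lemma isSubQ_iff {k : ℕ} (N : ModuleCat.{u} (Preproj K n)) : isSubQ K n k N ↔
    IsFinDim K n N ∧ ∀ u : N, (∀ i, pToK K n k i • u = 0) → u = 0 := by
  refine and_congr_right fun hfd => ?_
  constructor
  · rintro ⟨m, f, hf⟩ u hu
    apply hf
    rw [map_zero]
    funext i
    refine LinearMap.ext (f := (f u i : Module.Dual K (ePi K n k))) ?_
    rintro ⟨_, a, rfl⟩
    -- The value of a form at `e_k a` is the value at the generator `e_k` of the form multiplied by
    -- `e_k a`, so it is enough that `e_k a` kills `u`.
    have h1 : pE K n k • a • u = 0 := by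
      have := pToK_smul_smul_eq_zero a hu k
      rwa [pToK, IsZigzag.toVertex_self] at this
    have h2 : pE K n k • a • f u = 0 := by rw [← map_smul, ← map_smul, h1, map_zero]
    have h3 := congrArg (fun φ : Q K n k =>
      DFunLike.coe (F := Module.Dual K (ePi K n k)) φ (ePiGen K n k)) (congrFun h2 i)
    simp only [Pi.smul_apply, Pi.zero_apply] at h3
    rw [Q_smul_apply, Q_smul_apply] at h3
    refine Eq.trans (congrArg _ (Subtype.ext ?_)) h3
    change pE K n k * a = pE K n k * pE K n k * a
    rw [pE_idem]
  · intro h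
    let _ : Module K N := Module.restrictScalars K (Preproj K n) N
    have : IsScalarTower K (Preproj K n) N := IsScalarTower.restrictScalars K (Preproj K n) N
    have : Module.Finite K N := hfd
    let c := Module.finBasis K N
    -- The embedding uses one copy of `Q_k` for each coordinate of `N`: `u` gives the form `w ↦ c_i
    -- (w u)` on `e_k Π`.
    let ev : N → ePi K n k →ₗ[K] N := fun u =>
      { toFun := fun v => (v : Preproj K n) • u
        map_add' := fun v w => add_smul _ _ _
        map_smul' := fun t v => smul_assoc _ _ _ }
    refine ⟨Module.finrank K N,
      { toFun := fun u i => (c.coord i ∘ₗ ev u : Module.Dual K (ePi K n k))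
        map_add' := fun u v => ?_
        map_smul' := fun a u => ?_ }, ?_⟩
    · funext i
      refine LinearMap.ext (f := (_ : Module.Dual K (ePi K n k))) fun w => ?_
      change c.coord i ((w : Preproj K n) • (u + v)) = c.coord i ((w : Preproj K n) • u) +
        c.coord i ((w : Preproj K n) • v)
      rw [smul_add, map_add]
    · funext i
      refine LinearMap.ext (f := (_ : Module.Dual K (ePi K n k))) fun w => ?_
      change c.coord i ((w : Preproj K n) • a • u) = c.coord i (((w : Preproj K n) * a) • u)
      rw [mul_smul]
    · rw [injective_iff_map_eq_zero]
      intro u hu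
      refine h u fun j => ?_
      apply c.ext_elem
      intro i
      have h1 := LinearMap.congr_fun (f := (c.coord i ∘ₗ ev u)) (congrFun hu i)
        ⟨pToK K n k j, ⟨pToK K n k j, (zigzag_preproj K n).e_mul_toVertex k j⟩⟩
      rw [map_zero]
      exact h1

end Preprojective

/-! ### The socle of a module in `Sub Q_k`. -/

section Socle

variable {K : Type u} [Field K] {n : ℕ}

lemma exists_pow_smul_ne_zero {S N : Type*} [Ring S] [AddCommGroup N] [Module S N] {x : S} {m : ℕ}
    (hx : x ^ m = 0) {u : N} (hu : u ≠ 0) : ∃ a : ℕ, x ^ a • u ≠ 0 ∧ x • x ^ a • u = 0 := by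
  classical
  have hex : ∃ a : ℕ, x ^ a • u = 0 := ⟨m, by rw [hx, zero_smul]⟩
  have h0 : Nat.find hex ≠ 0 := fun h => hu (by
    have := Nat.find_spec hex
    rwa [h, pow_zero, one_smul] at this)
  refine ⟨Nat.find hex - 1, Nat.find_min hex (by omega), ?_⟩
  rw [smul_smul, ← pow_succ', Nat.sub_add_cancel (by omega)]
  exact Nat.find_spec hex

/-- In a module of `Sub Q_k`, the socle consists of the elements killed by all the arrows; it is
concentrated at `k`. -/
lemma mem_socle_iff {k : ℕ} {N : ModuleCat.{u} (Preproj K n)} (hN : isSubQ K n k N) (u : N) :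
    u ∈ socle (Preproj K n) N ↔ pX K n • u = 0 ∧ pY K n • u = 0 ∧ pE K n k • u = u := by
  rw [isSubQ_iff] at hN
  have hz := zigzag_preproj K n
  -- For `j ≠ k` a path from `j` to `k` has positive length, hence begins with an arrow and kills
  -- `u`; so `e_j u` is killed by all paths to `k` and vanishes.
  have hvert : ∀ u : N, pX K n • u = 0 → pY K n • u = 0 → ∀ j, j ≠ k → pE K n j • u = 0 := by
    intro u hx hy j hj
    refine hN.2 _ fun i => ?_
    rw [smul_smul]
    by_cases hij : i = j
    · subst hij
      rcases hj.lt_or_gt with h | h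
      · obtain ⟨d, hd⟩ : ∃ d, k - i = d + 1 := ⟨k - i - 1, by omega⟩
        rw [hz.toVertex_mul_e, IsZigzag.toVertex_of_le h.le, ← hz.e_mul_x_pow, hd, pow_succ, mul_smul,
          mul_smul, hx, smul_zero, smul_zero]
      · obtain ⟨d, hd⟩ : ∃ d, i - k = d + 1 := ⟨i - k - 1, by omega⟩
        have := hz.e_mul_y_pow k (i - k)
        rw [Nat.add_sub_cancel' h.le] at this
        rw [hz.toVertex_mul_e, IsZigzag.toVertex_of_ge h.le, ← this, hd, pow_succ, mul_smul,
          mul_smul, hy, smul_zero, smul_zero]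
    · rw [pToK_mul_pE_ne hij, zero_smul]
  -- On an element at `k` killed by the arrows, `Π` acts by scalars; a nonzero one spans a simple
  -- submodule.
  have hscal : ∀ u : N, pX K n • u = 0 → pY K n • u = 0 → pE K n k • u = u →
      ∀ a : Preproj K n, ∃ c : K, a • u = algebraMap K (Preproj K n) c • u := by
    intro u hx hy he a
    induction a using preproj_induction with
    | algebraMap c => exact ⟨c, rfl⟩
    | gen_x => exact ⟨0, by rw [hx, map_zero, zero_smul]⟩
    | gen_y => exact ⟨0, by rw [hy, map_zero, zero_smul]⟩
    | vertex j =>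
      by_cases hj : j = k
      · exact ⟨1, by rw [hj, he, map_one, one_smul]⟩
      · exact ⟨0, by rw [hvert u hx hy j hj, map_zero, zero_smul]⟩
    | add a b ha hb =>
      obtain ⟨c, hc⟩ := ha
      obtain ⟨d, hd⟩ := hb
      exact ⟨c + d, by rw [add_smul, hc, hd, map_add, add_smul]⟩
    | mul a b ha hb =>
      obtain ⟨c, hc⟩ := ha
      obtain ⟨d, hd⟩ := hb
      exact ⟨d * c, by rw [mul_smul, hd, smul_smul, ← Algebra.commutes, mul_smul, hc, map_mul,
        mul_smul]⟩
  have hfix : ∀ u : N, pX K n • u = 0 → pY K n • u = 0 → pE K n k • u = u := by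
    intro u hx hy
    conv_rhs => rw [← sum_pE_smul (K := K) (n := n) u]
    by_cases hk : k ∈ Finset.Ioo 0 n
    · rw [Finset.sum_eq_single k (fun j _ hj => hvert u hx hy j hj) (fun h => absurd hk h)]
    · rw [Finset.sum_eq_zero fun j hj => hvert u hx hy j fun h => hk (h ▸ hj),
        pE_outside (by simp at hk; omega), zero_smul]
  constructor
  · let S : Submodule (Preproj K n) N :=
      { carrier := {u | pX K n • u = 0 ∧ pY K n • u = 0}
        add_mem' := fun {u v} hu hv => ⟨by rw [smul_add, hu.1, hv.1, add_zero],
          by rw [smul_add, hu.2, hv.2, add_zero]⟩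
        zero_mem' := ⟨smul_zero _, smul_zero _⟩
        smul_mem' := fun a u hu => by
          obtain ⟨c, hc⟩ := hscal u hu.1 hu.2 (hfix u hu.1 hu.2) a
          constructor
          · rw [hc, smul_smul, ← Algebra.commutes, mul_smul, hu.1, smul_zero]
          · rw [hc, smul_smul, ← Algebra.commutes, mul_smul, hu.2, smul_zero] }
    intro hu
    suffices h : socle (Preproj K n) N ≤ S from ⟨(h hu).1, (h hu).2, hfix u (h hu).1 (h hu).2⟩
    refine sSup_le fun U hU => ?_
    have hatom : IsAtom U := isSimpleModule_iff_isAtom.mp hU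
    obtain ⟨v, hvU, hv0⟩ := (Submodule.ne_bot_iff U).mp hatom.1
    -- A simple submodule meets `S`: apply to `v` the last power of `x`, then the last power of `y`,
    -- that does not give zero. As `x` and `y` commute, both kill the result.
    obtain ⟨a, ha, ha'⟩ := exists_pow_smul_ne_zero (pX_pow_n (K := K) (n := n)) hv0
    obtain ⟨b, hb, hb'⟩ := exists_pow_smul_ne_zero (pY_pow_n (K := K) (n := n)) ha
    have hc : Commute (pX K n) (pY K n) := pX_mul_pY
    have hwS : pY K n ^ b • pX K n ^ a • v ∈ S :=
      ⟨by rw [smul_smul, (hc.pow_right b).eq, mul_smul, ha', smul_zero], hb'⟩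
    have hwU : pY K n ^ b • pX K n ^ a • v ∈ U := U.smul_mem _ (U.smul_mem _ hvU)
    rcases hatom.le_iff.mp (inf_le_left : U ⊓ S ≤ U) with h | h
    · have hw := Submodule.mem_inf.mpr ⟨hwU, hwS⟩
      rw [h, Submodule.mem_bot] at hw
      exact absurd hw hb
    · exact inf_eq_left.mp h
  · rintro ⟨hx, hy, he⟩
    by_cases hu0 : u = 0
    · rw [hu0]; exact zero_mem _
    have hsimple : IsAtom (Submodule.span (Preproj K n) {u}) := by
      refine ⟨fun h => hu0 (Submodule.span_singleton_eq_bot.mp h), fun V hV => ?_⟩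
      by_contra hV0
      obtain ⟨v, hvV, hv0⟩ := (Submodule.ne_bot_iff V).mp hV0
      obtain ⟨a, ha⟩ := Submodule.mem_span_singleton.mp (hV.le hvV)
      obtain ⟨c, hc⟩ := hscal u hx hy he a
      have hc0 : c ≠ 0 := by
        rintro rfl
        exact hv0 (by rw [← ha, hc, map_zero, zero_smul])
      refine hV.not_ge ((Submodule.span_singleton_le_iff_mem _ _).mpr ?_)
      have : u = algebraMap K (Preproj K n) c⁻¹ • v := by
        rw [← ha, hc, smul_smul, ← map_mul, inv_mul_cancel₀ hc0, map_one, one_smul]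
      rw [this]
      exact V.smul_mem _ hvV
    exact le_sSup (a := Submodule.span (Preproj K n) {u})
      (isSimpleModule_iff_isAtom.mpr hsimple) (Submodule.mem_span_singleton_self u)

end Socle

/-! ### The functor `π` -/

section PiFunctor

variable {K : Type u} [Field K] {n : ℕ} {k : Fin n} [NeZero n]

/-! ### The action of `t` modulo `(e_n) M`. -/

section Truncation

lemma exists_eq_sum_add_X_pow_mul (c : PowerSeries K) (N : ℕ) : ∃ c' : PowerSeries K,
    c = ∑ i ∈ Finset.range N, PowerSeries.C (PowerSeries.coeff i c) * PowerSeries.X ^ i +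
      PowerSeries.X ^ N * c' := by
  have h : PowerSeries.X ^ N ∣
      c - ∑ i ∈ Finset.range N, PowerSeries.C (PowerSeries.coeff i c) * PowerSeries.X ^ i := by
    rw [PowerSeries.X_pow_dvd_iff]
    intro d hd
    rw [map_sub, map_sum, Finset.sum_eq_single d]
    · simp
    · intro i _ hi
      simp [PowerSeries.coeff_C_mul, PowerSeries.coeff_X_pow, hi.symm]
    · intro h
      exact absurd (Finset.mem_range.mpr hd) h
  obtain ⟨c', hc'⟩ := h
  exact ⟨c', by rw [← hc']; ring⟩

variable [HasEnoughRootsOfUnity K n]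
variable {M : Type*} [AddCommGroup M] [Module (TwistedRing K n k) M]
  [Module (PowerSeries K) M] [IsScalarTower (PowerSeries K) (TwistedRing K n k) M]

lemma idem_n_smul_mem (m : M) : idem K n k n • m ∈ genZero K n k M := by
  rw [genZero_eq_span]
  exact Submodule.subset_span ⟨m, rfl⟩

lemma zsmul_mem (S : Submodule (TwistedRing K n k) M) (c : PowerSeries K) {m : M} (hm : m ∈ S) :
    c • m ∈ S := by
  rw [← algebraMap_smul (TwistedRing K n k) c m]
  exact S.smul_mem _ hm

/-- On the component at `j`, `t ^ j` acts as `x ^ j y ^ j`, a path through the vertex `0`; and `j <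
n`. -/
lemma X_pow_n_smul_mem (m : M) : (PowerSeries.X : PowerSeries K) ^ n • m ∈ genZero K n k M := by
  have hz := zigzag_twisted K n k
  have hc : Commute (xA K n k) (yA K n k) := xA_mul_yA K n k
  rw [← sum_idem_smul (K := K) (n := n) (k := k) m, Finset.smul_sum]
  refine sum_mem fun j hj => ?_
  have hj' : n = (n - j) + j := by have := Finset.mem_range.mp hj; omega
  have h1 : (PowerSeries.X : PowerSeries K) ^ n • idem K n k j • m =
      (PowerSeries.X : PowerSeries K) ^ (n - j) • xA K n k ^ j • idem K n k n • yA K n k ^ j • m := by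
    have h2 := hz.e_mul_y_pow 0 j
    rw [zero_add] at h2
    have h3 : (PowerSeries.X : PowerSeries K) ^ n =
        PowerSeries.X ^ (n - j) * PowerSeries.X ^ j := by rw [← pow_add, ← hj']
    rw [h3, mul_smul]
    congr 1
    rw [idem_self, smul_smul (idem K n k 0), h2, smul_smul, ← mul_assoc, ← hc.mul_pow,
      ← algebraMap_X_twisted, ← map_pow, mul_smul, algebraMap_smul]
  rw [h1]
  exact zsmul_mem _ _ (Submodule.smul_mem _ _ (idem_n_smul_mem _))

lemma exists_smul_eq_sum_add (c : PowerSeries K) (m : M) : ∃ m' ∈ genZero K n k M,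
    c • m = ∑ i ∈ Finset.range n,
      PowerSeries.C (PowerSeries.coeff i c) • (PowerSeries.X : PowerSeries K) ^ i • m + m' := by
  obtain ⟨c', hc'⟩ := exists_eq_sum_add_X_pow_mul c n
  refine ⟨(PowerSeries.X : PowerSeries K) ^ n • c' • m, X_pow_n_smul_mem _, ?_⟩
  conv_lhs => rw [hc', add_smul, Finset.sum_smul, mul_smul]
  simp only [mul_smul]

end Truncation

variable [HasEnoughRootsOfUnity K n]

/-! ### The homomorphism `Π → A / (e_n)`. -/

section Hom

lemma preprojHom_of (a : PGen) : preprojHom K n k (Preproj.of K n a) = genImage K n k a :=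
  (RingQuot.liftAlgHom_mkAlgHom_apply _ _ _ _).trans (FreeAlgebra.lift_ι_apply _ _)

lemma preprojHom_pE {j : ℕ} (hj : j ≤ n) :
    preprojHom K n k (pE K n j) = Ideal.Quotient.mk _ (idem K n k j) :=
  (preprojHom_of _).trans (bIdem_of_le K n k hj)

lemma mk_eq_sum (a : TwistedRing K n k) : (Ideal.Quotient.mk (idealEn K n k)) a =
    ∑ j ∈ Finset.range n, (Ideal.Quotient.mk (idealEn K n k)) (a * idem K n k j) := by
  rw [← map_sum, ← Finset.mul_sum, sum_idem, mul_one]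

lemma preprojHom_pX : preprojHom K n k (pX K n) = Ideal.Quotient.mk _ (xA K n k) := by
  have h := idem_mul_idem_self K n k
  rw [pX, map_sum, mk_eq_sum]
  refine Finset.sum_congr rfl fun j hj => ?_
  have hj' := Finset.mem_range.mp hj
  rw [preprojHom_of]
  change bIdem K n k (j + 1) * _ * bIdem K n k j = _
  rw [bIdem_of_le K n k hj'.le, bIdem_of_le K n k (show j + 1 ≤ n from hj'), ← map_mul, ← map_mul,
    idem_mul_xA, mul_assoc, h]

lemma preprojHom_pY : preprojHom K n k (pY K n) = Ideal.Quotient.mk _ (yA K n k) := by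
  have h := idem_mul_idem_self K n k
  rw [pY, map_sum, ← mul_one (yA K n k), ← sum_idem K n k]
  have h0 : idem K n k n = idem K n k 0 := idem_self K n k
  rw [← sum_range_shift (fun j => idem K n k j) n h0, Finset.mul_sum, map_sum]
  refine Finset.sum_congr rfl fun j hj => ?_
  have hj' := Finset.mem_range.mp hj
  rw [preprojHom_of]
  change bIdem K n k j * _ * bIdem K n k (j + 1) = _
  rw [bIdem_of_le K n k hj'.le, bIdem_of_le K n k (show j + 1 ≤ n from hj'), ← map_mul, ← map_mul,
    idem_mul_yA, mul_assoc, h]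

lemma preprojHom_pToK {j : ℕ} (hj : j ≤ n) :
    preprojHom K n k (pToK K n k j) = Ideal.Quotient.mk _ (toK K n k j) := by
  rcases le_total j k with h | h
  · rw [pToK, toK, IsZigzag.toVertex_of_le h, IsZigzag.toVertex_of_le h, map_mul, map_mul, map_pow,
      map_pow, preprojHom_pX, preprojHom_pE hj]
  · rw [pToK, toK, IsZigzag.toVertex_of_ge h, IsZigzag.toVertex_of_ge h, map_mul, map_mul, map_pow,
      map_pow, preprojHom_pY, preprojHom_pE hj]

lemma preprojHom_algebraMap (c : K) : preprojHom K n k (algebraMap K _ c) =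
    Ideal.Quotient.mk _ (algebraMap K (TwistedRing K n k) c) := AlgHom.commutes _ _

lemma algebraMap_C (c : K) : algebraMap (PowerSeries K) (TwistedRing K n k) (PowerSeries.C c) =
    algebraMap K (TwistedRing K n k) c := rfl

/-- The generators of `A` visibly have preimages, and a power series in `t` may be truncated to a
polynomial in `x y`, because `t ^ n` lies in `(e_n)`. Surjectivity lets `Π`-linear maps between
modules `π M` be treated as `A`-linear. -/
lemma exists_preprojHom_eq (hk : (k : ℕ) ≠ 0) (a : TwistedRing K n k) :
    ∃ p, preprojHom K n k p = Ideal.Quotient.mk _ a := by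
  induction a using twisted_induction (K := K) hk with
  | gen_x => exact ⟨_, preprojHom_pX⟩
  | gen_y => exact ⟨_, preprojHom_pY⟩
  | vertex j =>
    exact ⟨_, (preprojHom_pE (Nat.mod_lt j (NeZero.pos n)).le).trans (congrArg _ (idem_mod j))⟩
  | add a b ha hb =>
    obtain ⟨p, hp⟩ := ha
    obtain ⟨q, hq⟩ := hb
    exact ⟨p + q, by rw [map_add, hp, hq, map_add]⟩
  | mul a b ha hb =>
    obtain ⟨p, hp⟩ := ha
    obtain ⟨q, hq⟩ := hb
    exact ⟨p * q, by rw [map_mul, hp, hq, map_mul]⟩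
  | algebraMap c =>
    obtain ⟨m', hm', h⟩ := exists_smul_eq_sum_add (k := k) c (1 : TwistedRing K n k)
    refine ⟨∑ i ∈ Finset.range n, algebraMap K _ (PowerSeries.coeff i c) *
      (pX K n * pY K n) ^ i, ?_⟩
    have hm'' : m' ∈ idealEn K n k := (Submodule.smul_le.mpr
      (fun a ha b _ => (idealEn K n k).mul_mem_right b ha) : genZero K n k _ ≤ idealEn K n k) hm'
    rw [← mul_one (algebraMap (PowerSeries K) (TwistedRing K n k) c), ← Algebra.smul_def, h, map_add,
      Ideal.Quotient.eq_zero_iff_mem.mpr hm'', add_zero, map_sum, map_sum]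
    refine Finset.sum_congr rfl fun i _ => ?_
    rw [map_mul, map_pow, map_mul, preprojHom_pX, preprojHom_pY, preprojHom_algebraMap,
      Algebra.smul_def, Algebra.smul_def, mul_one, map_mul, map_pow, map_pow, algebraMap_X_twisted,
      map_mul, algebraMap_C]

end Hom

/-! ### Modules `π M` and the exactness of `π`. -/

section Objects

/-- The quotient map `M → π M`. -/
def piMk (M : ModuleCat.{u} (TwistedRing K n k)) : M →+ (piFunctor K n k).obj M :=
  (Submodule.mkQ (genZero K n k M)).toAddMonoidHom

lemma piMk_surjective (M : ModuleCat.{u} (TwistedRing K n k)) : Function.Surjective (piMk M) :=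
  Submodule.mkQ_surjective _

lemma piMk_eq_zero_iff {M : ModuleCat.{u} (TwistedRing K n k)} {m : M} :
    piMk M m = 0 ↔ m ∈ genZero K n k M :=
  Submodule.Quotient.mk_eq_zero _

lemma smul_piMk {M : ModuleCat.{u} (TwistedRing K n k)} {p : Preproj K n} {a : TwistedRing K n k}
    (h : preprojHom K n k p = Ideal.Quotient.mk _ a) (m : M) : p • piMk M m = piMk M (a • m) := by
  change (preprojHom K n k p) • (Submodule.Quotient.mk m : M ⧸ genZero K n k M) = _
  rw [h]
  rfl

lemma piFunctor_map_piMk {M N : ModuleCat.{u} (TwistedRing K n k)} (f : M ⟶ N) (m : M) :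
    ((piFunctor K n k).map f).hom (piMk M m) = piMk N (f.hom m) := rfl

lemma algebraMap_smul_piMk {M : ModuleCat.{u} (TwistedRing K n k)} [Module (PowerSeries K) M]
    [IsScalarTower (PowerSeries K) (TwistedRing K n k) M] (c : K) (m : M) :
    algebraMap K (Preproj K n) c • piMk M m = piMk M (PowerSeries.C c • m) := by
  rw [smul_piMk (preprojHom_algebraMap c), ← algebraMap_C, algebraMap_smul]

/-- Since `t ^ n` acts as zero on `π M`, the classes of `t ^ i b_j` with `i < n` span it, for `b` a
`K[[t]]`-basis of `M`. -/
lemma isFinDim_pi (M : ModuleCat.{u} (TwistedRing K n k)) [Module (PowerSeries K) M]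
    [IsScalarTower (PowerSeries K) (TwistedRing K n k) M] [Module.Finite (PowerSeries K) M]
    [Module.Free (PowerSeries K) M] : IsFinDim K n ((piFunctor K n k).obj M) := by
  let N := (piFunctor K n k).obj M
  let _ : Module K N := Module.restrictScalars K (Preproj K n) N
  have : IsScalarTower K (Preproj K n) N := IsScalarTower.restrictScalars K (Preproj K n) N
  change Module.Finite K N
  let b := Module.finBasis (PowerSeries K) M
  let g : Fin n × Fin (Module.finrank (PowerSeries K) M) → N :=
    fun q => piMk M ((PowerSeries.X : PowerSeries K) ^ (q.1 : ℕ) • b q.2)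
  refine ⟨⟨(Set.finite_range g).toFinset, ?_⟩⟩
  rw [Set.Finite.coe_toFinset, eq_top_iff]
  intro u _
  obtain ⟨m, rfl⟩ := piMk_surjective M u
  rw [← b.sum_repr m, map_sum]
  refine Submodule.sum_mem (Submodule.span K (Set.range g)) fun j _ => ?_
  obtain ⟨m', hm', h⟩ := exists_smul_eq_sum_add (k := k) (b.repr m j) (b j)
  rw [h, map_add, piMk_eq_zero_iff.mpr hm', add_zero, map_sum]
  refine Submodule.sum_mem (Submodule.span K (Set.range g)) fun i hi => ?_
  rw [← algebraMap_smul_piMk, algebraMap_smul]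
  exact (Submodule.span K (Set.range g)).smul_mem _ (Submodule.subset_span ⟨(⟨i, Finset.mem_range.mp hi⟩, j), rfl⟩)

lemma isSubQ_pi (hk : (k : ℕ) ≠ 0) {M : ModuleCat.{u} (TwistedRing K n k)} (hM : isCM K n k M) :
    isSubQ K n k ((piFunctor K n k).obj M) := by
  let _ : Module (PowerSeries K) M := Module.restrictScalars (PowerSeries K) (TwistedRing K n k) M
  have : IsScalarTower (PowerSeries K) (TwistedRing K n k) M := IsScalarTower.restrictScalars _ _ M
  obtain ⟨_, _⟩ := hM.finite_free hk
  refine (isSubQ_iff _).mpr ⟨isFinDim_pi M, fun u hu => ?_⟩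
  obtain ⟨m, rfl⟩ := piMk_surjective M u
  rw [piMk_eq_zero_iff, ← sum_idem_smul (K := K) (n := n) (k := k) m]
  refine sum_mem fun j hj => ?_
  have hj' := (Finset.mem_range.mp hj).le
  refine idem_smul_mem_of_toK_smul_mem hk hj' ?_
  rw [← piMk_eq_zero_iff, ← smul_piMk (preprojHom_pToK hj'), hu]

lemma map_genZero {M N : Type*} [AddCommGroup M] [AddCommGroup N] [Module (TwistedRing K n k) M]
    [Module (TwistedRing K n k) N] (f : M →ₗ[TwistedRing K n k] N) {m : M}
    (hm : m ∈ genZero K n k M) : f m ∈ genZero K n k N := by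
  have h : Submodule.map f (genZero K n k M) ≤ genZero K n k N := by
    rw [Submodule.map_smul'']
    exact Submodule.smul_mono le_rfl le_top
  exact h ⟨m, hm, rfl⟩

lemma exists_mem_genZero_of_surjective {M N : Type*} [AddCommGroup M] [AddCommGroup N]
    [Module (TwistedRing K n k) M] [Module (TwistedRing K n k) N]
    (f : M →ₗ[TwistedRing K n k] N) (hf : Function.Surjective f) {w : N}
    (hw : w ∈ genZero K n k N) : ∃ m ∈ genZero K n k M, f m = w := by
  have h : Submodule.map f (genZero K n k M) = genZero K n k N := by
    rw [Submodule.map_smul'', Submodule.map_top, LinearMap.range_eq_top.mpr hf]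
  rw [← h] at hw
  exact hw

/-- `π` preserves short exact sequences of Cohen-Macaulay modules. -/
lemma shortExact_map_pi (hk : (k : ℕ) ≠ 0) (S : ShortComplex (ModuleCat.{u} (TwistedRing K n k)))
    (h₂ : isCM K n k S.X₂) (h₃ : isCM K n k S.X₃) (hS : S.ShortExact) :
    (S.map (piFunctor K n k)).ShortExact := by
  have hinj : Function.Injective S.f.hom := (ModuleCat.mono_iff_injective S.f).mp hS.mono_f
  have hsurj : Function.Surjective S.g.hom := (ModuleCat.epi_iff_surjective S.g).mp hS.epi_g
  have hex : ∀ m, S.g.hom m = 0 → ∃ l, S.f.hom l = m := (ShortComplex.moduleCat_exact_iff S).mp hS.exact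
  refine { exact := ?_, mono_f := ?_, epi_g := ?_ }
  · rw [ShortComplex.moduleCat_exact_iff]
    intro u hu
    obtain ⟨m, rfl⟩ := piMk_surjective _ u
    have hm : S.g.hom m ∈ genZero K n k S.X₃ := piMk_eq_zero_iff.mp hu
    obtain ⟨m', hm', h⟩ := exists_mem_genZero_of_surjective _ hsurj hm
    obtain ⟨l, hl⟩ := hex (m - m') (by rw [map_sub, h, sub_self])
    refine ⟨piMk _ l, ?_⟩
    change piMk S.X₂ (S.f.hom l) = piMk S.X₂ m
    rw [hl, map_sub, piMk_eq_zero_iff.mpr hm', sub_zero]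
  · rw [ModuleCat.mono_iff_injective]
    refine (injective_iff_map_eq_zero ((piFunctor K n k).map S.f).hom).mpr fun u hu => ?_
    obtain ⟨l, rfl⟩ := piMk_surjective _ u
    have hl : S.f.hom l ∈ genZero K n k S.X₂ := piMk_eq_zero_iff.mp hu
    let _ : Module (PowerSeries K) S.X₂ :=
      Module.restrictScalars (PowerSeries K) (TwistedRing K n k) S.X₂
    have : IsScalarTower (PowerSeries K) (TwistedRing K n k) S.X₂ :=
      IsScalarTower.restrictScalars _ _ _
    let _ : Module (PowerSeries K) S.X₃ :=
      Module.restrictScalars (PowerSeries K) (TwistedRing K n k) S.X₃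
    have : IsScalarTower (PowerSeries K) (TwistedRing K n k) S.X₃ :=
      IsScalarTower.restrictScalars _ _ _
    obtain ⟨_, _⟩ := h₂.finite_free hk
    obtain ⟨_, _⟩ := h₃.finite_free hk
    have hcomp : ∀ l, S.g.hom (S.f.hom l) = 0 := fun l =>
      LinearMap.congr_fun (congrArg ModuleCat.Hom.hom S.zero) l
    rw [piMk_eq_zero_iff, ← sum_idem_smul (K := K) (n := n) (k := k) l]
    refine sum_mem fun j hj => ?_
    obtain ⟨m, hm, h⟩ := exists_fromZero_smul hk (Finset.mem_range.mp hj).le hl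
    -- Here `e_j f(l) = fromZero j • m` with `m` at the vertex `n`. As `g` kills the left side and
    -- the path cancels in the third term, `g m = 0`, so `m` comes from the first term and `e_j l`
    -- lies in its `(e_n)`-part.
    have h1 : fromZero K n k j • S.g.hom m = 0 := by
      rw [← map_smul, ← h, ← map_smul, hcomp]
    have h2 := fromZero_smul_eq_zero h1
    rw [← map_smul, hm] at h2
    obtain ⟨l', rfl⟩ := hex m h2
    rw [← map_smul, ← map_smul] at h
    rw [hinj h]
    exact fromZero_smul_mem _ _
  · rw [ModuleCat.epi_iff_surjective]
    intro u
    obtain ⟨m, rfl⟩ := piMk_surjective _ u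
    obtain ⟨m, rfl⟩ := hsurj m
    exact ⟨piMk _ m, rfl⟩

end Objects

/-! ### The maps killed by `π`. -/

section Maps

variable {M N : Type*} [AddCommGroup M] [Module (TwistedRing K n k) M]
  [AddCommGroup N] [Module (TwistedRing K n k) N]

lemma pi_pn_mem_genZero {r : ℕ} (p : Fin r → Pn K n k) : p ∈ genZero K n k (Fin r → Pn K n k) := by
  rw [← Finset.univ_sum_single p]
  refine sum_mem fun i _ => ?_
  obtain ⟨a, ha⟩ := eq_smul_pnGen (p i)
  rw [ha, ← LinearMap.coe_single (TwistedRing K n k) (fun _ => Pn K n k) i]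
  refine map_genZero _ (Submodule.smul_mem _ _ ?_)
  rw [← idem_smul_pnGen (Nat.zero_le n), ← idem_self]
  exact idem_n_smul_mem _

/-- A map of Cohen-Macaulay modules factors through a power of `P_n` if and only if its image is
contained in the submodule generated by the vertex `n`. -/
lemma factors_iff_range_le [Module (PowerSeries K) N]
    [IsScalarTower (PowerSeries K) (TwistedRing K n k) N] [Module.Finite (PowerSeries K) N]
    [Module.Free (PowerSeries K) N] (hk : (k : ℕ) ≠ 0) (f : M →ₗ[TwistedRing K n k] N) :
    (∀ m, f m ∈ genZero K n k N) ↔ ∃ (r : ℕ) (a : M →ₗ[TwistedRing K n k] (Fin r → Pn K n k))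
      (b : (Fin r → Pn K n k) →ₗ[TwistedRing K n k] N), f = b ∘ₗ a := by
  constructor
  · intro h
    obtain ⟨r, b, hb⟩ := exists_isVertexBasis K n k N
    -- The image of `pnSum` is `(e_n) N`, so `f` factors through this copy of `P_n ^ r`.
    let e := LinearEquiv.ofInjective (pnSum K n k b) (hb.pnSum_injective hk)
    refine ⟨r, e.symm.toLinearMap ∘ₗ f.codRestrict (LinearMap.range (pnSum K n k b))
      (fun m => hb.exists_pnSum_eq (h m)), pnSum K n k b, ?_⟩
    ext m
    have := congrArg Subtype.val (e.apply_symm_apply (f.codRestrict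
      (LinearMap.range (pnSum K n k b)) (fun m => hb.exists_pnSum_eq (h m)) m))
    exact this.symm
  · rintro ⟨r, a, b, rfl⟩ m
    exact map_genZero b (pi_pn_mem_genZero _)

end Maps

/-! ### Injectivity of `P_n` and fullness of `π`. -/

section Injective

/-- Homomorphisms to `P_n` extend along the injections of short exact sequences whose third term is
projective over `K[[t]]`. -/
lemma exists_extension_of_exact (hk : (k : ℕ) ≠ 0) {L M N : Type*} [AddCommGroup L]
    [AddCommGroup M] [AddCommGroup N]
    [Module (TwistedRing K n k) L] [Module (TwistedRing K n k) M] [Module (TwistedRing K n k) N]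
    [Module (PowerSeries K) L] [IsScalarTower (PowerSeries K) (TwistedRing K n k) L]
    [Module (PowerSeries K) M] [IsScalarTower (PowerSeries K) (TwistedRing K n k) M]
    [Module (PowerSeries K) N] [IsScalarTower (PowerSeries K) (TwistedRing K n k) N]
    [Module.Projective (PowerSeries K) N]
    (i : L →ₗ[TwistedRing K n k] M) (q : M →ₗ[TwistedRing K n k] N) (hi : Function.Injective i)
    (hq : Function.Surjective q) (hqi : ∀ l, q (i l) = 0) (hex : ∀ m, q m = 0 → ∃ l, i l = m)
    (g : L →ₗ[TwistedRing K n k] Pn K n k) :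
    ∃ h : M →ₗ[TwistedRing K n k] Pn K n k, h ∘ₗ i = g := by
  obtain ⟨σ, hσ⟩ := LinearMap.exists_rightInverse_of_surjective
    (q.restrictScalars (PowerSeries K)) (LinearMap.range_eq_top.mpr hq)
  have hσ' : ∀ x, q (σ x) = x := fun x => LinearMap.congr_fun hσ x
  let iZ := i.restrictScalars (PowerSeries K)
  let e := LinearEquiv.ofInjective iZ hi
  -- The `K[[t]]`-linear retraction `m ↦ m - σ (q m)`, with `σ` a section of `q`.
  let s : M →ₗ[PowerSeries K] L := e.symm.toLinearMap ∘ₗ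
    (LinearMap.id - σ ∘ₗ q.restrictScalars (PowerSeries K)).codRestrict (LinearMap.range iZ)
      (fun m => hex _ (by
        change q (m - σ (q m)) = 0
        rw [map_sub, hσ', sub_self]))
  refine exists_extension_pn hk i s (fun l => ?_) g
  change e.symm _ = l
  rw [LinearEquiv.symm_apply_eq]
  apply Subtype.ext
  change i l - σ (q (i l)) = i l
  rw [hqi, map_zero, sub_zero]

lemma exists_extension_of_shortExact (hk : (k : ℕ) ≠ 0)
    (S : ShortComplex (ModuleCat.{u} (TwistedRing K n k))) (h₃ : isCM K n k S.X₃)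
    (hS : S.ShortExact) (g : S.X₁ ⟶ ModuleCat.of (TwistedRing K n k) (Pn K n k)) :
    ∃ h, S.f ≫ h = g := by
  let _ : Module (PowerSeries K) S.X₁ :=
    Module.restrictScalars (PowerSeries K) (TwistedRing K n k) S.X₁
  have : IsScalarTower (PowerSeries K) (TwistedRing K n k) S.X₁ :=
    IsScalarTower.restrictScalars _ _ _
  let _ : Module (PowerSeries K) S.X₂ :=
    Module.restrictScalars (PowerSeries K) (TwistedRing K n k) S.X₂
  have : IsScalarTower (PowerSeries K) (TwistedRing K n k) S.X₂ :=
    IsScalarTower.restrictScalars _ _ _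
  let _ : Module (PowerSeries K) S.X₃ :=
    Module.restrictScalars (PowerSeries K) (TwistedRing K n k) S.X₃
  have : IsScalarTower (PowerSeries K) (TwistedRing K n k) S.X₃ :=
    IsScalarTower.restrictScalars _ _ _
  obtain ⟨_, _⟩ := h₃.finite_free hk
  obtain ⟨h, hh⟩ := exists_extension_of_exact hk S.f.hom S.g.hom
    ((ModuleCat.mono_iff_injective S.f).mp hS.mono_f)
    ((ModuleCat.epi_iff_surjective S.g).mp hS.epi_g)
    (fun l => LinearMap.congr_fun (congrArg ModuleCat.Hom.hom S.zero) l)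
    ((ShortComplex.moduleCat_exact_iff S).mp hS.exact) g.hom
  exact ⟨ModuleCat.ofHom h, ModuleCat.hom_ext hh⟩

/-- `π` is full on Cohen-Macaulay modules. -/
lemma exists_lift_of_pi (hk : (k : ℕ) ≠ 0) {M N : ModuleCat.{u} (TwistedRing K n k)}
    (hM : isCM K n k M) (hN : isCM K n k N)
    (g : (piFunctor K n k).obj M ⟶ (piFunctor K n k).obj N) :
    ∃ f : M ⟶ N, (piFunctor K n k).map f = g := by
  let _ : Module (PowerSeries K) M := Module.restrictScalars (PowerSeries K) (TwistedRing K n k) M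
  have : IsScalarTower (PowerSeries K) (TwistedRing K n k) M := IsScalarTower.restrictScalars _ _ _
  let _ : Module (PowerSeries K) N := Module.restrictScalars (PowerSeries K) (TwistedRing K n k) N
  have : IsScalarTower (PowerSeries K) (TwistedRing K n k) N := IsScalarTower.restrictScalars _ _ _
  obtain ⟨_, _⟩ := hM.finite_free hk
  obtain ⟨_, _⟩ := hN.finite_free hk
  obtain ⟨r, b, hb⟩ := exists_isVertexBasis K n k N
  -- The pullback of `M → π M → π N` and `N → π N`: an extension of `M` by `(e_n) N`, that is, by a
  -- power of `P_n`. Its stability under `A` uses that `Π → A / (e_n)` is surjective.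
  let E : Submodule (TwistedRing K n k) (M × N) :=
    { carrier := {q | g.hom (piMk M q.1) = piMk N q.2}
      add_mem' := fun {q q'} h h' => by
        change g.hom (piMk M (q.1 + q'.1)) = piMk N (q.2 + q'.2)
        rw [map_add, map_add, map_add]
        exact congrArg₂ (· + ·) h h'
      zero_mem' := by
        change g.hom (piMk M 0) = piMk N 0
        rw [map_zero, map_zero, map_zero]
      smul_mem' := fun a q h => by
        obtain ⟨p, hp⟩ := exists_preprojHom_eq hk a
        change g.hom (piMk M (a • q.1)) = piMk N (a • q.2)
        rw [← smul_piMk hp, ← smul_piMk hp, map_smul]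
        exact congrArg (p • ·) h }
  have hE : ∀ q : M × N, q ∈ E ↔ g.hom (piMk M q.1) = piMk N q.2 := fun _ => Iff.rfl
  let pr : E →ₗ[TwistedRing K n k] M := LinearMap.fst _ _ _ ∘ₗ E.subtype
  let i : (Fin r → Pn K n k) →ₗ[TwistedRing K n k] E :=
    (LinearMap.inr _ _ _ ∘ₗ pnSum K n k b).codRestrict E (fun p => by
      rw [hE]
      change g.hom (piMk M 0) = piMk N (pnSum K n k b p)
      rw [map_zero, map_zero, piMk_eq_zero_iff.mpr (pnSum_mem b p)])
  have hpr : Function.Surjective pr := fun m => by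
    obtain ⟨m', hm'⟩ := piMk_surjective N (g.hom (piMk M m))
    exact ⟨⟨(m, m'), hm'.symm⟩, rfl⟩
  have hi : Function.Injective i := fun p p' h =>
    hb.pnSum_injective hk (congrArg (fun q : E => q.1.2) h)
  have hex : ∀ q, pr q = 0 → ∃ p, i p = q := by
    rintro ⟨⟨m, m'⟩, h⟩ (rfl : m = 0)
    rw [hE, map_zero, map_zero] at h
    obtain ⟨p, hp⟩ := hb.exists_pnSum_eq (piMk_eq_zero_iff.mp h.symm)
    exact ⟨p, Subtype.ext (Prod.ext rfl hp)⟩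
  -- Injectivity of `P_n` extends the identity of `P_n ^ r` to `E`. Subtracting this retraction from
  -- the projection to `N` gives a map that vanishes on the kernel of `E → M`, hence descends to
  -- `M`; it changes only by elements of `(e_n) N`.
  choose h hh using fun j => exists_extension_of_exact hk i pr hi hpr (fun _ => rfl) hex
    (LinearMap.proj j)
  let F : E →ₗ[TwistedRing K n k] N :=
    LinearMap.snd _ _ _ ∘ₗ E.subtype - pnSum K n k b ∘ₗ LinearMap.pi h
  have hF : ∀ q, F q = q.1.2 - pnSum K n k b (fun j => h j q) := fun q => rfl
  have hker : LinearMap.ker pr ≤ LinearMap.ker F := by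
    intro q hq
    obtain ⟨p, rfl⟩ := hex q hq
    rw [LinearMap.mem_ker, hF, sub_eq_zero]
    change pnSum K n k b p = _
    congr 1
    funext j
    exact (LinearMap.congr_fun (hh j) p).symm
  let e := pr.quotKerEquivOfSurjective hpr
  let f : M →ₗ[TwistedRing K n k] N := (LinearMap.ker pr).liftQ F hker ∘ₗ e.symm.toLinearMap
  have hf : ∀ q, f (pr q) = F q := fun q => by
    have h1 : e.symm (pr q) = (LinearMap.ker pr).mkQ q := by
      rw [LinearEquiv.symm_apply_eq]; rfl
    change (LinearMap.ker pr).liftQ F hker (e.symm (pr q)) = F q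
    rw [h1]; rfl
  refine ⟨ModuleCat.ofHom f, ModuleCat.hom_ext (LinearMap.ext fun u => ?_)⟩
  obtain ⟨m, rfl⟩ := piMk_surjective M u
  obtain ⟨q, rfl⟩ := hpr m
  rw [piFunctor_map_piMk]
  change piMk N (f (pr q)) = _
  rw [hf, hF, map_sub, piMk_eq_zero_iff.mpr (pnSum_mem b _), sub_zero]
  exact ((hE _).mp q.2).symm

end Injective

end PiFunctor

/-! ### Every module in `Sub Q_k` lifts to a Cohen-Macaulay module -/

section Density

variable {K : Type u} [Field K] {n : ℕ} {k : Fin n} [NeZero n] [HasEnoughRootsOfUnity K n]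
  {N : Type*} [AddCommGroup N] [Module (Preproj K n) N] [Module K N]
  [IsScalarTower K (Preproj K n) N]

/-- The `K[t]`-linear map `N → K[[t]] / (t ^ n)` given by a linear form on a `Π`-module, where
`t` acts on `N` as `x y`. -/
def truncForm (φ : N →ₗ[K] K) : N →+ PowerSeries K where
  -- With the exponents reversed, `x y` acts as multiplication by `X` modulo `X ^ n`, and the top
  -- coefficient, at `n - 1`, is `φ u` itself.
  toFun u := PowerSeries.mk fun j =>
    if j < n then φ ((pX K n * pY K n) ^ (n - 1 - j) • u) else 0
  map_zero' := by
    ext j; simp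
  map_add' u v := by
    ext j
    simp only [PowerSeries.coeff_mk, map_add, smul_add]
    split_ifs <;> simp

lemma truncForm_apply (φ : N →ₗ[K] K) (u : N) : truncForm (n := n) φ u = PowerSeries.mk fun j =>
    if j < n then φ ((pX K n * pY K n) ^ (n - 1 - j) • u) else 0 := rfl

lemma coeff_truncForm (φ : N →ₗ[K] K) (u : N) {j : ℕ} (hj : j < n) :
    PowerSeries.coeff j (truncForm (n := n) φ u) =
      φ ((pX K n * pY K n) ^ (n - 1 - j) • u) := by
  rw [truncForm_apply, PowerSeries.coeff_mk, if_pos hj]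

lemma truncForm_C (φ : N →ₗ[K] K) (c : K) (u : N) : truncForm (n := n) φ (c • u) =
    PowerSeries.C c * truncForm (n := n) φ u := by
  ext j
  rw [PowerSeries.coeff_C_mul, truncForm_apply, truncForm_apply, PowerSeries.coeff_mk,
    PowerSeries.coeff_mk]
  split_ifs
  · rw [← algebraMap_smul (Preproj K n) c u, smul_smul, ← Algebra.commutes, mul_smul,
      algebraMap_smul, map_smul, smul_eq_mul]
  · rw [mul_zero]

lemma pX_mul_pY_pow_n : (pX K n * pY K n) ^ n = 0 := by
  have hc : Commute (pX K n) (pY K n) := pX_mul_pY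
  rw [hc.mul_pow, pX_pow_n, zero_mul]

/-- The coefficients below `n` are shifted by one; the one at `0` vanishes because `(x y) ^ n = 0`
in `Π`. -/
lemma exists_truncForm_smul (φ : N →ₗ[K] K) (u : N) : ∃ c, truncForm (n := n) φ
    ((pX K n * pY K n) • u) = PowerSeries.X * truncForm (n := n) φ u + PowerSeries.X ^ n * c := by
  have h : PowerSeries.X ^ n ∣ truncForm (n := n) φ ((pX K n * pY K n) • u) -
      PowerSeries.X * truncForm (n := n) φ u := by
    rw [PowerSeries.X_pow_dvd_iff]
    intro d hd
    rw [map_sub, coeff_truncForm φ _ hd, smul_smul, ← pow_succ]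
    rcases d with _ | d
    · rw [show n - 1 - 0 + 1 = n by omega, pX_mul_pY_pow_n, zero_smul, map_zero,
        PowerSeries.coeff_zero_X_mul, sub_zero]
    · rw [PowerSeries.coeff_succ_X_mul, coeff_truncForm φ _ (by omega),
        show n - 1 - (d + 1) + 1 = n - 1 - d by omega, sub_self]
  obtain ⟨c, hc⟩ := h
  exact ⟨c, by rw [← hc]; ring⟩

variable (k) in
/-- The map `N → P_n / t ^ n P_n` (with values lifted to `P_n`) given by a linear form on a
`Π`-module. -/
def truncCoind (φ : N →ₗ[K] K) : N →+ Pn K n k where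
  toFun u := ∑ j ∈ Finset.range n, truncForm (n := n) φ (pToK K n k j • u) • pnGen K n k j
  map_zero' := by simp
  map_add' u v := by simp only [smul_add, map_add, add_smul, Finset.sum_add_distrib]

lemma truncCoind_apply (φ : N →ₗ[K] K) (u : N) : truncCoind k φ u =
    ∑ j ∈ Finset.range n, truncForm (n := n) φ (pToK K n k j • u) • pnGen K n k j := rfl

lemma truncCoind_C (φ : N →ₗ[K] K) (c : K) (u : N) :
    truncCoind k φ (c • u) = PowerSeries.C c • truncCoind k φ u := by
  rw [truncCoind_apply, truncCoind_apply, Finset.smul_sum]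
  refine Finset.sum_congr rfl fun j _ => ?_
  rw [← algebraMap_smul (Preproj K n) c u, smul_smul, ← Algebra.commutes, mul_smul,
    algebraMap_smul, truncForm_C, mul_smul]

lemma truncCoind_vertex (φ : N →ₗ[K] K) {j : ℕ} (hj : j < n) (u : N) :
    truncCoind k φ (pE K n j • u) = idem K n k j • truncCoind k φ u := by
  rw [truncCoind_apply, truncCoind_apply, Finset.smul_sum]
  refine Finset.sum_congr rfl fun i hi => ?_
  rw [smul_smul, smul_smul_comm']
  by_cases h : i = j
  · rw [h, pToK, (zigzag_preproj K n).toVertex_mul_e, idem_smul_pnGen hj.le]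
  · rw [pToK_mul_pE_ne h, zero_smul, map_zero, zero_smul,
      idem_smul_pnGen_ne (Finset.mem_range.mp hi) hj (Ne.symm h), smul_zero]

/-- The computation of `coind` modulo `t ^ n`: detours produce `x y` on `N` and `t` on `P_n`, which
agree only up to `t ^ n`. The cyclic reindexing is harmless because `Π` has no vertex `0` or `n`. -/
lemma exists_truncCoind_pX (φ : N →ₗ[K] K) (u : N) : ∃ p, truncCoind k φ (pX K n • u) =
    xA K n k • truncCoind k φ u + (PowerSeries.X : PowerSeries K) ^ n • p := by
  choose c hc using fun j => exists_truncForm_smul (n := n) φ (pToK K n k j • u)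
  refine ⟨∑ j ∈ Finset.range n, if j < (k : ℕ) then 0 else c j • pnGen K n k (j + 1), ?_⟩
  rw [truncCoind_apply, truncCoind_apply, ← sum_range_shift, Finset.smul_sum, Finset.smul_sum,
    ← Finset.sum_add_distrib]
  · refine Finset.sum_congr rfl fun i hi => ?_
    rw [smul_smul, smul_smul_comm']
    split_ifs with h
    · rw [pToK, (zigzag_preproj K n).toVertex_mul_x_of_lt h, xA_smul_pnGen_of_lt h, smul_zero,
        add_zero]
    · have h := not_lt.mp h
      rw [pToK, (zigzag_preproj K n).toVertex_mul_x_of_ge h, mul_smul, hc,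
        xA_smul_pnGen_of_ge h (Finset.mem_range.mp hi), add_smul, mul_comm PowerSeries.X,
        mul_smul, mul_smul]
  · rw [pToK_outside (Or.inl rfl), pToK_outside (Or.inr le_rfl)]
    simp

lemma exists_truncCoind_pY (φ : N →ₗ[K] K) (u : N) : ∃ p, truncCoind k φ (pY K n • u) =
    yA K n k • truncCoind k φ u + (PowerSeries.X : PowerSeries K) ^ n • p := by
  choose c hc using fun j => exists_truncForm_smul (n := n) φ (pToK K n k j • u)
  refine ⟨∑ j ∈ Finset.range n, if j < (k : ℕ) then c (j + 1) • pnGen K n k j else 0, ?_⟩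
  have hshift := sum_range_shift
    (fun j => truncForm (n := n) φ (pToK K n k j • u) • pnGen K n k j) n (by
      simp only [pToK_outside (Or.inl (rfl : (0 : ℕ) = 0)), pToK_outside (Or.inr (le_refl n))]
      simp)
  rw [truncCoind_apply, truncCoind_apply, ← hshift, Finset.smul_sum, Finset.smul_sum,
    ← Finset.sum_add_distrib]
  refine Finset.sum_congr rfl fun i hi => ?_
  rw [smul_smul, smul_smul_comm']
  split_ifs with h
  · rw [pToK, (zigzag_preproj K n).toVertex_mul_y_of_lt h, mul_smul, hc,
      yA_smul_pnGen_of_lt h, add_smul, mul_comm PowerSeries.X, mul_smul, mul_smul]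
  · have h := not_lt.mp h
    rw [pToK, (zigzag_preproj K n).toVertex_mul_y_of_ge h,
      yA_smul_pnGen_of_ge h (Finset.mem_range.mp hi), smul_zero, add_zero]

/-- The number in question is the coefficient of `t ^ (n - 1)` at the vertex `i`, and this vanishes
for a multiple of `t ^ n`. -/
lemma apply_pToK_eq_zero (hk : (k : ℕ) ≠ 0) (φ : N →ₗ[K] K) {u : N} {p : Pn K n k}
    (h : truncCoind k φ u = (PowerSeries.X : PowerSeries K) ^ n • p) (i : ℕ) :
    φ (pToK K n k i • u) = 0 := by
  rcases lt_or_ge i n with hi | hi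
  · have h1 := DFunLike.congr_fun (congrArg (pnBasis hk).repr h) ⟨i, hi⟩
    have h2 : truncCoind k φ u = ∑ j : Fin n,
        truncForm (n := n) φ (pToK K n k j • u) • pnBasis hk j := by
      rw [truncCoind_apply, Finset.sum_range]
      simp only [pnBasis_apply]
    rw [h2, Module.Basis.repr_sum_self, map_smul (pnBasis hk).repr, Finsupp.smul_apply, smul_eq_mul] at h1
    have h3 := congrArg (PowerSeries.coeff (n - 1)) h1
    have hn := NeZero.pos n
    rw [coeff_truncForm φ _ (by omega), Nat.sub_self, pow_zero, one_smul,
      PowerSeries.coeff_X_pow_mul', if_neg (by omega)] at h3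
    exact h3
  · rw [pToK_outside (Or.inr hi), zero_smul, map_zero]

end Density

section EssSurj

variable {K : Type u} [Field K] {n : ℕ} {k : Fin n} [NeZero n] [HasEnoughRootsOfUnity K n]

/-- `π` is dense: a module `N` in `Sub Q_k` embeds in a power of `P_n / t ^ n P_n`, and its
preimage in the power of `P_n` is a lift of `N`. -/
lemma exists_isCM_pi_iso (hk : (k : ℕ) ≠ 0) {N : ModuleCat.{u} (Preproj K n)}
    (hN : isSubQ K n k N) : ∃ M : ModuleCat.{u} (TwistedRing K n k),
      isCM K n k M ∧ Nonempty ((piFunctor K n k).obj M ≅ N) := by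
  rw [isSubQ_iff] at hN
  obtain ⟨hfd, hN⟩ := hN
  let _ : Module K N := Module.restrictScalars K (Preproj K n) N
  have : IsScalarTower K (Preproj K n) N := IsScalarTower.restrictScalars K (Preproj K n) N
  have : Module.Finite K N := hfd
  let c := Module.finBasis K N
  let r := Module.finrank K N
  -- One copy of `P_n` for each coordinate form of `N`.
  let F : N →+ (Fin r → Pn K n k) :=
    { toFun := fun u i => truncCoind k (c.coord i) u
      map_zero' := by funext i; simp
      map_add' := fun u v => by funext i; simp }
  have hFi : ∀ u i, F u i = truncCoind k (c.coord i) u := fun _ _ => rfl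
  have hFX : ∀ u, ∃ p, F (pX K n • u) =
      xA K n k • F u + (PowerSeries.X : PowerSeries K) ^ n • p := fun u => by
    choose p hp using fun i => exists_truncCoind_pX (k := k) (c.coord i) u
    exact ⟨p, funext fun i => hp i⟩
  have hFY : ∀ u, ∃ p, F (pY K n • u) =
      yA K n k • F u + (PowerSeries.X : PowerSeries K) ^ n • p := fun u => by
    choose p hp using fun i => exists_truncCoind_pY (k := k) (c.coord i) u
    exact ⟨p, funext fun i => hp i⟩
  have hFE : ∀ u, ∀ j < n, F (pE K n j • u) = idem K n k j • F u := fun u j hj =>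
    funext fun i => truncCoind_vertex (c.coord i) hj u
  have hFC : ∀ (a : K) u, F (a • u) = PowerSeries.C a • F u := fun a u =>
    funext fun i => truncCoind_C (c.coord i) a u
  -- Injectivity modulo `t ^ n`: all coordinates of all paths from `u` to `k` vanish, so `u = 0` by
  -- the criterion for `Sub Q_k`.
  have hF0 : ∀ u p, F u = (PowerSeries.X : PowerSeries K) ^ n • p → u = 0 := fun u p h =>
    hN u fun i => c.ext_elem fun j => by
      rw [map_zero]
      exact apply_pToK_eq_zero hk (c.coord j) (congrFun h j) i
  -- The preimage in `P_n ^ r` of the image of `N` modulo `t ^ n`.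
  let P : Set (Fin r → Pn K n k) :=
    {p | ∃ u q, p = F u + (PowerSeries.X : PowerSeries K) ^ n • q}
  have hadd : ∀ p p', p ∈ P → p' ∈ P → p + p' ∈ P := by
    rintro _ _ ⟨u, q, rfl⟩ ⟨u', q', rfl⟩
    exact ⟨u + u', q + q', by rw [map_add, smul_add]; abel⟩
  have hXn : ∀ q, (PowerSeries.X : PowerSeries K) ^ n • q ∈ P := fun q =>
    ⟨0, q, by rw [map_zero, zero_add]⟩
  have hx : ∀ p ∈ P, xA K n k • p ∈ P := by
    rintro _ ⟨u, q, rfl⟩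
    obtain ⟨p, hp⟩ := hFX u
    exact ⟨pX K n • u, xA K n k • q - p, by
      rw [hp, smul_add, smul_smul_comm', smul_sub]; abel⟩
  have hy : ∀ p ∈ P, yA K n k • p ∈ P := by
    rintro _ ⟨u, q, rfl⟩
    obtain ⟨p, hp⟩ := hFY u
    exact ⟨pY K n • u, yA K n k • q - p, by
      rw [hp, smul_add, smul_smul_comm', smul_sub]; abel⟩
  have hC : ∀ (a : K), ∀ p ∈ P, PowerSeries.C a • p ∈ P := by
    rintro a _ ⟨u, q, rfl⟩
    exact ⟨a • u, PowerSeries.C a • q, by rw [hFC, smul_add, smul_comm (PowerSeries.C a)]⟩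
  have hXi : ∀ (i : ℕ), ∀ p ∈ P, (PowerSeries.X : PowerSeries K) ^ i • p ∈ P := by
    intro i
    induction i with
    | zero => intro p hp; rwa [pow_zero, one_smul]
    | succ i ih =>
      intro p hp
      rw [pow_succ', mul_smul, ← xA_yA_smul (k := k), mul_smul]
      exact hx _ (hy _ (ih p hp))
  have hsum : ∀ (f : ℕ → Fin r → Pn K n k) (m : ℕ), (∀ i < m, f i ∈ P) →
      ∑ i ∈ Finset.range m, f i ∈ P := by
    intro f m
    induction m with
    | zero => intro _; exact ⟨0, 0, by simp⟩
    | succ m ih =>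
      intro h
      rw [Finset.sum_range_succ]
      exact hadd _ _ (ih fun i hi => h i (by omega)) (h m (by omega))
  let S : Submodule (TwistedRing K n k) (Fin r → Pn K n k) :=
    { carrier := P
      add_mem' := fun {p p'} h h' => hadd p p' h h'
      zero_mem' := ⟨0, 0, by simp⟩
      smul_mem' := fun a p hp => by
        induction a using twisted_induction (K := K) hk generalizing p with
        | gen_x => exact hx p hp
        | gen_y => exact hy p hp
        | add a b ha hb => rw [add_smul]; exact hadd _ _ (ha _ hp) (hb _ hp)
        | mul a b ha hb => rw [mul_smul]; exact ha _ (hb _ hp)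
        | vertex j =>
          rw [← idem_mod]
          obtain ⟨u, q, rfl⟩ := hp
          exact ⟨pE K n (j % n) • u, idem K n k (j % n) • q, by
            rw [hFE _ _ (Nat.mod_lt _ (NeZero.pos n)), smul_add, smul_smul_comm']⟩
        | algebraMap c =>
          rw [algebraMap_smul]
          obtain ⟨c', hc'⟩ := exists_eq_sum_add_X_pow_mul c n
          rw [hc', add_smul, mul_smul, Finset.sum_smul]
          refine hadd _ _ (hsum _ _ fun i _ => ?_) (hXn _)
          rw [mul_smul]
          exact hC _ _ (hXi i p hp) }
  have hfin : Module.Finite (PowerSeries K) (Pn K n k) := Module.Finite.of_basis (pnBasis hk)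
  have hfree : Module.Free (PowerSeries K) (Pn K n k) := Module.Free.of_basis (pnBasis hk)
  have hCM : isCM K n k (ModuleCat.of (TwistedRing K n k) S) :=
    isCM_of_injective hk S.subtype Subtype.val_injective
  let M := ModuleCat.of (TwistedRing K n k) S
  -- `(e_n) S = t ^ n P_n ^ r`: on the one hand `e_n` kills the values of `F`, since `N` has no
  -- component at the vertex `0`; on the other hand `P_n ^ r` is generated by its component at `n`.
  have hzero : ∀ s : S, s ∈ genZero K n k S ↔
      ∃ q, (s : Fin r → Pn K n k) = (PowerSeries.X : PowerSeries K) ^ n • q := by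
    intro s
    constructor
    · intro hs
      rw [genZero_eq_span] at hs
      induction hs using Submodule.span_induction with
      | mem s hs =>
        obtain ⟨⟨_, u, q, rfl⟩, rfl⟩ := hs
        refine ⟨idem K n k n • q, ?_⟩
        change idem K n k n • (F u + (PowerSeries.X : PowerSeries K) ^ n • q) = _
        rw [smul_add, idem_self, ← hFE _ _ (NeZero.pos n), pE_outside (Or.inl rfl), zero_smul,
          map_zero, zero_add, smul_smul_comm']
      | zero => exact ⟨0, by simp⟩
      | add s s' _ _ h h' =>
        obtain ⟨q, hq⟩ := h
        obtain ⟨q', hq'⟩ := h'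
        exact ⟨q + q', by rw [smul_add, ← hq, ← hq']; rfl⟩
      | smul a s _ h =>
        obtain ⟨q, hq⟩ := h
        exact ⟨a • q, by rw [← smul_smul_comm', ← hq]; rfl⟩
    · rintro ⟨q, hq⟩
      let g : (Fin r → Pn K n k) →ₗ[TwistedRing K n k] S :=
        { toFun := fun q => ⟨(PowerSeries.X : PowerSeries K) ^ n • q, hXn q⟩
          map_add' := fun p q => Subtype.ext (smul_add _ _ _)
          map_smul' := fun a q => Subtype.ext (smul_smul_comm' _ _ _).symm }
      have : s = g q := Subtype.ext hq
      rw [this]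
      exact map_genZero g (pi_pn_mem_genZero q)
  have hFP : ∀ u, F u ∈ S := fun u => ⟨u, 0, by rw [smul_zero, add_zero]⟩
  let ψ : N →+ (piFunctor K n k).obj M := (piMk M).comp
    { toFun := fun u => ⟨F u, hFP u⟩
      map_zero' := Subtype.ext (map_zero F)
      map_add' := fun u v => Subtype.ext (map_add F u v) }
  -- `F` commutes with the arrows only up to `t ^ n P_n ^ r`, and this error disappears in `π M`.
  have hψ : ∀ (u : N) (s : S) (q : Fin r → Pn K n k),
      F u = s + (PowerSeries.X : PowerSeries K) ^ n • q → ψ u = piMk M s := by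
    intro u s q h
    rw [← sub_eq_zero]
    change piMk M _ - piMk M s = 0
    rw [← map_sub, piMk_eq_zero_iff]
    refine (hzero _).mpr ⟨q, ?_⟩
    change F u - s = _
    rw [h, add_sub_cancel_left]
  have hlin : ∀ (a : Preproj K n) (u : N), ψ (a • u) = a • ψ u := by
    intro a
    induction a using preproj_induction with
    | add a b ha hb => intro u; rw [add_smul, map_add, ha, hb, ← add_smul]
    | mul a b ha hb => intro u; rw [mul_smul, ha, hb, ← mul_smul]
    | gen_x =>
      intro u
      obtain ⟨p, hp⟩ := hFX u
      exact (hψ _ (xA K n k • (⟨F u, hFP u⟩ : S)) p hp).trans (smul_piMk preprojHom_pX _).symm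
    | gen_y =>
      intro u
      obtain ⟨p, hp⟩ := hFY u
      exact (hψ _ (yA K n k • (⟨F u, hFP u⟩ : S)) p hp).trans (smul_piMk preprojHom_pY _).symm
    | vertex j =>
      intro u
      rcases lt_or_ge j n with hj | hj
      · exact (hψ _ (idem K n k j • (⟨F u, hFP u⟩ : S)) 0 (by
          rw [hFE _ _ hj, smul_zero, add_zero]; rfl)).trans
          (smul_piMk (preprojHom_pE hj.le) _).symm
      · rw [pE_outside (Or.inr hj), zero_smul, zero_smul, map_zero]
    | algebraMap a =>
      intro u
      refine (hψ _ (PowerSeries.C a • (⟨F u, hFP u⟩ : S)) 0 ?_).trans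
        (algebraMap_smul_piMk (M := M) a (⟨F u, hFP u⟩ : S)).symm
      rw [algebraMap_smul, hFC, smul_zero, add_zero]
      rfl
  let e : N ≃ₗ[Preproj K n] (piFunctor K n k).obj M := LinearEquiv.ofBijective
    { toFun := ψ, map_add' := map_add ψ, map_smul' := hlin } (by
      constructor
      · refine (injective_iff_map_eq_zero ψ).mpr fun u hu => ?_
        obtain ⟨q, hq⟩ := (hzero _).mp (piMk_eq_zero_iff.mp hu)
        exact hF0 u q hq
      · intro v
        obtain ⟨s, rfl⟩ := piMk_surjective M v
        obtain ⟨_, u, q, rfl⟩ := s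
        exact ⟨u, hψ u _ (-q) (by rw [smul_neg]; simp)⟩)
  exact ⟨M, hCM, ⟨e.symm.toModuleIso⟩⟩

end EssSurj

/-! ### Minimal Cohen-Macaulay modules -/

section Minimal

variable {K : Type u} [Field K] {n : ℕ} {k : Fin n} [NeZero n] [HasEnoughRootsOfUnity K n]

lemma isUnit_of_not_X_dvd {c : PowerSeries K} (h : ¬ PowerSeries.X ∣ c) : IsUnit c := by
  rw [PowerSeries.isUnit_iff_constantCoeff, isUnit_iff_ne_zero]
  exact fun h0 => h (PowerSeries.X_dvd_iff.mpr h0)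

lemma isCompl_range_ker {S M P : Type*} [Ring S] [AddCommGroup M] [AddCommGroup P] [Module S M]
    [Module S P] (a : M →ₗ[S] P) (b : P →ₗ[S] M) (h : a ∘ₗ b = LinearMap.id) :
    IsCompl (LinearMap.range b) (LinearMap.ker a) := by
  have h' : ∀ p, a (b p) = p := fun p => LinearMap.congr_fun h p
  constructor
  · rw [Submodule.disjoint_def]
    rintro _ ⟨p, rfl⟩ hp
    rw [LinearMap.mem_ker, h'] at hp
    rw [hp, map_zero]
  · rw [codisjoint_iff, eq_top_iff]
    intro m _
    refine Submodule.mem_sup.mpr ⟨b (a m), ⟨_, rfl⟩, m - b (a m), ?_, by abel⟩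
    rw [LinearMap.mem_ker, map_sub, h', sub_self]

/-- A minimal module has no retraction to `P_n`, so that every map to `P_n` takes `(e_n) M` to
`t P_n`. -/
lemma exists_eq_X_smul_of_isMinimal (hk : (k : ℕ) ≠ 0) {M : ModuleCat.{u} (TwistedRing K n k)}
    [Module (PowerSeries K) M] [IsScalarTower (PowerSeries K) (TwistedRing K n k) M]
    (hM : IsMinimal K n k M) (a : M →ₗ[TwistedRing K n k] Pn K n k) {m : M}
    (hm : m ∈ genZero K n k M) : ∃ p, a m = (PowerSeries.X : PowerSeries K) • p := by
  rw [genZero_eq_span] at hm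
  induction hm using Submodule.span_induction with
  | zero => exact ⟨0, by simp⟩
  | add m m' _ _ h h' =>
    obtain ⟨p, hp⟩ := h
    obtain ⟨p', hp'⟩ := h'
    exact ⟨p + p', by rw [map_add, hp, hp', smul_add]⟩
  | smul b m _ h =>
    obtain ⟨p, hp⟩ := h
    exact ⟨b • p, by rw [map_smul, hp, smul_smul_comm']⟩
  | mem m hm =>
    obtain ⟨m, rfl⟩ := hm
    have h1 := idem_smul_pn hk (a m) ⟨0, NeZero.pos n⟩
    change idem K n k 0 • a m = _ • pnGen K n k 0 at h1
    rw [← idem_self, ← map_smul] at h1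
    set c := (pnBasis hk).repr (a m) ⟨0, NeZero.pos n⟩
    by_cases hc : PowerSeries.X ∣ c
    · obtain ⟨d, hd⟩ := hc
      exact ⟨d • pnGen K n k 0, by rw [← mul_smul, ← hd]; exact h1⟩
    · exfalso
      obtain ⟨v, hv⟩ := isUnit_of_not_X_dvd hc
      -- If the coefficient of `a (e_n m)` is a unit `v`, then `e_n ↦ v⁻¹ e_n m` is a section of `a`
      -- and `P_n` splits off from `M`, against minimality.
      have h2 : a ∘ₗ pnMap ((↑v⁻¹ : PowerSeries K) • m) = LinearMap.id := by
        refine pn_hom_ext ?_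
        rw [LinearMap.comp_apply, pnMap_zero, smul_smul_comm']
        have := map_smul (a.restrictScalars (PowerSeries K)) (↑v⁻¹ : PowerSeries K)
          (idem K n k n • m)
        refine Eq.trans this ?_
        change (↑v⁻¹ : PowerSeries K) • a (idem K n k n • m) = _
        rw [h1, ← hv, smul_smul, Units.inv_mul, one_smul]
        rfl
      refine hM ⟨_, _, isCompl_range_ker _ _ h2, ⟨(LinearEquiv.ofInjective _ ?_).symm⟩⟩
      exact Function.LeftInverse.injective (g := a) (fun p => LinearMap.congr_fun h2 p)

/-- An endomorphism of a minimal Cohen-Macaulay module is bijective if it induces the identity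
of `π M`. -/
lemma bijective_of_isMinimal (hk : (k : ℕ) ≠ 0) {M : ModuleCat.{u} (TwistedRing K n k)}
    (hCM : isCM K n k M) (hM : IsMinimal K n k M) (f : M →ₗ[TwistedRing K n k] M)
    (hf : ∀ m, f m - m ∈ genZero K n k M) : Function.Bijective f := by
  let _ : Module (PowerSeries K) M := Module.restrictScalars (PowerSeries K) (TwistedRing K n k) M
  have : IsScalarTower (PowerSeries K) (TwistedRing K n k) M := IsScalarTower.restrictScalars _ _ _
  obtain ⟨_, _⟩ := hCM.finite_free hk
  obtain ⟨r, a, b, hab⟩ := (factors_iff_range_le hk (f - LinearMap.id)).mp hf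
  set h := f - LinearMap.id with hh
  -- `h = b ∘ a` through `P_n ^ r`, and `h m` lies in `(e_n) M`; minimality makes `a (h m)`
  -- divisible by `t`, hence also `h (h m)`.
  have hsq : ∀ m, ∃ m', h (h m) = (PowerSeries.X : PowerSeries K) • m' := by
    intro m
    choose p hp using fun i =>
      exists_eq_X_smul_of_isMinimal hk hM (LinearMap.proj i ∘ₗ a) (hf m)
    have h1 : a (h m) = (PowerSeries.X : PowerSeries K) • p := funext fun i => hp i
    refine ⟨b p, ?_⟩
    nth_rewrite 1 [hab]
    rw [LinearMap.comp_apply, h1]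
    exact map_smul (b.restrictScalars (PowerSeries K)) _ _
  let fZ := f.restrictScalars (PowerSeries K)
  have hsurj : Function.Surjective fZ := by
    rw [← LinearMap.range_eq_top, eq_top_iff]
    refine Submodule.le_of_le_smul_of_le_jacobson_bot (I := IsLocalRing.maximalIdeal _)
      (Module.Finite.fg_top) (IsLocalRing.jacobson_eq_maximalIdeal ⊥ bot_ne_top).ge fun m _ => ?_
    obtain ⟨m', hm'⟩ := hsq m
    -- From `f = 1 + h` one gets `f (m - h m) = m - h (h m)`, so the image of `f` and `t M` together
    -- give `M`, as Nakayama's lemma requires.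
    refine Submodule.mem_sup.mpr ⟨f (m - h m), ⟨_, rfl⟩, (PowerSeries.X : PowerSeries K) • m',
      Submodule.smul_mem_smul ?_ trivial, ?_⟩
    · rw [IsLocalRing.mem_maximalIdeal]
      exact PowerSeries.X_prime.not_isUnit
    · have hfh : ∀ m, f m = h m + m := fun m => by
        rw [hh, LinearMap.sub_apply, LinearMap.id_apply, sub_add_cancel]
      rw [← hm', hfh, map_sub]
      abel
  exact ⟨OrzechProperty.injective_of_surjective_endomorphism fZ hsurj, hsurj⟩

/-- Lift the isomorphism and its inverse; both composites induce the identity under `π`, so they are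
bijective by minimality. -/
lemma nonempty_iso_of_isMinimal (hk : (k : ℕ) ≠ 0) {M N : ModuleCat.{u} (TwistedRing K n k)}
    (hM : isCM K n k M) (hN : isCM K n k N) (hM' : IsMinimal K n k M) (hN' : IsMinimal K n k N)
    (e : (piFunctor K n k).obj M ≅ (piFunctor K n k).obj N) : Nonempty (M ≅ N) := by
  obtain ⟨f, hf⟩ := exists_lift_of_pi hk hM hN e.hom
  obtain ⟨g, hg⟩ := exists_lift_of_pi hk hN hM e.inv
  have key : ∀ {M N : ModuleCat.{u} (TwistedRing K n k)} (f : M ⟶ N) (g : N ⟶ M),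
      (piFunctor K n k).map f ≫ (piFunctor K n k).map g = 𝟙 _ →
      ∀ m, (g.hom ∘ₗ f.hom) m - m ∈ genZero K n k M := by
    intro M N f g h m
    rw [← piMk_eq_zero_iff, map_sub, sub_eq_zero]
    have h1 := LinearMap.congr_fun (congrArg ModuleCat.Hom.hom h) (piMk M m)
    exact h1
  have h1 := bijective_of_isMinimal hk hM hM' _ (key f g (by rw [hf, hg, e.hom_inv_id]))
  have h2 := bijective_of_isMinimal hk hN hN' _ (key g f (by rw [hf, hg, e.inv_hom_id]))
  have hinj : Function.Injective f.hom := Function.Injective.of_comp (f := g.hom) h1.1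
  have hsurj : Function.Surjective f.hom := Function.Surjective.of_comp (g := g.hom) h2.2
  exact ⟨(LinearEquiv.ofBijective f.hom ⟨hinj, hsurj⟩).toModuleIso⟩

lemma pn_nontrivial (hk : (k : ℕ) ≠ 0) : 0 < Module.finrank (PowerSeries K) (Pn K n k) := by
  rw [Module.finrank_eq_card_basis (pnBasis hk), Fintype.card_fin]
  exact NeZero.pos n

/-- Splitting off copies of `P_n` leads to a minimal module. -/
lemma exists_isMinimal_pi_iso (hk : (k : ℕ) ≠ 0) (d : ℕ) : ∀ (M : Type u) [AddCommGroup M]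
    [Module (TwistedRing K n k) M] [Module (PowerSeries K) M]
    [IsScalarTower (PowerSeries K) (TwistedRing K n k) M],
    isCM K n k (ModuleCat.of (TwistedRing K n k) M) → Module.finrank (PowerSeries K) M = d →
    ∃ M' : ModuleCat.{u} (TwistedRing K n k), isCM K n k M' ∧ IsMinimal K n k M' ∧
      Nonempty ((piFunctor K n k).obj M' ≅
        (piFunctor K n k).obj (ModuleCat.of (TwistedRing K n k) M)) := by
  induction d using Nat.strong_induction_on with
  | _ d ih =>
  intro M _ _ _ _ hM hd
  by_cases hmin : IsMinimal K n k (ModuleCat.of (TwistedRing K n k) M)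
  · exact ⟨_, hM, hmin, ⟨Iso.refl _⟩⟩
  obtain ⟨U, W, hUW, ⟨e⟩⟩ := not_not.mp hmin
  change Submodule (TwistedRing K n k) M at U W
  obtain ⟨_, _⟩ := (isCM_of_iff hk M).mp hM
  have hU : isCM K n k (ModuleCat.of (TwistedRing K n k) U) :=
    isCM_of_injective hk U.subtype Subtype.val_injective
  have hW : isCM K n k (ModuleCat.of (TwistedRing K n k) W) :=
    isCM_of_injective hk W.subtype Subtype.val_injective
  obtain ⟨_, _⟩ := (isCM_of_iff hk U).mp hU
  obtain ⟨_, _⟩ := (isCM_of_iff hk W).mp hW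
  have h1 : Module.finrank (PowerSeries K) M =
      Module.finrank (PowerSeries K) U + Module.finrank (PowerSeries K) W := by
    rw [← Module.finrank_prod]
    exact ((U.prodEquivOfIsCompl W hUW).restrictScalars (PowerSeries K)).finrank_eq.symm
  have h2 : Module.finrank (PowerSeries K) U = Module.finrank (PowerSeries K) (Pn K n k) :=
    (e.restrictScalars (PowerSeries K)).finrank_eq
  have h3 := pn_nontrivial (K := K) hk
  obtain ⟨M', hM', hmin', ⟨i⟩⟩ := ih _ (by omega) W hW rfl
  refine ⟨M', hM', hmin', ⟨i ≪≫ ?_⟩⟩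
  let ι : ModuleCat.of (TwistedRing K n k) W ⟶ ModuleCat.of (TwistedRing K n k) M :=
    ModuleCat.ofHom W.subtype
  let q : M →ₗ[TwistedRing K n k] W := W.projectionOnto U hUW.symm
  have hqW : ∀ w : W, q w = w := fun w => Submodule.projectionOnto_apply_left hUW.symm w
  -- The summand `U`, a copy of `P_n`, is generated by its component at `n` and vanishes under `π`,
  -- so the inclusion of `W` becomes an isomorphism.
  have hU0 : ∀ m ∈ U, m ∈ genZero K n k M := fun m hm => by
    have h4 : e ⟨m, hm⟩ ∈ genZero K n k (Pn K n k) := by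
      have := map_genZero (LinearMap.proj (0 : Fin 1))
        (pi_pn_mem_genZero (fun _ : Fin 1 => e ⟨m, hm⟩))
      exact this
    have h5 := map_genZero (U.subtype ∘ₗ e.symm.toLinearMap) h4
    rw [LinearMap.comp_apply, LinearEquiv.coe_coe, e.symm_apply_apply] at h5
    exact h5
  have hq : ∀ m, m - q m ∈ U := fun m => by
    rw [← Submodule.ker_projectionOnto hUW.symm, LinearMap.mem_ker, map_sub]
    exact sub_eq_zero.mpr (hqW _).symm
  exact
    { hom := (piFunctor K n k).map ι
      inv := (piFunctor K n k).map (ModuleCat.ofHom q)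
      hom_inv_id := by
        rw [← Functor.map_comp, ← (piFunctor K n k).map_id]
        congr 1
        exact ModuleCat.hom_ext (LinearMap.ext hqW)
      inv_hom_id := by
        refine ModuleCat.hom_ext (LinearMap.ext fun u => ?_)
        obtain ⟨m, rfl⟩ := piMk_surjective _ u
        change piMk (ModuleCat.of (TwistedRing K n k) M) ((q m : W) : M) = piMk _ m
        rw [eq_comm, ← sub_eq_zero, ← map_sub, piMk_eq_zero_iff]
        exact hU0 _ (hq m) }

end Minimal

/-! ### The socle of `π M` for a minimal module `M`. -/

section SocleDimension

variable {K : Type u} [Field K] {n : ℕ} {k : Fin n} [NeZero n] [HasEnoughRootsOfUnity K n]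

/-- In a minimal Cohen-Macaulay module, the shortest path from `n` to `k` acts divisibly by `t`. -/
lemma exists_fromZero_smul_eq_X_smul (hk : (k : ℕ) ≠ 0) {M : ModuleCat.{u} (TwistedRing K n k)}
    [Module (PowerSeries K) M] [IsScalarTower (PowerSeries K) (TwistedRing K n k) M]
    [Module.Finite (PowerSeries K) M] [Module.Free (PowerSeries K) M] (hM : IsMinimal K n k M)
    {m : M} (hm : idem K n k n • m = m) : ∃ w : M, idem K n k k • w = w ∧
      (PowerSeries.X : PowerSeries K) • w = fromZero K n k k • m := by
  let B := Module.finBasis (PowerSeries K) M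
  have hdvd : ∀ i, (PowerSeries.X : PowerSeries K) ∣ B.repr (fromZero K n k k • m) i := by
    intro i
    have hm0 : m ∈ genZero K n k M := hm ▸ idem_n_smul_mem m
    -- The map coinduced from the `i`-th coordinate form takes `m` to the `i`-th coordinate of
    -- `fromZero k • m` times the generator of `P_n`; minimality makes that coordinate divisible by
    -- `t`.
    obtain ⟨p, hp⟩ := exists_eq_X_smul_of_isMinimal hk hM (coind hk (B.coord i)) hm0
    have h1 : coind hk (B.coord i) m = B.repr (fromZero K n k k • m) i • pnGen K n k 0 := by
      rw [coind_apply, Finset.sum_eq_single 0]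
      · rw [← hm, ← fromZero_zero, smul_smul, smul_smul, toK_mul_fromZero (Nat.zero_le _),
          fromZero_zero, fromZero_mul_idem, Module.Basis.coord_apply]
      · intro j hj hj0
        rw [← hm, ← fromZero_zero, smul_smul,
          toK_mul_fromZero_ne (NeZero.pos n) (Finset.mem_range.mp hj) hj0, zero_smul, map_zero,
          zero_smul]
      · intro h
        exact absurd (Finset.mem_range.mpr (NeZero.pos n)) h
    rw [h1] at hp
    have h2 := DFunLike.congr_fun (congrArg (pnBasis hk).repr hp) ⟨0, NeZero.pos n⟩
    have h3 : pnGen K n k 0 = pnBasis hk ⟨0, NeZero.pos n⟩ :=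
      (pnBasis_apply hk (⟨0, NeZero.pos n⟩ : Fin n)).symm
    rw [map_smul (pnBasis hk).repr, map_smul (pnBasis hk).repr, h3, Module.Basis.repr_self,
      Finsupp.smul_apply, Finsupp.smul_apply, Finsupp.single_eq_same, smul_eq_mul, mul_one,
      smul_eq_mul] at h2
    exact ⟨_, h2⟩
  choose d hd using hdvd
  have h4 : (PowerSeries.X : PowerSeries K) • ∑ i, d i • B i = fromZero K n k k • m := by
    rw [← B.sum_repr (fromZero K n k k • m), Finset.smul_sum]
    refine Finset.sum_congr rfl fun i _ => ?_
    rw [hd, mul_smul]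
  refine ⟨idem K n k k • ∑ i, d i • B i, ?_, ?_⟩
  · rw [smul_smul, idem_mul_idem_self]
  · rw [← smul_smul_comm', h4, smul_smul, idem_mul_fromZero k.isLt.le]

variable {M : ModuleCat.{u} (TwistedRing K n k)} [Module (PowerSeries K) M]
  [IsScalarTower (PowerSeries K) (TwistedRing K n k) M] [Module.Finite (PowerSeries K) M]
  [Module.Free (PowerSeries K) M]

/-- The elements of `M` that represent elements of the socle of `π M`. -/
lemma piMk_mem_socle (hk : (k : ℕ) ≠ 0) (hCM : isCM K n k M) {m w : M}
    (hw : idem K n k k • w = w)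
    (h : (PowerSeries.X : PowerSeries K) • w = fromZero K n k k • m) :
    piMk M w ∈ socle (Preproj K n) ((piFunctor K n k).obj M) := by
  rw [mem_socle_iff (isSubQ_pi hk hCM), smul_piMk preprojHom_pX, smul_piMk preprojHom_pY,
    smul_piMk (preprojHom_pE k.isLt.le), hw, piMk_eq_zero_iff, piMk_eq_zero_iff]
  refine ⟨?_, ?_, rfl⟩
  · have h1 : yA K n k • (xA K n k • w - fromZero K n k (k + 1) • m) = 0 := by
      rw [smul_sub, smul_smul, ← xA_mul_yA, xA_yA_smul, h, smul_smul,
        yA_mul_fromZero_of_ge le_rfl k.isLt, sub_self]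
    rw [sub_eq_zero.mp (yA_smul_eq_zero h1)]
    exact fromZero_smul_mem _ _
  · obtain ⟨j, hj⟩ : ∃ j, (k : ℕ) = j + 1 := ⟨k - 1, by omega⟩
    have h1 : xA K n k • (yA K n k • w - fromZero K n k j • m) = 0 := by
      rw [smul_sub, smul_smul, xA_yA_smul, h, smul_smul, xA_mul_fromZero_of_lt (by omega), hj,
        sub_self]
    rw [sub_eq_zero.mp (xA_smul_eq_zero h1)]
    exact fromZero_smul_mem _ _

/-- If `x` kills the class, then at the vertex `k + 1` the element `x w` is `fromZero (k + 1) • m`;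
applying `y` turns this into the equation for `t w`. -/
lemma exists_of_mem_socle (hk : (k : ℕ) ≠ 0) (hCM : isCM K n k M)
    {u : (piFunctor K n k).obj M} (hu : u ∈ socle (Preproj K n) ((piFunctor K n k).obj M)) :
    ∃ m w : M, idem K n k n • m = m ∧ u = piMk M w ∧
      (PowerSeries.X : PowerSeries K) • w = fromZero K n k k • m := by
  rw [mem_socle_iff (isSubQ_pi hk hCM)] at hu
  obtain ⟨hx, -, he⟩ := hu
  obtain ⟨w, rfl⟩ := piMk_surjective M u
  rw [smul_piMk preprojHom_pX, piMk_eq_zero_iff] at hx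
  rw [smul_piMk (preprojHom_pE k.isLt.le)] at he
  obtain ⟨m, hm, h⟩ := exists_fromZero_smul hk (show (k : ℕ) + 1 ≤ n from k.isLt) hx
  refine ⟨m, idem K n k k • w, hm, he.symm, ?_⟩
  have h1 : yA K n k • xA K n k • idem K n k k • w = yA K n k • fromZero K n k (k + 1) • m := by
    rw [smul_smul (xA K n k), ← idem_mul_xA, mul_smul, h]
  rw [smul_smul, ← xA_mul_yA, xA_yA_smul, smul_smul, yA_mul_fromZero_of_ge le_rfl k.isLt] at h1
  exact h1

/-- By the previous lemmas the socle consists of the classes of `t⁻¹ fromZero k • m` with `m` in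
`e_n M`, where minimality makes the division possible for every `m`. Such a class vanishes exactly
for `m` in `t e_n M`, so the elements `w i` attached to the basis `b` give a basis of the socle. -/
lemma dimSocle_pi (hk : (k : ℕ) ≠ 0) (hCM : isCM K n k M) (hM : IsMinimal K n k M) {r : ℕ}
    {b : Fin r → M} (hb : IsVertexBasis K n k b) : dimSocle K n ((piFunctor K n k).obj M) = r := by
  choose w hwe hw using fun i => exists_fromZero_smul_eq_X_smul hk hM (hb.idem_smul i)
  let _ : Module K ((piFunctor K n k).obj M) := Module.restrictScalars K (Preproj K n) _
  have : IsScalarTower K (Preproj K n) ((piFunctor K n k).obj M) :=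
    IsScalarTower.restrictScalars K (Preproj K n) _
  have hsum : ∀ c : Fin r → K, ∑ i, c i • piMk M (w i) =
      piMk M (∑ i, PowerSeries.C (c i) • w i) := fun c => by
    rw [map_sum]
    refine Finset.sum_congr rfl fun i _ => ?_
    rw [← algebraMap_smul_piMk, algebraMap_smul]
  have hX : ∀ c : Fin r → K, (PowerSeries.X : PowerSeries K) • ∑ i, PowerSeries.C (c i) • w i =
      fromZero K n k k • ∑ i, PowerSeries.C (c i) • b i := fun c => by
    rw [Finset.smul_sum, Finset.smul_sum]
    refine Finset.sum_congr rfl fun i _ => ?_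
    rw [smul_comm, hw, smul_smul_comm']
  have hfix : ∀ c : Fin r → PowerSeries K, idem K n k n • ∑ i, c i • b i = ∑ i, c i • b i :=
    fun c => by
    rw [Finset.smul_sum]
    refine Finset.sum_congr rfl fun i _ => ?_
    rw [smul_smul_comm', hb.idem_smul]
  let L : (Fin r → K) →ₗ[K] (piFunctor K n k).obj M := Fintype.linearCombination K fun i => piMk M (w i)
  have hL : ∀ c, L c = ∑ i, c i • piMk M (w i) := fun c => Fintype.linearCombination_apply _ _ _
  have hinj : Function.Injective L := by
    refine (injective_iff_map_eq_zero L).mpr fun c hc => ?_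
    rw [hL, hsum, piMk_eq_zero_iff] at hc
    obtain ⟨m, hm, h⟩ := exists_fromZero_smul hk k.isLt.le hc
    have hwk : idem K n k k • ∑ i, PowerSeries.C (c i) • w i = ∑ i, PowerSeries.C (c i) • w i := by
      rw [Finset.smul_sum]
      refine Finset.sum_congr rfl fun i _ => ?_
      rw [smul_smul_comm', hwe]
    rw [hwk] at h
    obtain ⟨d, rfl⟩ := hb.exists_sum m hm
    -- A vanishing combination of the `w i` yields, after multiplication by `t` and cancellation of
    -- the path, `∑ c_i b_i = t ∑ d_i b_i`; comparing constant terms gives `c = 0`.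
    have h1 : fromZero K n k k •
        ∑ i, (PowerSeries.C (c i) - PowerSeries.X * d i) • b i = 0 := by
      simp only [sub_smul, Finset.sum_sub_distrib, smul_sub]
      rw [← hX, h, sub_eq_zero, ← smul_smul_comm', Finset.smul_sum]
      simp only [mul_smul]
    have h2 := fromZero_smul_eq_zero h1
    rw [hfix] at h2
    funext i
    have h3 := Fintype.linearIndependent_iff.mp hb.linearIndependent _ h2 i
    have h4 := congrArg PowerSeries.constantCoeff (sub_eq_zero.mp h3)
    simpa using h4
  have hrange : ∀ u, u ∈ socle (Preproj K n) ((piFunctor K n k).obj M) ↔ ∃ c, L c = u := by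
    intro u
    constructor
    · intro hu
      obtain ⟨m, v, hm, rfl, hv⟩ := exists_of_mem_socle hk hCM hu
      obtain ⟨d, rfl⟩ := hb.exists_sum m hm
      -- Only the constant terms of the coefficients matter: the remaining part `t d'` contributes
      -- `fromZero k • ∑ d'_i b_i`, which is zero in `π M`.
      have hd : ∀ i, ∃ d', d i = PowerSeries.C (PowerSeries.constantCoeff (d i)) +
          PowerSeries.X * d' := fun i => by
        obtain ⟨d', hd'⟩ := PowerSeries.X_dvd_iff.mpr (show PowerSeries.constantCoeff
          (d i - PowerSeries.C (PowerSeries.constantCoeff (d i))) = 0 by simp)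
        exact ⟨d', by rw [← hd']; ring⟩
      choose d' hd' using hd
      refine ⟨fun i => PowerSeries.constantCoeff (d i), ?_⟩
      have h1 : (PowerSeries.X : PowerSeries K) •
          (v - ∑ i, PowerSeries.C (PowerSeries.constantCoeff (d i)) • w i -
            fromZero K n k k • ∑ i, d' i • b i) = 0 := by
        rw [smul_sub, smul_sub, hX, hv, ← smul_smul_comm', ← smul_sub, ← smul_sub]
        have : ∑ i, d i • b i - ∑ i, PowerSeries.C (PowerSeries.constantCoeff (d i)) • b i -
            (PowerSeries.X : PowerSeries K) • ∑ i, d' i • b i = 0 := by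
          rw [Finset.smul_sum, ← Finset.sum_sub_distrib, ← Finset.sum_sub_distrib]
          refine Finset.sum_eq_zero fun i _ => ?_
          nth_rewrite 1 [hd' i]
          rw [add_smul, mul_smul]
          abel
        rw [this, smul_zero]
      have h2 := (smul_eq_zero.mp h1).resolve_left PowerSeries.X_ne_zero
      rw [hL, hsum, eq_comm, ← sub_eq_zero, ← map_sub, sub_eq_zero.mp h2, piMk_eq_zero_iff]
      exact fromZero_smul_mem _ _
    · rintro ⟨c, rfl⟩
      rw [hL]
      refine Submodule.sum_mem _ fun i _ => ?_
      rw [← algebraMap_smul (Preproj K n)]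
      exact Submodule.smul_mem _ _ (piMk_mem_socle hk hCM (hwe i) (hw i))
  let L' : (Fin r → K) →ₗ[K] socle (Preproj K n) ((piFunctor K n k).obj M) :=
    { toFun := fun c => ⟨L c, (hrange _).mpr ⟨c, rfl⟩⟩
      map_add' := fun c d => Subtype.ext (map_add L c d)
      map_smul' := fun a c => Subtype.ext (map_smul L a c) }
  have e := LinearEquiv.ofBijective L' ⟨fun c d h => hinj (congrArg Subtype.val h), fun u => by
    obtain ⟨c, hc⟩ := (hrange u).mp u.2
    exact ⟨c, Subtype.ext hc⟩⟩
  unfold dimSocle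
  have h := e.finrank_eq
  rw [Module.finrank_fin_fun] at h
  rw [h]

end SocleDimension

/-! ### The rank -/

section Tensor

variable {Z A L M N : Type u} [CommRing Z] [Ring A] [Algebra Z A] [Field L] [Algebra Z L]
  [AddCommGroup M] [Module Z M] [Module A M] [IsScalarTower Z A M]
  [AddCommGroup N] [Module Z N] [Module A N] [IsScalarTower Z A N]

variable (Z A L M) in
/-- The `A ⊗ L`-module structure on `M ⊗ L`. -/
abbrev tensorModule : Module (A ⊗[Z] L) (M ⊗[Z] L) :=
  Module.compHom _ (tensorAction Z A L M).toRingHom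

attribute [local instance] tensorModule

variable (Z A L M) in
lemma lengthTensor_eq : lengthTensor Z A L M = Module.length (A ⊗[Z] L) (M ⊗[Z] L) := by
  have h : Module.restrictScalars Z A M = ‹Module Z M› :=
    Module.ext' _ _ fun c m => algebraMap_smul A c m
  subst h
  rfl

lemma tmul_smul_tmul (a : A) (l l' : L) (m : M) :
    (a ⊗ₜ[Z] l : A ⊗[Z] L) • (m ⊗ₜ[Z] l') = (a • m) ⊗ₜ[Z] (l * l') := rfl

lemma one_tmul_algebraMap_smul (z : Z) (v : M ⊗[Z] L) :
    ((1 : A) ⊗ₜ[Z] (algebraMap Z L z) : A ⊗[Z] L) • v = z • v := by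
  induction v with
  | zero => simp
  | tmul m l => rw [tmul_smul_tmul, one_smul, ← Algebra.smul_def, tmul_smul]
  | add v w hv hw => rw [smul_add, smul_add, hv, hw]

/-- The base change of a map of `A`-modules. -/
def tensorMap (f : M →ₗ[A] N) : M ⊗[Z] L →ₗ[A ⊗[Z] L] N ⊗[Z] L where
  toFun := (f.restrictScalars Z).rTensor L
  map_add' := map_add _
  map_smul' c v := by
    induction c with
    | zero => simp
    | add c d hc hd => rw [add_smul, map_add, hc, hd]; exact (add_smul c d _).symm
    | tmul a l =>
      induction v with
      | zero => simp
      | add v w hv hw => rw [smul_add, map_add, hv, hw, map_add, smul_add]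
      | tmul m l' =>
        rw [tmul_smul_tmul, LinearMap.rTensor_tmul, LinearMap.rTensor_tmul, RingHom.id_apply,
          tmul_smul_tmul, LinearMap.restrictScalars_apply, map_smul]
        rfl

lemma tensorMap_tmul (f : M →ₗ[A] N) (m : M) (l : L) :
    tensorMap (Z := Z) f (m ⊗ₜ l) = f m ⊗ₜ l := rfl

variable [IsDomain Z] [IsFractionRing Z L]

lemma inv_smul_smul_tensor {z : Z} (hz : z ≠ 0) (v : M ⊗[Z] L) :
    ((1 : A) ⊗ₜ[Z] (algebraMap Z L z)⁻¹ : A ⊗[Z] L) • z • v = v := by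
  have h : algebraMap Z L z ≠ 0 := fun h =>
    hz (IsFractionRing.injective Z L (h.trans (map_zero _).symm))
  rw [← one_tmul_algebraMap_smul (A := A), smul_smul, Algebra.TensorProduct.tmul_mul_tmul,
    one_mul, inv_mul_cancel₀ h, ← Algebra.TensorProduct.one_def, one_smul]

lemma exists_smul_eq_tmul_one (v : M ⊗[Z] L) :
    ∃ (z : Z) (m : M), z ≠ 0 ∧ z • v = m ⊗ₜ (1 : L) := by
  induction v with
  | zero => exact ⟨1, 0, one_ne_zero, by simp⟩
  | tmul m l =>
    obtain ⟨a, s, hs, rfl⟩ := IsFractionRing.div_surjective (A := Z) l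
    have hs0 := nonZeroDivisors.ne_zero hs
    have h : algebraMap Z L s ≠ 0 := fun h =>
      hs0 (IsFractionRing.injective Z L (h.trans (map_zero _).symm))
    refine ⟨s, a • m, hs0, ?_⟩
    rw [← tmul_smul, Algebra.smul_def, mul_div_cancel₀ _ h, smul_tmul, Algebra.algebraMap_eq_smul_one]
  | add v w hv hw =>
    obtain ⟨s, m, hs, hv⟩ := hv
    obtain ⟨t, m', ht, hw⟩ := hw
    refine ⟨s * t, t • m + s • m', mul_ne_zero hs ht, ?_⟩
    rw [smul_add, mul_smul, mul_smul, smul_comm s t v, hv, hw, add_tmul, smul_tmul', smul_tmul']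

lemma tmul_one_injective [Module.Flat Z M] :
    Function.Injective fun m : M => m ⊗ₜ[Z] (1 : L) := by
  have h := Module.Flat.lTensor_preserves_injective_linearMap (M := M) (Algebra.linearMap Z L)
    (IsFractionRing.injective Z L)
  intro m m' hm
  refine (TensorProduct.rid Z M).symm.injective (h ?_)
  simpa using hm

lemma tensorMap_injective {f : M →ₗ[A] N} (hf : Function.Injective f) :
    Function.Injective (tensorMap (Z := Z) (L := L) f) := by
  have : Module.Flat Z L := IsLocalization.flat L (nonZeroDivisors Z)
  exact Module.Flat.rTensor_preserves_injective_linearMap (M := L) (f.restrictScalars Z) hf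

/-- The hypothesis says that the cokernel of `f` is torsion, so it vanishes over the fraction field.
-/
lemma tensorMap_surjective {f : M →ₗ[A] N}
    (hf : ∀ m : N, ∃ z : Z, z ≠ 0 ∧ ∃ p, f p = z • m) :
    Function.Surjective (tensorMap (Z := Z) (L := L) f) := by
  intro v
  obtain ⟨s, m, hs, hv⟩ := exists_smul_eq_tmul_one v
  obtain ⟨z, hz, p, hp⟩ := hf m
  refine ⟨((1 : A) ⊗ₜ[Z] (algebraMap Z L (z * s))⁻¹ : A ⊗[Z] L) • (p ⊗ₜ[Z] (1 : L)), ?_⟩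
  rw [map_smul, tensorMap_tmul, hp, ← smul_tmul', ← hv, smul_smul,
    inv_smul_smul_tensor (mul_ne_zero hz hs)]

/-- If any two nonzero cyclic submodules of `M` are commensurable then `M ⊗ L` is simple. -/
lemma isSimpleModule_tensor [Module.Flat Z M] [Nontrivial M]
    (h : ∀ p q : M, p ≠ 0 → ∃ (a : A) (z : Z), z ≠ 0 ∧ a • p = z • q) :
    IsSimpleModule (A ⊗[Z] L) (M ⊗[Z] L) := by
  have : Nontrivial (M ⊗[Z] L) := (tmul_one_injective (Z := Z) (L := L) (M := M)).nontrivial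
  rw [isSimpleModule_iff_toSpanSingleton_surjective]
  refine ⟨this, fun v hv w => ?_⟩
  obtain ⟨s, p, hs, hp⟩ := exists_smul_eq_tmul_one v
  obtain ⟨t, q, ht, hq⟩ := exists_smul_eq_tmul_one w
  have hp0 : p ≠ 0 := by
    rintro rfl
    rw [zero_tmul] at hp
    apply hv
    rw [← inv_smul_smul_tensor (A := A) hs v, hp, smul_zero]
  -- After clearing denominators, `s v = p ⊗ 1` and `t w = q ⊗ 1`; from `a p = z q` one gets `w = (z
  -- t)⁻¹ a s v`.
  obtain ⟨a, z, hz, ha⟩ := h p q hp0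
  refine ⟨((1 : A) ⊗ₜ[Z] (algebraMap Z L (z * t))⁻¹ : A ⊗[Z] L) *
    ((a ⊗ₜ[Z] (1 : L)) * ((1 : A) ⊗ₜ[Z] algebraMap Z L s)), ?_⟩
  rw [LinearMap.toSpanSingleton_apply, mul_smul, mul_smul, one_tmul_algebraMap_smul, hp,
    tmul_smul_tmul, ha, one_mul, ← smul_tmul', ← hq, smul_smul,
    inv_smul_smul_tensor (mul_ne_zero hz ht)]

lemma length_pi_tensor (r : ℕ) :
    Module.length (A ⊗[Z] L) ((Fin r → M) ⊗[Z] L) = r * Module.length (A ⊗[Z] L) (M ⊗[Z] L) := by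
  let p : (Fin r → M) ⊗[Z] L →ₗ[A ⊗[Z] L] (Fin r → M ⊗[Z] L) :=
    LinearMap.pi fun i => tensorMap (LinearMap.proj (R := A) i)
  let q : (Fin r → M ⊗[Z] L) →ₗ[A ⊗[Z] L] (Fin r → M) ⊗[Z] L :=
    ∑ i, tensorMap (LinearMap.single A (fun _ => M) i) ∘ₗ LinearMap.proj i
  have hqp : ∀ v, q (p v) = v := fun v => by
    induction v with
    | zero => simp
    | add v w hv hw => rw [map_add, map_add, hv, hw]
    | tmul m l =>
      simp only [q, p, LinearMap.sum_apply, LinearMap.comp_apply, LinearMap.proj_apply,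
        LinearMap.pi_apply, tensorMap_tmul, ← sum_tmul]
      congr 1
      exact Finset.univ_sum_single m
  have hsum : ∀ i (v : M ⊗[Z] L), p (tensorMap (LinearMap.single A (fun _ => M) i) v) =
      Pi.single i v := fun i v => by
    induction v with
    | zero => simp
    | add v w hv hw => rw [map_add, map_add, hv, hw, Pi.single_add]
    | tmul m l =>
      funext j
      change (Pi.single i m : Fin r → M) j ⊗ₜ[Z] l = _
      rcases eq_or_ne j i with rfl | h
      · simp
      · simp [Pi.single_eq_of_ne h]
  have hpq : ∀ v, p (q v) = v := fun v => by
    simp only [q, LinearMap.sum_apply, LinearMap.comp_apply, LinearMap.proj_apply, map_sum, hsum]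
    exact Finset.univ_sum_single v
  let e : ((Fin r → M) ⊗[Z] L) ≃ₗ[A ⊗[Z] L] (Fin r → M ⊗[Z] L) :=
    LinearEquiv.ofLinearMap p q (LinearMap.ext hpq) (LinearMap.ext hqp)
  rw [e.length_eq, Module.length_pi_of_fintype]
  simp

end Tensor

/-! ### The rank as the rank of the component at `n`. -/

section Rank

variable {K : Type u} [Field K] {n : ℕ} [NeZero n] [HasEnoughRootsOfUnity K n] {k : Fin n}

attribute [local instance] tensorModule

/-- Project `p` to a vertex where its coordinate is nonzero, return to the vertex `0` at the cost of
a power of `t`, and send the generator to `q`. -/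
lemma commensurable_pn (hk : (k : ℕ) ≠ 0) (p q : Pn K n k) (hp : p ≠ 0) :
    ∃ (a : TwistedRing K n k) (z : PowerSeries K), z ≠ 0 ∧ a • p = z • q := by
  obtain ⟨j, hj⟩ : ∃ j, (pnBasis hk).repr p j ≠ 0 := by
    by_contra! h
    exact hp ((pnBasis hk).repr.injective (Finsupp.ext fun i => by simpa using h i))
  obtain ⟨a, rfl⟩ := eq_smul_pnGen q
  obtain ⟨b, m, hb⟩ := exists_mul_fromZero (K := K) k j
  have h : b • pnGen K n k j = (PowerSeries.X : PowerSeries K) ^ m • pnGen K n k 0 :=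
    Subtype.ext (hb.trans (by rw [← fromZero_zero]; rfl))
  refine ⟨a * b * idem K n k j, (pnBasis hk).repr p j * PowerSeries.X ^ m,
    mul_ne_zero hj (pow_ne_zero _ PowerSeries.X_ne_zero), ?_⟩
  rw [mul_smul, idem_smul_pn hk, mul_smul, smul_smul_comm' b, h, smul_smul, smul_smul_comm']

/-- `P_n ^ r → M` is injective with cokernel killed by `t ^ n`, so it becomes an isomorphism over
the fraction field, where `P_n` becomes simple by `commensurable_pn`. -/
lemma rk_eq (hk : (k : ℕ) ≠ 0) {M : ModuleCat.{u} (TwistedRing K n k)} [Module (PowerSeries K) M]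
    [IsScalarTower (PowerSeries K) (TwistedRing K n k) M] [Module.Finite (PowerSeries K) M]
    [Module.Free (PowerSeries K) M] {r : ℕ} {b : Fin r → M} (hb : IsVertexBasis K n k b) :
    rk K n k M = r := by
  have hfree := ((isCM_of_iff hk (Pn K n k)).mp (isCM_pn hk)).2
  have hnt : Nontrivial (Pn K n k) := ⟨pnGen K n k 0, 0, by
    rw [← pnBasis_apply hk (⟨0, NeZero.pos n⟩ : Fin n)]
    exact (pnBasis hk).ne_zero _⟩
  have hs : IsSimpleModule (TwistedRing K n k ⊗[PowerSeries K] FractionRing (PowerSeries K))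
      (Pn K n k ⊗[PowerSeries K] FractionRing (PowerSeries K)) :=
    isSimpleModule_tensor (commensurable_pn hk)
  have e := LinearEquiv.ofBijective
    (tensorMap (Z := PowerSeries K) (L := FractionRing (PowerSeries K)) (pnSum K n k b))
    ⟨tensorMap_injective (hb.pnSum_injective hk), tensorMap_surjective fun m =>
      ⟨PowerSeries.X ^ n, pow_ne_zero _ PowerSeries.X_ne_zero,
        hb.exists_pnSum_eq (X_pow_n_smul_mem m)⟩⟩
  rw [rk, lengthTensor_eq, ← e.length_eq, length_pi_tensor, Module.length_eq_one, mul_one]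

end Rank

/-! ### The restriction of `π` to `CM(A)` -/

section Main

variable {K : Type u} [Field K] {n : ℕ} [NeZero n] [HasEnoughRootsOfUnity K n] {k : Fin n}
  (hπ : ∀ M : (isCM K n k).FullSubcategory,
    isSubQ K n k (((isCM K n k).ι ⋙ piFunctor K n k).obj M))

lemma piCM_map_eq_iff {M N : (isCM K n k).FullSubcategory} (f g : M ⟶ N) :
    (piCM K n k hπ).map f = (piCM K n k hπ).map g ↔
      ∀ m : M.obj, (f.hom - g.hom).hom m ∈ genZero K n k N.obj := by
  have h : (piCM K n k hπ).map f = (piCM K n k hπ).map g ↔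
      (piFunctor K n k).map f.hom = (piFunctor K n k).map g.hom :=
    ⟨fun h => congrArg (fun φ => φ.hom) h, fun h => ObjectProperty.hom_ext _ h⟩
  rw [h]
  constructor
  · intro h m
    rw [← piMk_eq_zero_iff, ← piFunctor_map_piMk, Functor.map_sub, h, sub_self]
    rfl
  · intro h
    rw [← sub_eq_zero, ← Functor.map_sub]
    refine ModuleCat.hom_ext (LinearMap.ext fun u => ?_)
    obtain ⟨m, rfl⟩ := piMk_surjective M.obj u
    rw [piFunctor_map_piMk, piMk_eq_zero_iff.mpr (h m)]
    rfl

lemma inIdealPn_iff (hk : (k : ℕ) ≠ 0) {M N : (isCM K n k).FullSubcategory} (f : M ⟶ N) :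
    InIdealPn K n k f ↔ ∀ m : M.obj, f.hom.hom m ∈ genZero K n k N.obj := by
  let _ : Module (PowerSeries K) N.obj :=
    Module.restrictScalars (PowerSeries K) (TwistedRing K n k) N.obj
  have : IsScalarTower (PowerSeries K) (TwistedRing K n k) N.obj :=
    IsScalarTower.restrictScalars _ _ _
  obtain ⟨_, _⟩ := N.property.finite_free hk
  exact (factors_iff_range_le hk f.hom.hom).symm

lemma piCM_map_eq_zero_iff (hk : (k : ℕ) ≠ 0) {M N : (isCM K n k).FullSubcategory} (f : M ⟶ N) :
    (piCM K n k hπ).map f = 0 ↔ InIdealPn K n k f := by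
  have h := piCM_map_eq_iff hπ f 0
  have h0 : (piCM K n k hπ).map (0 : M ⟶ N) = 0 :=
    ObjectProperty.hom_ext _ ((piFunctor K n k).map_zero M.obj N.obj)
  have h1 : f.hom - (0 : M ⟶ N).hom = f.hom := sub_zero f.hom
  rw [h0, h1] at h
  rw [h, inIdealPn_iff hk]

lemma piCM_map_eq_iff_idealRel (hk : (k : ℕ) ≠ 0) {M N : (isCM K n k).FullSubcategory}
    (f g : M ⟶ N) : (piCM K n k hπ).map f = (piCM K n k hπ).map g ↔ idealRel K n k f g := by
  rw [piCM_map_eq_iff, idealRel, inIdealPn_iff hk]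
  rfl

lemma isEquivalence_lift_piCM (hk : (k : ℕ) ≠ 0)
    (H : ∀ (M N : (isCM K n k).FullSubcategory) (f g : M ⟶ N), idealRel K n k f g →
      (piCM K n k hπ).map f = (piCM K n k hπ).map g) :
    (CategoryTheory.Quotient.lift (idealRel K n k) (piCM K n k hπ) H).IsEquivalence where
  faithful := ⟨fun {M N} f g h => by
    obtain ⟨f, rfl⟩ := (Quotient.functor (idealRel K n k)).map_surjective f
    obtain ⟨g, rfl⟩ := (Quotient.functor (idealRel K n k)).map_surjective g
    exact CategoryTheory.Quotient.sound _ ((piCM_map_eq_iff_idealRel hπ hk f g).mp h)⟩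
  full := ⟨fun {M N} g => by
    obtain ⟨f, hf⟩ := exists_lift_of_pi hk M.as.property N.as.property g.hom
    exact ⟨(Quotient.functor (idealRel K n k)).map (ObjectProperty.homMk f),
      ObjectProperty.hom_ext _ hf⟩⟩
  essSurj := ⟨fun N => by
    obtain ⟨M, hM, ⟨e⟩⟩ := exists_isCM_pi_iso hk N.property
    exact ⟨⟨⟨M, hM⟩⟩, ⟨ObjectProperty.isoMk _ e⟩⟩⟩

lemma exists_minimal_lift (hk : (k : ℕ) ≠ 0) (N : (isSubQ K n k).FullSubcategory) :
    ∃ M : (isCM K n k).FullSubcategory, IsMinimal K n k M.obj ∧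
      Nonempty ((piCM K n k hπ).obj M ≅ N) ∧
        ∀ M' : (isCM K n k).FullSubcategory, IsMinimal K n k M'.obj →
          Nonempty ((piCM K n k hπ).obj M' ≅ N) → Nonempty (M' ≅ M) := by
  obtain ⟨M₀, hM₀, ⟨e₀⟩⟩ := exists_isCM_pi_iso hk N.property
  let _ : Module (PowerSeries K) M₀ := Module.restrictScalars (PowerSeries K) (TwistedRing K n k) M₀
  have : IsScalarTower (PowerSeries K) (TwistedRing K n k) M₀ := IsScalarTower.restrictScalars _ _ _
  obtain ⟨M, hCM, hM, ⟨e⟩⟩ := exists_isMinimal_pi_iso hk _ M₀ hM₀ rfl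
  refine ⟨⟨M, hCM⟩, hM, ⟨ObjectProperty.isoMk _ (e ≪≫ e₀)⟩, ?_⟩
  rintro M' hM' ⟨e'⟩
  obtain ⟨i⟩ := nonempty_iso_of_isMinimal hk M'.property hCM hM' hM
    ((isSubQ K n k).ι.mapIso e' ≪≫ (e ≪≫ e₀).symm)
  exact ⟨ObjectProperty.isoMk _ i⟩

lemma rk_eq_dimSocle (hk : (k : ℕ) ≠ 0) {M : ModuleCat.{u} (TwistedRing K n k)}
    (hCM : isCM K n k M) (hM : IsMinimal K n k M) :
    rk K n k M = dimSocle K n ((piFunctor K n k).obj M) := by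
  let _ : Module (PowerSeries K) M := Module.restrictScalars (PowerSeries K) (TwistedRing K n k) M
  have : IsScalarTower (PowerSeries K) (TwistedRing K n k) M := IsScalarTower.restrictScalars _ _ _
  obtain ⟨_, _⟩ := hCM.finite_free hk
  obtain ⟨r, b, hb⟩ := exists_isVertexBasis K n k M
  rw [rk_eq hk hb, dimSocle_pi hk hCM hM hb]

end Main

end GrassCM

end

open GrassCM in
/-- `K` is a field containing a primitive `n`-th root of unity, so that `G` is cyclic of order `n`;
`0 < k < n`; `A = K[[x, y]] / (x ^ k - y ^ (n - k)) * G`. -/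
theorem theorem4p5 (K : Type u) [Field K] (n : ℕ) [NeZero n] [HasEnoughRootsOfUnity K n]
    (k : Fin n) (hk : (k : ℕ) ≠ 0) :
    -- `P_n` is a projective-injective object of the exact category `CM(A)`
    (isCM K n k (ModuleCat.of (TwistedRing K n k) (Pn K n k)) ∧
      Module.Projective (TwistedRing K n k) (Pn K n k) ∧
      ∀ S : ShortComplex (ModuleCat.{u} (TwistedRing K n k)),
        isCM K n k S.X₁ → isCM K n k S.X₂ → isCM K n k S.X₃ → S.ShortExact →
          ∀ g : S.X₁ ⟶ ModuleCat.of (TwistedRing K n k) (Pn K n k), ∃ h, S.f ≫ h = g) ∧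
    -- `π` takes `CM(A)` to `Sub Q_k`
    ∃ hπ : ∀ M : (isCM K n k).FullSubcategory,
        isSubQ K n k (((isCM K n k).ι ⋙ piFunctor K n k).obj M),
      -- `π` is exact on `CM(A)`
      (∀ S : ShortComplex (ModuleCat.{u} (TwistedRing K n k)),
        isCM K n k S.X₁ → isCM K n k S.X₂ → isCM K n k S.X₃ → S.ShortExact →
          (S.map (piFunctor K n k)).ShortExact) ∧
      -- the kernel of `π` is the ideal generated by `P_n`, and `π` is the quotient by it
      (∀ (M N : (isCM K n k).FullSubcategory) (f : M ⟶ N), (piCM K n k hπ).map f = 0 ↔ InIdealPn K n k f) ∧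
      (∃ H, (CategoryTheory.Quotient.lift (idealRel K n k) (piCM K n k hπ) H).IsEquivalence) ∧
      -- existence and uniqueness of minimal lifts
      (∀ N : (isSubQ K n k).FullSubcategory,
        ∃ M : (isCM K n k).FullSubcategory, IsMinimal K n k M.obj ∧ Nonempty ((piCM K n k hπ).obj M ≅ N) ∧
          ∀ M' : (isCM K n k).FullSubcategory,
            IsMinimal K n k M'.obj → Nonempty ((piCM K n k hπ).obj M' ≅ N) → Nonempty (M' ≅ M)) ∧
      -- the rank of a minimal lift
      (∀ M : (isCM K n k).FullSubcategory, IsMinimal K n k M.obj →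
        rk K n k M.obj = (dimSocle K n ((piCM K n k hπ).obj M).obj : ℕ∞)) := by
  exact ⟨⟨isCM_pn hk, projective_pn, fun S _ _ h₃ hS g => exists_extension_of_shortExact hk S h₃ hS g⟩,
    fun M => isSubQ_pi hk M.property, fun S _ h₂ h₃ hS => shortExact_map_pi hk S h₂ h₃ hS,
    fun _ _ f => piCM_map_eq_zero_iff _ hk f,
    ⟨fun _ _ f g => (piCM_map_eq_iff_idealRel _ hk f g).mpr, isEquivalence_lift_piCM _ hk _⟩,
    exists_minimal_lift _ hk, fun M hM => rk_eq_dimSocle hk M.property hM⟩
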